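/- Let $X$ be a random variable with values in an arbitrary measurable space (for instance discrete or real-valued), and let $Z$ be a real random variable all of whose moments are finite, such that the first two conditional moments of $Z$ do not depend on $X$: $$\mathbb E(Z\mid X)=\mathbb E(Z)\quad\text{and}\quad \mathbb E(Z^2\mid X)=\mathbb E(Z^2)\quad\text{a.s.}$$ For $\sigma_N>0$ let $Y=Z+N$, where $N\sim\mathcal N(0,\sigma_N^2)$ is independent of $(X,Z)$, and put $\sigma^2=\mathrm{Var}(Y)=\sigma_N^2+\mathrm{Var}(Z)$. For a probability law on $\mathbb R$ with characteristic function $\varphi$ and finite moments, the cumulants are $\kappa_k=i^{-k}\frac{d^k}{dt^k}\log\varphi(t)\big|_{t=0}$; write $\kappa_k=\kappa_k(Z)$ for those of the law of $Z$, and $\kappa_k(Z|X)$ for the random variable whose value on $\{X=x\}$ is the $k$-th cumulant of the conditional law of $Z$ given $X=x$. Let $I(X;Y)$ be the mutual information in nats, i.e. the Kullback–Leibler divergence of the joint law of $(X,Y)$ from the product of its marginal laws. Then $I(X;Y)<\infty$ for every $\sigma_N>0$, all products of powers of $\kappa_3(Z|X),\dots,\kappa_6(Z|X)$ are integrable, and,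 for fixed $(X,Z)$, as $\sigma_N\to\infty$, $$\begin{aligned} I(X;Y)={}&\frac{\mathbb E\,\kappa_3^2(Z|X)-\kappa_3^2(Z)}{12\sigma^6}+\frac{\mathbb E\,\kappa_4^2(Z|X)-\kappa_4^2(Z)}{48\sigma^8}\\ &-\frac{\mathbb E\bigl(\kappa_3^2(Z|X)\kappa_4(Z|X)\bigr)-\kappa_3^2(Z)\kappa_4(Z)}{8\sigma^{10}}+\frac{\mathbb E\,\kappa_5^2(Z|X)-\kappa_5^2(Z)}{240\sigma^{10}}\\ &+\frac{7\bigl(\mathbb E\,\kappa_3^4(Z|X)-\kappa_3^4(Z)\bigr)}{48\sigma^{12}}-\frac{\mathbb E\,\kappa_4^3(Z|X)-\kappa_4^3(Z)}{48\sigma^{12}}\\ &-\frac{\mathbb E\bigl(\kappa_3(Z|X)\kappa_4(Z|X)\kappa_5(Z|X)\bigr)-\kappa_3(Z)\kappa_4(Z)\kappa_5(Z)}{12\sigma^{12}}+\frac{\mathbb E\,\kappa_6^2(Z|X)-\kappa_6^2(Z)}{1440\sigma^{12}}+O\Bigl(\frac1{\sigma^{14}}\Bigr). \end{aligned}$$ 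-/

import Mathlib

open MeasureTheory ProbabilityTheory InformationTheory Filter Asymptotics
open scoped ENNReal NNReal

/-- The `k`-th cumulant of a probability measure `ν` on the real line: `κ_k = i⁻ᵏ ψ⁽ᵏ⁾(0)` for
`ψ(t) = log φ_ν(t)`, where `φ_ν(t) = ∫ e^{ity} dν(y)` is the characteristic function, so that
`log φ_ν(t) = ∑ κ_k (it)ᵏ / k!` near `0`. (The right-hand side is a real number as soon as `ν` has
a finite moment of order `k`.) -/
noncomputable def cumulant (ν : Measure ℝ) (k : ℕ) : ℝ :=
  ((-Complex.I) ^ k * iteratedDeriv k (fun t : ℝ => Complex.log (charFun ν t)) 0).re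

/-- `κ_k(Z)`: the `k`-th cumulant of the law of a real random variable `Z`. -/
noncomputable def cumulantRV {Ω : Type*} [MeasurableSpace Ω] (P : Measure Ω)
    (Z : Ω → ℝ) (k : ℕ) : ℝ :=
  cumulant (P.map Z) k

/-- `κ_k(Z | X = x)`: the `k`-th cumulant of the (regular) conditional law of `Z` given `X = x`. -/
noncomputable def condCumulant {Ω 𝓧 : Type*} [MeasurableSpace Ω] [MeasurableSpace 𝓧]
    (P : Measure Ω) [IsFiniteMeasure P] (Z : Ω → ℝ) (X : Ω → 𝓧) (k : ℕ) (x : 𝓧) : ℝ :=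
  cumulant (condDistrib Z X P x) k

/-- Mutual information `I(X;Y)`, in nats: the Kullback-Leibler divergence of the joint law of
`(X, Y)` from the product of the marginal laws. -/
noncomputable def mutualInfo {Ω 𝓧 𝓨 : Type*} [MeasurableSpace Ω] [MeasurableSpace 𝓧]
    [MeasurableSpace 𝓨] (P : Measure Ω) (X : Ω → 𝓧) (Y : Ω → 𝓨) : ℝ≥0∞ :=
  klDiv (P.map (fun ω => (X ω, Y ω))) ((P.map X).prod (P.map Y))

/-! ### Gaussian expectations of polynomials and the Hermite polynomials. -/

namespace GaussHermite
open Polynomial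

/-! Let `m` and `w²` be the mean and variance of `Z`, let `G` be the Gaussian law with the mean and
variance of `Y`, and put `ε = 1/σ`. Almost every conditional law of `Z` given `X` has the same first
two moments as `Z`, so a single `G` serves as reference for all of them, and `I(X;Y)` is the mean
over `X` of the divergence of the conditional law of `Y` from `G`, minus the divergence of the law
of `Y` from `G` (`klDiv_withDensity_prod`). It remains to expand one divergence, uniformly over the
input law `ν` (`abs_integral_klFun_mixRatio_sub_klMain_le`), and then to integrate over `X`.

At `y = m + τ/ε` the output density relative to `G` is the sum of `ε^k/k! · He_k(τ) · b_k`, where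
`b_k` is the expectation of `(z - m + i w x)^k` for `z` of law `ν` and an independent standard
Gaussian `x`. The imaginary part removes a Gaussian of variance `w²`, so `b_1 = b_2 = 0`, `b_k =
κ_k` for `k = 3, 4, 5`, and `b_6 = κ_6 + 10κ_3²`. The density is thus `1 + U` with `U` of order
`ε³`. The divergence is the Gaussian integral of `klFun (1 + U)`, and `klFun (1 + u) = u²/2 - u³/6 +
u⁴/12 + O(|u|⁵)`. The quadratic part is evaluated by orthogonality, and the cubic and quartic parts
by a few integrals of products of Hermite polynomials.

The analytic difficulty is that the Hermite remainder grows like `exp(τ²/2)`, which just cancels the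
Gaussian weight. The expansion is therefore taken to order `42 = 3 · 14`, with an extra factor `(1 +
τ²)⁻²` in the remainder, and the cases of small and large `τ` are treated separately
(`abs_klFun_sub_klPoly_le_of_approx`). All errors are at most `C S⁵ ε¹⁴`, where `S` is the absolute
moment of order 46 of `ν`; for the conditional laws `S⁵` is integrable in `X`, since `Z` has all
moments. -/

theorem integrable_polynomial_gaussian (p : ℝ[X]) :
    Integrable (fun x => p.eval x) (gaussianReal 0 1) := by
  induction p using Polynomial.induction_on' with
  | add p q hp hq =>
    simp only [eval_add]
    exact hp.add hq
  | monomial n a =>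
    have h : MemLp (id : ℝ → ℝ) n (gaussianReal 0 1) := memLp_id_gaussianReal' n (by simp)
    have h2 : Integrable (fun x : ℝ => x ^ n) (gaussianReal 0 1) := by
      have := h.integrable_norm_pow'
      refine this.mono' (by fun_prop) (ae_of_all _ fun x => ?_)
      simp
    simp only [eval_monomial]
    exact h2.const_mul a

/-- Stein's identity: with `φ` the Gaussian density, `φ p` has derivative `φ (p' - X p)`, and both
are integrable, so the derivative has integral zero. -/
theorem integral_mul_id_gaussian (p : ℝ[X]) :
    ∫ x, x * p.eval x ∂(gaussianReal 0 1) = ∫ x, p.derivative.eval x ∂(gaussianReal 0 1) := by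
  have hint : ∀ q : ℝ[X], Integrable (fun x => gaussianPDFReal 0 1 x * q.eval x) := by
    intro q
    have := integrable_polynomial_gaussian q
    rw [gaussianReal_of_var_ne_zero 0 one_ne_zero,
      integrable_withDensity_iff_integrable_smul' (measurable_gaussianPDF 0 1)
        (ae_of_all _ fun x => gaussianPDF_lt_top)] at this
    simpa [toReal_gaussianPDF] using this
  have hd : ∀ x, HasDerivAt (fun x => gaussianPDFReal 0 1 x * p.eval x)
      (gaussianPDFReal 0 1 x * (p.derivative - X * p).eval x) x := by
    intro x
    have h1 : HasDerivAt (fun x => gaussianPDFReal 0 1 x) (- x * gaussianPDFReal 0 1 x) x := by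
      have h := (((hasDerivAt_pow 2 x).neg.div_const 2).exp.const_mul ((√(2 * Real.pi))⁻¹))
      have heq : gaussianPDFReal 0 1 = fun y => (√(2 * Real.pi))⁻¹ * Real.exp (-y ^ 2 / 2) := by
        ext y; simp [gaussianPDFReal]
      rw [heq]
      refine HasDerivAt.congr_deriv h ?_
      simp
      ring
    refine (h1.mul (p.hasDerivAt x)).congr_deriv ?_
    simp; ring
  have h0 := integral_eq_zero_of_hasDerivAt_of_integrable hd (hint _) (hint _)
  have h1 : ∫ x, (p.derivative - X * p).eval x ∂(gaussianReal 0 1) = 0 := by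
    rw [integral_gaussianReal_eq_integral_smul one_ne_zero]
    simpa using h0
  have h2 := integrable_polynomial_gaussian p.derivative
  have h3 := integrable_polynomial_gaussian (X * p)
  simp only [eval_sub] at h1
  rw [integral_sub h2 h3] at h1
  simp only [eval_mul, eval_X] at h1
  linarith

/-- Expectation of a polynomial under the standard Gaussian, as a linear functional. -/
noncomputable def gaussE : ℝ[X] →ₗ[ℝ] ℝ where
  toFun p := ∫ x, p.eval x ∂(gaussianReal 0 1)
  map_add' p q := by
    simp only [eval_add]
    exact integral_add (integrable_polynomial_gaussian p) (integrable_polynomial_gaussian q)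
  map_smul' c p := by
    simp [integral_const_mul]

theorem gaussE_apply (p : ℝ[X]) : gaussE p = ∫ x, p.eval x ∂(gaussianReal 0 1) := rfl

theorem gaussE_one : gaussE 1 = 1 := by simp [gaussE_apply]

theorem gaussE_X_mul (p : ℝ[X]) : gaussE (X * p) = gaussE (derivative p) := by
  simpa [gaussE_apply] using integral_mul_id_gaussian p

theorem gaussE_X_pow (n : ℕ) : gaussE (X ^ (n + 2)) = (n + 1) * gaussE (X ^ n) := by
  have := gaussE_X_mul (X ^ (n + 1))
  rw [pow_succ', this, derivative_X_pow, ← smul_eq_C_mul, map_smul]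
  simp

/-- The probabilists' Hermite polynomials with real coefficients. -/
noncomputable def hermR (n : ℕ) : ℝ[X] := (hermite n).map (Int.castRingHom ℝ)

theorem hermR_zero : hermR 0 = 1 := by simp [hermR]

theorem hermR_succ (n : ℕ) : hermR (n + 1) = X * hermR n - derivative (hermR n) := by
  simp [hermR, hermite_succ, derivative_map]

theorem hermR_one : hermR 1 = X := by simp [hermR]

theorem derivative_hermR_succ (n : ℕ) :
    derivative (hermR (n + 1)) = ((n : ℝ) + 1) • hermR n := by
  induction n with
  | zero => simp [hermR_one, hermR_zero]
  | succ n ih =>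
    rw [hermR_succ (n + 1), ih]
    simp only [derivative_sub, derivative_mul, derivative_X, ih, derivative_smul, one_mul]
    rw [hermR_succ n]
    push_cast
    simp only [smul_eq_C_mul, C_add, C_1]
    ring

/-- By Stein's identity `q ↦ X q - q'` is the adjoint of differentiation for the Gaussian pairing,
and it sends each Hermite polynomial to the next. -/
theorem gaussE_hermR_succ_mul (n : ℕ) (p : ℝ[X]) :
    gaussE (hermR (n + 1) * p) = gaussE (hermR n * derivative p) := by
  have h : hermR (n + 1) * p = X * (hermR n * p) - derivative (hermR n) * p := by
    rw [hermR_succ]; ring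
  rw [h, map_sub, gaussE_X_mul, derivative_mul, map_add]
  ring

theorem gaussE_hermR_mul_hermR (n : ℕ) : ∀ m : ℕ,
    gaussE (hermR n * hermR m) = if n = m then (n.factorial : ℝ) else 0 := by
  induction n with
  | zero =>
    intro m
    cases m with
    | zero => simp [hermR_zero, gaussE_one]
    | succ m =>
      have := gaussE_hermR_succ_mul m 1
      rw [mul_one] at this
      simp [hermR_zero, this]
  | succ n ih =>
    intro m
    cases m with
    | zero => rw [gaussE_hermR_succ_mul, hermR_zero]; simp
    | succ m =>
      rw [gaussE_hermR_succ_mul, derivative_hermR_succ, mul_smul_comm, map_smul, ih m]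
      by_cases h : n = m
      · subst h; simp [Nat.factorial_succ]
      · simp [h]

theorem hermR_comp_neg (n : ℕ) : (hermR n).comp (-X) = (-1) ^ n * hermR n := by
  induction n with
  | zero => simp [hermR_zero]
  | succ n ih =>
    have hd : (derivative (hermR n)).comp (-X) = - derivative ((hermR n).comp (-X)) := by
      rw [derivative_comp]; simp
    have h1 : derivative ((-1 : ℝ[X]) ^ n) = 0 := by
      have : ((-1 : ℝ[X]) ^ n) = C ((-1) ^ n) := by simp
      rw [this, derivative_C]
    rw [hermR_succ, sub_comp, mul_comp, X_comp, hd, ih, derivative_mul, h1, pow_succ]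
    ring

theorem gaussE_comp_neg (p : ℝ[X]) : gaussE (p.comp (-X)) = gaussE p := by
  simp only [gaussE_apply]
  have h := gaussianReal_map_neg (μ := 0) (v := 1)
  rw [neg_zero] at h
  conv_rhs => rw [← h]
  rw [integral_map (by fun_prop) (by fun_prop)]
  simp

theorem gaussE_eq_zero_of_comp_neg {p : ℝ[X]} (h : p.comp (-X) = -p) : gaussE p = 0 := by
  have := gaussE_comp_neg p
  rw [h, map_neg] at this
  linarith

theorem hermR_three : hermR 3 = X ^ 3 - 3 * X := by
  simp [hermR_succ, hermR_zero]; ring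
theorem hermR_four : hermR 4 = X ^ 4 - 6 * X ^ 2 + 3 := by
  rw [hermR_succ, hermR_three]; simp; simp only [map_ofNat]; ring
theorem hermR_five : hermR 5 = X ^ 5 - 10 * X ^ 3 + 15 * X := by
  rw [hermR_succ, hermR_four]; simp; simp only [map_ofNat]; ring
theorem hermR_six : hermR 6 = X ^ 6 - 15 * X ^ 4 + 45 * X ^ 2 - 15 := by
  rw [hermR_succ, hermR_five]; simp; simp only [map_ofNat]; ring

/-- The Gaussian law is symmetric and `He_n` has the parity of `n`. -/
theorem gaussE_triple_odd {i j k : ℕ} (h : Odd (i + j + k)) :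
    gaussE (hermR i * hermR j * hermR k) = 0 := by
  apply gaussE_eq_zero_of_comp_neg
  simp only [mul_comp, hermR_comp_neg]
  have : (-1 : ℝ[X]) ^ i * (-1) ^ j * (-1) ^ k = -1 := by
    rw [← pow_add, ← pow_add, h.neg_one_pow]
  linear_combination (hermR i * hermR j * hermR k) * this

theorem gaussE_three_cubed_four : gaussE (hermR 3 ^ 3 * hermR 4) = 0 := by
  apply gaussE_eq_zero_of_comp_neg
  simp only [mul_comp, pow_comp, hermR_comp_neg]
  ring

theorem gaussE_even_values : gaussE (X ^ 2) = 1 ∧ gaussE (X ^ 4) = 3 ∧ gaussE (X ^ 6) = 15 ∧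
    gaussE (X ^ 8) = 105 ∧ gaussE (X ^ 10) = 945 ∧ gaussE (X ^ 12) = 10395 := by
  have h0 := gaussE_X_pow 0
  have h2 := gaussE_X_pow 2
  have h4 := gaussE_X_pow 4
  have h6 := gaussE_X_pow 6
  have h8 := gaussE_X_pow 8
  have h10 := gaussE_X_pow 10
  norm_num [gaussE_one] at h0
  norm_num [h0] at h2
  norm_num [h2] at h4
  norm_num [h4] at h6
  norm_num [h6] at h8
  norm_num [h8] at h10
  exact ⟨h0, h2, h4, h6, h8, h10⟩

theorem gaussE_even_polynomial (a0 a1 a2 a3 a4 a5 a6 : ℝ) :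
    gaussE (C a0 + C a1 * X ^ 2 + C a2 * X ^ 4 + C a3 * X ^ 6 + C a4 * X ^ 8 + C a5 * X ^ 10
      + C a6 * X ^ 12) = a0 + a1 + 3 * a2 + 15 * a3 + 105 * a4 + 945 * a5 + 10395 * a6 := by
  obtain ⟨h1, h2, h3, h4, h5, h6⟩ := gaussE_even_values
  have h0 : C a0 = a0 • (1 : ℝ[X]) := by simp [smul_eq_C_mul]
  rw [h0]
  simp only [← smul_eq_C_mul, map_add, map_smul, h1, h2, h3, h4, h5, h6, gaussE_one, smul_eq_mul]
  ring

/-- This value and the next three are instances of `i! j! k! / ((s-i)! (s-j)! (s-k)!)` with `2s = i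
+ j + k`. Each is checked by expanding the product and inserting the even Gaussian moments. -/
theorem gaussE_334 : gaussE (hermR 3 * hermR 3 * hermR 4) = 216 := by
  have h : hermR 3 * hermR 3 * hermR 4 = C 0 + C 27 * X ^ 2 + C (-72) * X ^ 4 + C 48 * X ^ 6
      + C (-12) * X ^ 8 + C 1 * X ^ 10 + C 0 * X ^ 12 := by
    rw [hermR_three, hermR_four]; simp; simp only [map_ofNat]; ring
  rw [h, gaussE_even_polynomial]; norm_num

theorem gaussE_336 : gaussE (hermR 3 * hermR 3 * hermR 6) = 720 := by
  have h : hermR 3 * hermR 3 * hermR 6 = C 0 + C (-135) * X ^ 2 + C 495 * X ^ 4 + C (-420) * X ^ 6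
      + C 144 * X ^ 8 + C (-21) * X ^ 10 + C 1 * X ^ 12 := by
    rw [hermR_three, hermR_six]; simp; simp only [map_ofNat]; ring
  rw [h, gaussE_even_polynomial]; norm_num

theorem gaussE_345 : gaussE (hermR 3 * hermR 4 * hermR 5) = 1440 := by
  have h : hermR 3 * hermR 4 * hermR 5 = C 0 + C (-135) * X ^ 2 + C 405 * X ^ 4
      + C (-354) * X ^ 6 + C 126 * X ^ 8 + C (-19) * X ^ 10 + C 1 * X ^ 12 := by
    rw [hermR_three, hermR_four, hermR_five]; simp; simp only [map_ofNat]; ring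
  rw [h, gaussE_even_polynomial]; norm_num

theorem gaussE_444 : gaussE (hermR 4 * hermR 4 * hermR 4) = 1728 := by
  have h : hermR 4 * hermR 4 * hermR 4 = C 27 + C (-162) * X ^ 2 + C 351 * X ^ 4
      + C (-324) * X ^ 6 + C 117 * X ^ 8 + C (-18) * X ^ 10 + C 1 * X ^ 12 := by
    rw [hermR_four]; simp; simp only [map_ofNat]; ring
  rw [h, gaussE_even_polynomial]; norm_num

theorem gaussE_three_fourth : gaussE (hermR 3 ^ 4) = 3348 := by
  have h : hermR 3 ^ 4 = C 0 + C 0 * X ^ 2 + C 81 * X ^ 4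
      + C (-108) * X ^ 6 + C 54 * X ^ 8 + C (-12) * X ^ 10 + C 1 * X ^ 12 := by
    rw [hermR_three]; simp; simp only [map_ofNat]; ring
  rw [h, gaussE_even_polynomial]; norm_num

end GaussHermite

/-! ### Moments and cumulants. -/

namespace CumulantMoment

/-- `φ' = ψ' φ` differentiated `n` times at `0`, where `ψ = log φ`. -/
theorem iteratedDeriv_charFun_eq_sum (ν : Measure ℝ) [IsProbabilityMeasure ν]
    (hν : ∀ k : ℕ, MemLp id k ν) (n : ℕ) :
    iteratedDeriv (n + 1) (charFun ν) 0 = ∑ i ∈ Finset.range (n + 1),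
      n.choose i * iteratedDeriv i (charFun ν) 0 *
        iteratedDeriv (n - i + 1) (fun t : ℝ => Complex.log (charFun ν t)) 0 := by
  have hφ : ContDiff ℝ ((⊤ : ℕ∞) : WithTop ℕ∞) (charFun ν) := contDiff_charFun' hν
  have h0 : charFun ν 0 ∈ Complex.slitPlane := by simp
  have hlog : ContDiffAt ℝ ((⊤ : ℕ∞) : WithTop ℕ∞) (fun t : ℝ => Complex.log (charFun ν t)) 0 := by
    have h1 : ContDiffAt ℝ ((⊤ : ℕ∞) : WithTop ℕ∞) Complex.log (charFun ν 0) :=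
      (Complex.contDiffAt_log h0).restrict_scalars ℝ
    exact h1.comp (0 : ℝ) hφ.contDiffAt
  -- Near `0` the characteristic function stays in the slit plane, so `log φ` is differentiable
  -- there and `φ' = φ · (log φ)'`. Leibniz's rule then gives the sum.
  have hev : deriv (charFun ν) =ᶠ[nhds 0]
      (charFun ν * deriv (fun t : ℝ => Complex.log (charFun ν t))) := by
    have hmem : ∀ᶠ t in nhds (0 : ℝ), charFun ν t ∈ Complex.slitPlane :=
      hφ.continuous.continuousAt.eventually (Complex.isOpen_slitPlane.mem_nhds h0)
    filter_upwards [hmem] with t ht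
    have hd : HasDerivAt (charFun ν) (deriv (charFun ν) t) t :=
      (hφ.differentiable (by simp)).differentiableAt.hasDerivAt
    have hl := hd.clog_real ht
    rw [Pi.mul_apply, hl.deriv, mul_div_cancel₀ _ (Complex.slitPlane_ne_zero ht)]
  rw [iteratedDeriv_succ', hev.iteratedDeriv_eq, iteratedDeriv_mul]
  · simp only [iteratedDeriv_succ']
  · exact hφ.contDiffAt.of_le (by exact_mod_cast le_top)
  · have : ContDiffAt ℝ (n + 1 : ℕ) (fun t : ℝ => Complex.log (charFun ν t)) 0 :=
      hlog.of_le (by exact_mod_cast le_top)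
    exact this.derivWithin (le_of_eq (by push_cast; rfl))

theorem moment_eq_sum_complex (ν : Measure ℝ) [IsProbabilityMeasure ν]
    (hν : ∀ k : ℕ, MemLp id k ν) (n : ℕ) :
    ((∫ x, x ^ (n + 1) ∂ν : ℝ) : ℂ) = ∑ i ∈ Finset.range (n + 1),
      n.choose i * ((∫ x, x ^ i ∂ν : ℝ) : ℂ) * ((-Complex.I) ^ (n - i + 1) *
        iteratedDeriv (n - i + 1) (fun t : ℝ => Complex.log (charFun ν t)) 0) := by
  have hI : ∀ k : ℕ, (-Complex.I) ^ k * Complex.I ^ k = 1 := fun k => by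
    rw [← mul_pow]; simp
  have h := iteratedDeriv_charFun_eq_sum ν hν n
  have hm : ∀ k : ℕ, ((∫ x, x ^ k ∂ν : ℝ) : ℂ) =
      (-Complex.I) ^ k * iteratedDeriv k (charFun ν) 0 := fun k => by
    rw [iteratedDeriv_charFun_zero (hν k), ← mul_assoc, hI, one_mul]
  rw [hm, h, Finset.mul_sum]
  refine Finset.sum_congr rfl fun i hi => ?_
  rw [hm]
  have hi' : n + 1 = i + (n - i + 1) := by
    have := Finset.mem_range.1 hi
    omega
  have hp : (-Complex.I) ^ (n + 1) = (-Complex.I) ^ i * (-Complex.I) ^ (n - i + 1) := by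
    rw [← pow_add, ← hi']
  rw [hp]
  ring

/-- The definition of `cumulant` keeps only a real part; nothing is lost, because the moment
recursion determines each cumulant from real moments and lower cumulants. -/
theorem ofReal_cumulant (ν : Measure ℝ) [IsProbabilityMeasure ν]
    (hν : ∀ k : ℕ, MemLp id k ν) (n : ℕ) :
    ((cumulant ν (n + 1) : ℝ) : ℂ) = (-Complex.I) ^ (n + 1) *
      iteratedDeriv (n + 1) (fun t : ℝ => Complex.log (charFun ν t)) 0 := by
  induction n using Nat.strong_induction_on with
  | _ n ih =>
    have h := moment_eq_sum_complex ν hν n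
    -- Isolates the term `i = 0`, the only one containing the derivative of order `n + 1`; its
    -- coefficient is `1`.
    rw [Finset.sum_range_succ'] at h
    have h2 : ∀ i ∈ Finset.range n, (n.choose (i + 1) : ℂ) * ((∫ x, x ^ (i + 1) ∂ν : ℝ) : ℂ) *
        ((-Complex.I) ^ (n - (i + 1) + 1) * iteratedDeriv (n - (i + 1) + 1)
          (fun t : ℝ => Complex.log (charFun ν t)) 0) =
        ((n.choose (i + 1) * (∫ x, x ^ (i + 1) ∂ν) * cumulant ν (n - (i + 1) + 1) : ℝ) : ℂ) := by
      intro i hi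
      have := Finset.mem_range.1 hi
      rw [← ih (n - (i + 1)) (by omega)]
      push_cast
      rfl
    rw [Finset.sum_congr rfl h2, ← Complex.ofReal_sum] at h
    simp only [Nat.choose_zero_right, Nat.cast_one, pow_zero, integral_const, probReal_univ,
      smul_eq_mul, mul_one, Complex.ofReal_one, one_mul, tsub_zero] at h
    have him : ((-Complex.I) ^ (n + 1) *
      iteratedDeriv (n + 1) (fun t : ℝ => Complex.log (charFun ν t)) 0).im = 0 := by
      have := congrArg Complex.im h
      simpa only [Complex.add_im, Complex.ofReal_im, zero_add, eq_comm] using this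
    apply Complex.ext
    · rw [Complex.ofReal_re, cumulant]
    · rw [Complex.ofReal_im, him]

/-- The recursion expressing moments by cumulants. -/
theorem moment_eq_sum_cumulant (ν : Measure ℝ) [IsProbabilityMeasure ν]
    (hν : ∀ k : ℕ, MemLp id k ν) (n : ℕ) :
    ∫ x, x ^ (n + 1) ∂ν = ∑ i ∈ Finset.range (n + 1),
      n.choose i * (∫ x, x ^ i ∂ν) * cumulant ν (n - i + 1) := by
  have h := moment_eq_sum_complex ν hν n
  simp only [← ofReal_cumulant ν hν] at h
  exact_mod_cast h

end CumulantMoment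

/-! ### Taylor expansion of `klFun` at `1`. -/

namespace KLExpansion
open Real

/-- The degree-four Taylor polynomial of `klFun (1 + u)` at `u = 0`. -/
noncomputable def klPoly (u : ℝ) : ℝ := u ^ 2 / 2 - u ^ 3 / 6 + u ^ 4 / 12

/-- For `|u| ≤ 1/2` this is Taylor's formula for the logarithm. Farther out `1 ≤ 32 |u|⁵`, so crude
bounds on each term suffice. -/
theorem abs_klFun_sub_klPoly_le {u : ℝ} (hu : -1 ≤ u) :
    |klFun (1 + u) - klPoly u| ≤ 100 * |u| ^ 5 := by
  rw [klFun_apply, klPoly]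
  rcases le_or_gt |u| (1 / 2) with h | h
  · have hlt : |-u| < 1 := by rw [abs_neg]; linarith
    have hb := Real.abs_log_sub_add_sum_range_le hlt 4
    simp only [Finset.sum_range_succ, Finset.sum_range_zero, abs_neg, sub_neg_eq_add] at hb
    norm_num at hb
    have hpos : 0 ≤ |u| ^ 5 := by positivity
    have hb2 : |u| ^ 5 / (1 - |u|) ≤ 2 * |u| ^ 5 := by
      rw [div_le_iff₀ (by linarith)]
      nlinarith
    set l := log (1 + u)
    set e := -u + u ^ 2 / 2 + (-u) ^ 3 / 3 + u ^ 4 / 4 + l with he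
    have hb3 : |e| ≤ 2 * |u| ^ 5 := by
      refine le_trans (le_of_eq ?_) (hb.trans hb2)
      try rfl
    -- Multiplying the degree-four logarithm polynomial by `1 + u` reproduces `klPoly` plus the
    -- single extra term `-u⁵/4`.
    have hid : (1 + u) * l + 1 - (1 + u) - (u ^ 2 / 2 - u ^ 3 / 6 + u ^ 4 / 12)
        = (1 + u) * e - u ^ 5 / 4 := by
      rw [he]; ring
    rw [hid]
    have h1 : |1 + u| ≤ 2 := by
      rw [abs_le] at h ⊢; constructor <;> linarith [h.1, h.2]
    calc |(1 + u) * e - u ^ 5 / 4| ≤ |(1 + u) * e| + |u ^ 5 / 4| := abs_sub _ _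
      _ = |1 + u| * |e| + |u| ^ 5 / 4 := by rw [abs_mul, abs_div, abs_pow]; norm_num
      _ ≤ 2 * (2 * |u| ^ 5) + |u| ^ 5 / 4 := by gcongr
      _ ≤ 100 * |u| ^ 5 := by linarith
  · rcases lt_or_ge u 0 with hneg | hpos
    · rw [abs_of_neg hneg] at h ⊢
      have hr0 : 0 ≤ 1 + u := by linarith
      have hk0 := klFun_nonneg hr0
      rw [klFun_apply] at hk0
      have hk1 : (1 + u) * log (1 + u) ≤ 0 :=
        mul_log_nonpos hr0 (by linarith)
      have h5 : (1 / 2 : ℝ) ^ 5 ≤ (-u) ^ 5 := by gcongr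
      have a2 : u ^ 2 ≤ 1 := by nlinarith
      have a2' : 0 ≤ u ^ 2 := by positivity
      have a3 : |u ^ 3| ≤ 1 := by
        rw [abs_pow]; exact pow_le_one₀ (abs_nonneg _) (by rw [abs_le]; constructor <;> linarith)
      have a4 : |u ^ 4| ≤ 1 := by
        rw [abs_pow]; exact pow_le_one₀ (abs_nonneg _) (by rw [abs_le]; constructor <;> linarith)
      rw [abs_le] at a3 a4 ⊢
      constructor <;> linarith [a3.1, a3.2, a4.1, a4.2]
    · rw [abs_of_nonneg hpos] at h ⊢
      have hl0 : 0 ≤ log (1 + u) := log_nonneg (by linarith)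
      have hl1 : log (1 + u) ≤ u := by
        have := log_le_sub_one_of_pos (show 0 < 1 + u by linarith); linarith
      have hk0 : 0 ≤ (1 + u) * log (1 + u) := by positivity
      have hk1 : (1 + u) * log (1 + u) ≤ (1 + u) * u := by gcongr
      have hq : ∀ k ≤ 5, u ^ k ≤ 32 * u ^ 5 := by
        intro k hk
        have h2 : (2 * u) ^ k ≤ (2 * u) ^ 5 := pow_le_pow_right₀ (by linarith) hk
        rw [mul_pow, mul_pow] at h2
        have h3 : u ^ k ≤ 2 ^ k * u ^ k := by
          have : (1 : ℝ) ≤ 2 ^ k := one_le_pow₀ (by norm_num)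
          have : 0 ≤ u ^ k := by positivity
          nlinarith
        linarith
      have q1 := hq 1 (by norm_num)
      have q2 := hq 2 (by norm_num)
      have q3 := hq 3 (by norm_num)
      have q4 := hq 4 (by norm_num)
      have : 0 ≤ u ^ 2 := by positivity
      have : 0 ≤ u ^ 3 := by positivity
      have : 0 ≤ u ^ 4 := by positivity
      have : 0 ≤ u ^ 5 := by positivity
      rw [abs_le]
      constructor <;> nlinarith

theorem abs_klPoly_le {u B : ℝ} (hB : 1 ≤ B) (hu : |u| ≤ B) : |klPoly u| ≤ B ^ 4 := by
  have h2 : |u| ^ 2 ≤ B ^ 4 := (pow_le_pow_left₀ (abs_nonneg u) hu 2).trans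
    (pow_le_pow_right₀ hB (by norm_num))
  have h3 : |u| ^ 3 ≤ B ^ 4 := (pow_le_pow_left₀ (abs_nonneg u) hu 3).trans
    (pow_le_pow_right₀ hB (by norm_num))
  have h4 : |u| ^ 4 ≤ B ^ 4 := (pow_le_pow_left₀ (abs_nonneg u) hu 4)
  rw [← abs_pow] at h2 h3 h4
  rw [klPoly]
  rw [abs_le] at *
  constructor <;> linarith [h2.1, h2.2, h3.1, h3.2, h4.1, h4.2]

/-- The divided difference of `klPoly` has degree three, and the moduli of its coefficients add up
to `1 + 1/2 + 1/3 ≤ 2`. -/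
theorem abs_klPoly_sub_le {u w B : ℝ} (hB : 1 ≤ B) (hu : |u| ≤ B) (hw : |w| ≤ B) :
    |klPoly u - klPoly w| ≤ 2 * B ^ 3 * |u - w| := by
  have hid : klPoly u - klPoly w = (u - w) * ((u + w) / 2 - (u ^ 2 + u * w + w ^ 2) / 6
      + (u ^ 3 + u ^ 2 * w + u * w ^ 2 + w ^ 3) / 12) := by
    rw [klPoly, klPoly]; ring
  have b1 : B ≤ B ^ 3 := by nlinarith [pow_le_pow_right₀ hB (show 1 ≤ 3 by norm_num)]
  have b2 : B ^ 2 ≤ B ^ 3 := pow_le_pow_right₀ hB (by norm_num)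
  have hm2 : ∀ x y : ℝ, |x| ≤ B → |y| ≤ B → |x * y| ≤ B ^ 3 := by
    intro x y hx hy
    rw [abs_mul]
    calc |x| * |y| ≤ B * B := by gcongr
      _ = B ^ 2 := by ring
      _ ≤ B ^ 3 := b2
  have hm3 : ∀ x y z : ℝ, |x| ≤ B → |y| ≤ B → |z| ≤ B → |x * y * z| ≤ B ^ 3 := by
    intro x y z hx hy hz
    rw [abs_mul, abs_mul]
    calc |x| * |y| * |z| ≤ B * B * B := by gcongr
      _ = B ^ 3 := by ring
  have e1 := hu.trans b1
  have e2 := hw.trans b1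
  have e3 := hm2 u u hu hu
  have e4 := hm2 u w hu hw
  have e5 := hm2 w w hw hw
  have e6 := hm3 u u u hu hu hu
  have e7 := hm3 u u w hu hu hw
  have e8 := hm3 u w w hu hw hw
  have e9 := hm3 w w w hw hw hw
  rw [hid, abs_mul, mul_comm]
  gcongr
  rw [abs_le] at *
  constructor <;> nlinarith [e1.1, e1.2, e2.1, e2.2, e3.1, e3.2, e4.1, e4.2, e5.1, e5.2, e6.1, e6.2,
    e7.1, e7.2, e8.1, e8.2, e9.1, e9.2]

/-- Pointwise expansion of `klFun r` around `1` with an error of order `ε ^ 14`, where `1 + U` is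
a good approximation of `r` as long as the growth factor `E` is not too large. -/
theorem abs_klFun_sub_klPoly_le_of_approx {ε S W T r U D C : ℝ} (hε0 : 0 < ε) (hε1 : ε ≤ 1)
    (hS : 1 ≤ S) (hW : 1 ≤ W) (hC : 1 ≤ C) (hT : 1 ≤ T)
    (hr0 : 0 ≤ r) (hrE : r ≤ C * exp (T / 2)) (hrU : r = 1 + U + D)
    (hU : |U| ≤ C * S * ε ^ 3 * W)
    (hD : |D| ≤ C * S * ε ^ 42 * (exp (T / 2) / T ^ 2)) :
    |klFun r - klPoly U| ≤ 4000 * C ^ 5 * S ^ 5 * ε ^ 14 *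
      (W ^ 5 * T * exp (T / 4) + exp (T / 2) / T) := by
  have hT0 : 0 < T := by linarith
  have hCS : 1 ≤ C * S := one_le_mul_of_one_le_of_one_le hC hS
  set B := C * S * W with hBdef
  have hB1 : 1 ≤ B := one_le_mul_of_one_le_of_one_le hCS hW
  have hCSB : C * S ≤ B := le_mul_of_one_le_right (by linarith) hW
  have hε3 : ε ^ 3 ≤ 1 := pow_le_one₀ hε0.le hε1
  have hε14 : ε ^ 14 ≤ ε ^ 3 := pow_le_pow_of_le_one hε0.le hε1 (by norm_num)
  have hUB3 : |U| ≤ B * ε ^ 3 := by rw [hBdef]; linarith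
  have hUB : |U| ≤ B := hUB3.trans (mul_le_of_le_one_right (by linarith) hε3)
  have hexp1 : 1 ≤ exp (T / 4) := one_le_exp (by linarith)
  have hE2 : exp (T / 2) = exp (T / 4) ^ 2 := by rw [← exp_nat_mul]; congr 1; push_cast; ring
  have hlast : 0 ≤ exp (T / 2) / T := by positivity
  have hBeq : C ^ 5 * S ^ 5 * W ^ 5 = B ^ 5 := by rw [hBdef]; ring
  have hTe : 1 ≤ T * exp (T / 4) := one_le_mul_of_one_le_of_one_le hT hexp1
  -- The threshold splits `42 = 28 + 14`. Below it, `D` is of order `ε¹⁴` and Taylor's formula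
  -- applies to `U + D`. Above it, `ε¹⁴ exp(T/4) ≥ 1`, so that any bound polynomial in `W` and `T`
  -- acquires the factor `ε¹⁴` at the price of `exp(T/4)`.
  rcases le_or_gt (ε ^ 28 * exp (T / 2)) 1 with hA | hA
  · have hD1 : |D| ≤ B * ε ^ 14 := by
      have h1 : ε ^ 28 * (exp (T / 2) / T ^ 2) ≤ 1 := by
        rw [← mul_div_assoc]
        exact div_le_one_of_le₀ (hA.trans (one_le_pow₀ hT)) (by positivity)
      calc |D| ≤ C * S * ε ^ 42 * (exp (T / 2) / T ^ 2) := hD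
        _ = C * S * ε ^ 14 * (ε ^ 28 * (exp (T / 2) / T ^ 2)) := by ring
        _ ≤ C * S * ε ^ 14 * 1 := by gcongr
        _ ≤ B * ε ^ 14 := by rw [mul_one]; gcongr
    have hUD : |U + D| ≤ 2 * B * ε ^ 3 := by
      calc |U + D| ≤ |U| + |D| := abs_add_le _ _
        _ ≤ B * ε ^ 3 + B * ε ^ 14 := add_le_add hUB3 hD1
        _ ≤ B * ε ^ 3 + B * ε ^ 3 := by gcongr
        _ = 2 * B * ε ^ 3 := by ring
    have hUD' : |U + D| ≤ 2 * B := hUD.trans (mul_le_of_le_one_right (by linarith) hε3)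
    have hk := abs_klFun_sub_klPoly_le (u := U + D) (by linarith)
    rw [← add_assoc, ← hrU] at hk
    have hp := abs_klPoly_sub_le (show 1 ≤ 2 * B by linarith) hUD'
      (hUB.trans (by linarith))
    rw [add_sub_cancel_left] at hp
    have e1 : 100 * |U + D| ^ 5 ≤ 3200 * B ^ 5 * ε ^ 14 := by
      calc 100 * |U + D| ^ 5 ≤ 100 * (2 * B * ε ^ 3) ^ 5 := by gcongr
        _ = 3200 * B ^ 5 * ε ^ 15 := by ring
        _ ≤ 3200 * B ^ 5 * ε ^ 14 := by
          have : ε ^ 15 ≤ ε ^ 14 := pow_le_pow_of_le_one hε0.le hε1 (by norm_num)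
          gcongr
    have e2 : 2 * (2 * B) ^ 3 * |D| ≤ 16 * B ^ 5 * ε ^ 14 := by
      calc 2 * (2 * B) ^ 3 * |D| ≤ 2 * (2 * B) ^ 3 * (B * ε ^ 14) := by gcongr
        _ = 16 * B ^ 4 * ε ^ 14 := by ring
        _ ≤ 16 * B ^ 5 * ε ^ 14 := by
          have : B ^ 4 ≤ B ^ 5 := pow_le_pow_right₀ hB1 (by norm_num)
          gcongr
    calc |klFun r - klPoly U| ≤ |klFun r - klPoly (U + D)| + |klPoly (U + D) - klPoly U| :=
          abs_sub_le _ _ _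
      _ ≤ 3200 * B ^ 5 * ε ^ 14 + 16 * B ^ 5 * ε ^ 14 :=
          add_le_add (hk.trans e1) (hp.trans e2)
      _ ≤ 4000 * B ^ 5 * ε ^ 14 := by
          have : 0 ≤ B ^ 5 * ε ^ 14 := by positivity
          linarith
      _ ≤ 4000 * B ^ 5 * ε ^ 14 * (T * exp (T / 4)) := le_mul_of_one_le_right (by positivity) hTe
      _ = 4000 * C ^ 5 * S ^ 5 * ε ^ 14 * (W ^ 5 * T * exp (T / 4)) := by rw [← hBeq]; ring
      _ ≤ _ := by gcongr; linarith
  · have hbig : 1 ≤ ε ^ 14 * exp (T / 4) := by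
      have h2 : 1 < (ε ^ 14 * exp (T / 4)) ^ 2 := by rw [mul_pow, ← hE2]; calc
        (1 : ℝ) < ε ^ 28 * exp (T / 2) := hA
        _ = _ := by ring
      by_contra hcon
      push Not at hcon
      have h0 : 0 ≤ ε ^ 14 * exp (T / 4) := by positivity
      nlinarith
    -- The logarithm costs one factor `T`. This is why the hypothesis on `D` carries `T⁻²`: one
    -- power of `1/T` has to survive in the conclusion.
    have hrlog : r * log r ≤ r * (C + T / 2) := by
      rcases hr0.eq_or_lt with h | h
      · rw [← h]; simp
      · gcongr
        calc log r ≤ log (C * exp (T / 2)) := log_le_log h hrE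
          _ = log C + T / 2 := by rw [log_mul (by linarith) (exp_pos _).ne', log_exp]
          _ ≤ C + T / 2 := by
            have := log_le_sub_one_of_pos (show 0 < C by linarith); linarith
    have hCT : C + T / 2 ≤ 2 * (C * T) := by nlinarith
    have hrle : r ≤ 2 * B + C * S * ε ^ 42 * (exp (T / 2) / T ^ 2) := by
      have h1 := le_abs_self U
      have h2 := le_abs_self D
      linarith
    have hk0 := klFun_nonneg hr0
    have hk1 : klFun r ≤ 5 * B ^ 5 * T + 2 * (C ^ 5 * S ^ 5) * ε ^ 14 * (exp (T / 2) / T) := by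
      have hC2 : C * (C * S) ≤ C ^ 5 * S ^ 5 := by
        calc C * (C * S) = C ^ 2 * S ^ 1 := by ring
          _ ≤ C ^ 5 * S ^ 5 := by
            have h1 : C ^ 2 ≤ C ^ 5 := pow_le_pow_right₀ hC (by norm_num)
            have h2 : S ^ 1 ≤ S ^ 5 := pow_le_pow_right₀ hS (by norm_num)
            gcongr
      have hCB : C * B ≤ B ^ 5 := by
        have h1 : C ≤ B := (le_mul_of_one_le_right (by linarith) hS).trans hCSB
        calc C * B ≤ B * B := by gcongr
          _ = B ^ 2 := by ring
          _ ≤ B ^ 5 := pow_le_pow_right₀ hB1 (by norm_num)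
      have hε42 : ε ^ 42 ≤ ε ^ 14 := pow_le_pow_of_le_one hε0.le hε1 (by norm_num)
      have hB5 : 1 ≤ B ^ 5 * T := one_le_mul_of_one_le_of_one_le (one_le_pow₀ hB1) hT
      rw [klFun_apply]
      calc r * log r + 1 - r ≤ r * (2 * (C * T)) + 1 := by nlinarith
        _ ≤ (2 * B + C * S * ε ^ 42 * (exp (T / 2) / T ^ 2)) * (2 * (C * T)) + 1 := by gcongr
        _ = 4 * (C * B) * T + 2 * (C * (C * S)) * ε ^ 42 * (exp (T / 2) / T) + 1 := by
          field_simp; ring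
        _ ≤ 4 * B ^ 5 * T + 2 * (C ^ 5 * S ^ 5) * ε ^ 14 * (exp (T / 2) / T) + B ^ 5 * T := by
          gcongr
        _ = _ := by ring
    have hp := abs_klPoly_le hB1 hUB
    have hp2 : |klPoly U| ≤ B ^ 5 * T := hp.trans (by
      calc B ^ 4 ≤ B ^ 5 := pow_le_pow_right₀ hB1 (by norm_num)
        _ ≤ B ^ 5 * T := le_mul_of_one_le_right (by positivity) hT)
    calc |klFun r - klPoly U| ≤ |klFun r| + |klPoly U| := abs_sub _ _
      _ ≤ (5 * B ^ 5 * T + 2 * (C ^ 5 * S ^ 5) * ε ^ 14 * (exp (T / 2) / T)) + B ^ 5 * T := by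
        rw [abs_of_nonneg hk0]; gcongr
      _ = 6 * B ^ 5 * T * 1 + 2 * (C ^ 5 * S ^ 5) * ε ^ 14 * (exp (T / 2) / T) := by ring
      _ ≤ 4000 * B ^ 5 * T * (ε ^ 14 * exp (T / 4)) +
          4000 * (C ^ 5 * S ^ 5) * ε ^ 14 * (exp (T / 2) / T) := by
        gcongr <;> norm_num
      _ = _ := by rw [← hBeq]; ring
end KLExpansion

/-! ### Collecting powers of `ε` in the truncated expansion. -/

namespace KLExpansion
open Real

/-- Of the 36 products, `6 + 5 + 4 + 3 + 2 + 1 = 21` have total degree at least five; they make up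
`G`. The fifth coefficients may themselves be remainders depending on `ε`, so the lemma can be
iterated. -/
theorem truncated_mul {ε M B : ℝ} (hε0 : 0 ≤ ε) (hε1 : ε ≤ 1)
    {f0 f1 f2 f3 f4 f5 a0 a1 a2 a3 a4 a5 : ℝ}
    (hf0 : |f0| ≤ M) (hf1 : |f1| ≤ M) (hf2 : |f2| ≤ M) (hf3 : |f3| ≤ M) (hf4 : |f4| ≤ M)
    (hf5 : |f5| ≤ M) (ha0 : |a0| ≤ B) (ha1 : |a1| ≤ B) (ha2 : |a2| ≤ B) (ha3 : |a3| ≤ B)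
    (ha4 : |a4| ≤ B) (ha5 : |a5| ≤ B) :
    ∃ G, |G| ≤ 21 * (M * B) ∧
      (f0 + ε * f1 + ε ^ 2 * f2 + ε ^ 3 * f3 + ε ^ 4 * f4 + ε ^ 5 * f5) *
      (a0 + ε * a1 + ε ^ 2 * a2 + ε ^ 3 * a3 + ε ^ 4 * a4 + ε ^ 5 * a5) =
      f0 * a0 + ε * (f0 * a1 + f1 * a0) + ε ^ 2 * (f0 * a2 + f1 * a1 + f2 * a0)
      + ε ^ 3 * (f0 * a3 + f1 * a2 + f2 * a1 + f3 * a0)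
      + ε ^ 4 * (f0 * a4 + f1 * a3 + f2 * a2 + f3 * a1 + f4 * a0) + ε ^ 5 * G := by
  have key : ∀ (k : ℕ) {x y : ℝ}, |x| ≤ M → |y| ≤ B → |ε ^ k * (x * y)| ≤ M * B := by
    intro k x y hx hy
    have hM : 0 ≤ M := (abs_nonneg x).trans hx
    rw [abs_mul, abs_mul, abs_of_nonneg (pow_nonneg hε0 k)]
    calc ε ^ k * (|x| * |y|) ≤ 1 * (M * B) := by
          gcongr
          exact pow_le_one₀ hε0 hε1
      _ = M * B := one_mul _
  have add : ∀ {x y : ℝ} {m n : ℝ}, |x| ≤ m * (M * B) → |y| ≤ n * (M * B) →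
      |x + y| ≤ (m + n) * (M * B) := by
    intro x y m n hx hy
    calc |x + y| ≤ |x| + |y| := abs_add_le x y
      _ ≤ _ := by linarith
  have one : ∀ {x : ℝ}, |x| ≤ M * B → |x| ≤ 1 * (M * B) := fun h => by rwa [one_mul]
  refine ⟨(ε ^ 0 * (f0 * a5) + ε ^ 0 * (f1 * a4) + ε ^ 0 * (f2 * a3) + ε ^ 0 * (f3 * a2)
    + ε ^ 0 * (f4 * a1) + ε ^ 0 * (f5 * a0)) + (ε ^ 1 * (f1 * a5) + ε ^ 1 * (f2 * a4)
    + ε ^ 1 * (f3 * a3) + ε ^ 1 * (f4 * a2) + ε ^ 1 * (f5 * a1)) + (ε ^ 2 * (f2 * a5)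
    + ε ^ 2 * (f3 * a4) + ε ^ 2 * (f4 * a3) + ε ^ 2 * (f5 * a2)) + (ε ^ 3 * (f3 * a5)
    + ε ^ 3 * (f4 * a4) + ε ^ 3 * (f5 * a3)) + (ε ^ 4 * (f4 * a5) + ε ^ 4 * (f5 * a4))
    + ε ^ 5 * (f5 * a5), ?_, by ring⟩
  refine le_trans (add (add (add (add (add
    (add (add (add (add (add (one (key 0 hf0 ha5)) (one (key 0 hf1 ha4))) (one (key 0 hf2 ha3)))
      (one (key 0 hf3 ha2))) (one (key 0 hf4 ha1))) (one (key 0 hf5 ha0)))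
    (add (add (add (add (one (key 1 hf1 ha5)) (one (key 1 hf2 ha4))) (one (key 1 hf3 ha3)))
      (one (key 1 hf4 ha2))) (one (key 1 hf5 ha1))))
    (add (add (add (one (key 2 hf2 ha5)) (one (key 2 hf3 ha4))) (one (key 2 hf4 ha3)))
      (one (key 2 hf5 ha2))))
    (add (add (one (key 3 hf3 ha5)) (one (key 3 hf4 ha4))) (one (key 3 hf5 ha3))))
    (add (one (key 4 hf4 ha5)) (one (key 4 hf5 ha4)))) (one (key 5 hf5 ha5))) (le_of_eq ?_)
  ring

/-- The terms of order at most `13` in `klPoly U`. -/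
theorem abs_klPoly_sub_main_le {ε B a b c d e R : ℝ} (hε0 : 0 ≤ ε) (hε1 : ε ≤ 1) (hB : 1 ≤ B)
    (ha : |a| ≤ B) (hb : |b| ≤ B) (hc : |c| ≤ B) (hd : |d| ≤ B) (he : |e| ≤ B) (hR : |R| ≤ B)
    {U : ℝ}
    (hU : U = ε ^ 3 * (a + ε * b + ε ^ 2 * c + ε ^ 3 * d + ε ^ 4 * e + ε ^ 5 * R)) :
    |klPoly U - (U ^ 2 / 2 - ε ^ 9 / 6 * (a ^ 3 + ε * (3 * (a ^ 2 * b))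
      + ε ^ 2 * (3 * (a ^ 2 * c) + 3 * (a * b ^ 2))
      + ε ^ 3 * (3 * (a ^ 2 * d) + 6 * (a * b * c) + b ^ 3)
      + ε ^ 4 * (3 * (a ^ 2 * e) + 6 * (a * b * d) + 3 * (a * c ^ 2) + 3 * (b ^ 2 * c)))
      + ε ^ 12 / 12 * (a ^ 4 + ε * (4 * (a ^ 3 * b))))| ≤ 1000 * B ^ 4 * ε ^ 14 := by
  have prod : ∀ {x y : ℝ}, |x| ≤ B → |y| ≤ B → |x * y| ≤ B ^ 2 := by
    intro x y hx hy
    rw [abs_mul, pow_two]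
    gcongr
  have hB0 : 0 ≤ B := by linarith
  -- Two applications give `U³` modulo `ε⁹ · ε⁵`. The square is left untruncated, since
  -- orthogonality integrates it exactly.
  obtain ⟨G, hG, hG2⟩ := truncated_mul hε0 hε1 ha hb hc hd he hR ha hb hc hd he hR
  have pad : ∀ {x : ℝ}, |x| ≤ 21 * (B * B) → |x| ≤ 21 * B ^ 2 := fun h => by rwa [pow_two]
  have B2 : 0 ≤ B ^ 2 := by positivity
  have t0 : |a * a| ≤ 21 * B ^ 2 := (prod ha ha).trans (by linarith)
  have p1 := prod ha hb
  have p2 := prod ha hc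
  have p3 := prod hb hb
  have p4 := prod ha hd
  have p5 := prod hb hc
  have p6 := prod ha he
  have p7 := prod hb hd
  have p8 := prod hc hc
  have p1' := prod hb ha
  have p2' := prod hc ha
  have p4' := prod hd ha
  have p5' := prod hc hb
  have p6' := prod he ha
  have p7' := prod hd hb
  have t1 : |a * b + b * a| ≤ 21 * B ^ 2 := by
    rw [abs_le] at *; constructor <;> linarith [p1.1, p1.2, p1'.1, p1'.2]
  have t2 : |a * c + b * b + c * a| ≤ 21 * B ^ 2 := by
    rw [abs_le] at *; constructor <;> linarith [p2.1, p2.2, p3.1, p3.2, p2'.1, p2'.2]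
  have t3 : |a * d + b * c + c * b + d * a| ≤ 21 * B ^ 2 := by
    rw [abs_le] at *
    constructor <;> linarith [p4.1, p4.2, p5.1, p5.2, p5'.1, p5'.2, p4'.1, p4'.2]
  have t4 : |a * e + b * d + c * c + d * b + e * a| ≤ 21 * B ^ 2 := by
    rw [abs_le] at *
    constructor <;> linarith [p6.1, p6.2, p7.1, p7.2, p8.1, p8.2, p7'.1, p7'.2, p6'.1, p6'.2]
  obtain ⟨H, hH, hH2⟩ := truncated_mul hε0 hε1 t0 t1 t2 t3 t4 (pad hG) ha hb hc hd he hR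
  rw [← hG2] at hH2
  -- Nested tails, `U = ε³(a + ε A1)` and `A1 = b + ε A2`: as `U⁴` already starts at `ε¹²`, only its
  -- first two terms are of order below `14`.
  set A2 := c + ε * d + ε ^ 2 * e + ε ^ 3 * R with hA2
  set A1 := b + ε * A2 with hA1
  have sm : ∀ (k : ℕ) {x : ℝ}, |x| ≤ B → |ε ^ k * x| ≤ B := by
    intro k x hx
    rw [abs_mul, abs_of_nonneg (pow_nonneg hε0 k)]
    calc ε ^ k * |x| ≤ 1 * B := by gcongr; exact pow_le_one₀ hε0 hε1
      _ = B := one_mul _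
  have s1 := sm 1 hd
  have s2 := sm 2 he
  have s3 := sm 3 hR
  have s4 := sm 1 hc
  have s5 := sm 2 hd
  have s6 := sm 3 he
  have s7 := sm 4 hR
  have hA2B : |A2| ≤ 4 * B := by
    rw [hA2]; rw [pow_one] at s1
    rw [abs_le] at *
    constructor <;> linarith [s1.1, s1.2, s2.1, s2.2, s3.1, s3.2, hc.1, hc.2]
  have hA1B : |A1| ≤ 5 * B := by
    have : A1 = b + ε * c + ε ^ 2 * d + ε ^ 3 * e + ε ^ 4 * R := by rw [hA1, hA2]; ring
    rw [this]; rw [pow_one] at s4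
    rw [abs_le] at *
    constructor <;> linarith [s4.1, s4.2, s5.1, s5.2, s6.1, s6.2, s7.1, s7.2, hb.1, hb.2]
  set Q := 4 * (a ^ 3 * A2) + 6 * (a ^ 2 * A1 ^ 2) + 4 * ε * (a * A1 ^ 3) + ε ^ 2 * A1 ^ 4 with hQ
  have hQB : |Q| ≤ 1300 * B ^ 4 := by
    have q1 : |a ^ 3 * A2| ≤ 4 * B ^ 4 := by
      rw [abs_mul, abs_pow]
      calc |a| ^ 3 * |A2| ≤ B ^ 3 * (4 * B) := by gcongr
        _ = _ := by ring
    have q2 : |a ^ 2 * A1 ^ 2| ≤ 25 * B ^ 4 := by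
      rw [abs_mul, abs_pow, abs_pow]
      calc |a| ^ 2 * |A1| ^ 2 ≤ B ^ 2 * (5 * B) ^ 2 := by gcongr
        _ = _ := by ring
    have q3 : |ε * (a * A1 ^ 3)| ≤ 125 * B ^ 4 := by
      rw [abs_mul, abs_mul, abs_pow, abs_of_nonneg hε0]
      calc ε * (|a| * |A1| ^ 3) ≤ 1 * (B * (5 * B) ^ 3) := by gcongr
        _ = _ := by ring
    have q4 : |ε ^ 2 * A1 ^ 4| ≤ 625 * B ^ 4 := by
      rw [abs_mul, abs_pow, abs_pow, abs_of_nonneg hε0]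
      calc ε ^ 2 * |A1| ^ 4 ≤ 1 * (5 * B) ^ 4 := by gcongr; exact pow_le_one₀ hε0 hε1
        _ = _ := by ring
    have hQ' : Q = 4 * (a ^ 3 * A2) + 6 * (a ^ 2 * A1 ^ 2) + 4 * (ε * (a * A1 ^ 3))
      + ε ^ 2 * A1 ^ 4 := by rw [hQ]; ring
    rw [hQ']
    rw [abs_le] at *
    constructor <;> linarith [q1.1, q1.2, q2.1, q2.2, q3.1, q3.2, q4.1, q4.2]
  have hUA : U = ε ^ 3 * (a + ε * A1) := by rw [hU, hA1, hA2]; ring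
  have hU3 : U ^ 3 = ε ^ 9 * (a ^ 3 + ε * (3 * (a ^ 2 * b))
      + ε ^ 2 * (3 * (a ^ 2 * c) + 3 * (a * b ^ 2))
      + ε ^ 3 * (3 * (a ^ 2 * d) + 6 * (a * b * c) + b ^ 3)
      + ε ^ 4 * (3 * (a ^ 2 * e) + 6 * (a * b * d) + 3 * (a * c ^ 2) + 3 * (b ^ 2 * c)))
      + ε ^ 14 * H := by
    rw [hU]
    linear_combination ε ^ 9 * hH2
  have hU4 : U ^ 4 = ε ^ 12 * (a ^ 4 + ε * (4 * (a ^ 3 * b))) + ε ^ 14 * Q := by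
    rw [hUA, hQ, hA1]; ring
  have hfin : klPoly U - (U ^ 2 / 2 - ε ^ 9 / 6 * (a ^ 3 + ε * (3 * (a ^ 2 * b))
      + ε ^ 2 * (3 * (a ^ 2 * c) + 3 * (a * b ^ 2))
      + ε ^ 3 * (3 * (a ^ 2 * d) + 6 * (a * b * c) + b ^ 3)
      + ε ^ 4 * (3 * (a ^ 2 * e) + 6 * (a * b * d) + 3 * (a * c ^ 2) + 3 * (b ^ 2 * c)))
      + ε ^ 12 / 12 * (a ^ 4 + ε * (4 * (a ^ 3 * b)))) = ε ^ 14 * (Q / 12 - H / 6) := by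
    rw [klPoly, hU3, hU4]; ring
  have hHB : |H| ≤ 441 * B ^ 4 := by
    have : B ^ 3 ≤ B ^ 4 := pow_le_pow_right₀ hB (by norm_num)
    calc |H| ≤ 21 * (21 * B ^ 2 * B) := hH
      _ = 441 * B ^ 3 := by ring
      _ ≤ _ := by linarith
  rw [hfin, abs_mul, abs_of_nonneg (pow_nonneg hε0 14), mul_comm]
  gcongr
  rw [abs_le] at *
  constructor <;> linarith [hHB.1, hHB.2, hQB.1, hQB.2]

end KLExpansion

/-! ### The Hermite generating function at complex arguments, with remainder. -/

namespace GaussHermite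
open Polynomial

/-- Taylor's formula for a sequence `f` of successive derivatives. The derivative of the remainder
of order `n + 1` is the remainder of order `n` of the shifted sequence, so the mean value inequality
gives the induction; the factor `1/n!` is not needed. -/
theorem norm_sub_taylor_sum_le (n : ℕ) : ∀ (f : ℕ → ℝ → ℂ) (C ε : ℝ), 0 ≤ ε →
    (∀ k x, HasDerivAt (f k) (f (k + 1) x) x) → (∀ x ∈ Set.Icc 0 ε, ‖f n x‖ ≤ C) →
    ‖f 0 ε - ∑ k ∈ Finset.range n, ((ε ^ k / k.factorial : ℝ) : ℂ) * f k 0‖ ≤ C * ε ^ n := by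
  induction n with
  | zero =>
    intro f C ε hε hf hC
    simpa using hC ε ⟨hε, le_rfl⟩
  | succ n ih =>
    intro f C ε hε hf hC
    have hC0 : 0 ≤ C := (norm_nonneg _).trans (hC 0 ⟨le_rfl, hε⟩)
    set g : ℝ → ℂ := fun x => f 0 x -
      ∑ k ∈ Finset.range (n + 1), ((x ^ k / k.factorial : ℝ) : ℂ) * f k 0 with hg
    have hd : ∀ x, HasDerivAt g (f 1 x -
        ∑ k ∈ Finset.range n, ((x ^ k / k.factorial : ℝ) : ℂ) * f (k + 1) 0) x := by
      intro x
      have hs : HasDerivAt (fun x : ℝ => ∑ k ∈ Finset.range (n + 1),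
          ((x ^ k / k.factorial : ℝ) : ℂ) * f k 0)
          (∑ k ∈ Finset.range (n + 1), ((k * x ^ (k - 1) / k.factorial : ℝ) : ℂ) * f k 0) x := by
        refine HasDerivAt.fun_sum fun k _ => ?_
        exact (((hasDerivAt_pow k x).div_const _).ofReal_comp).mul_const _
      refine ((hf 0 x).sub hs).congr_deriv ?_
      rw [Finset.sum_range_succ']
      simp only [Nat.cast_zero, zero_mul, zero_div, Complex.ofReal_zero, add_zero, zero_add]
      congr 1
      refine Finset.sum_congr rfl fun k _ => ?_
      congr 2
      rw [Nat.factorial_succ]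
      push_cast
      have : (k.factorial : ℝ) ≠ 0 := by positivity
      field_simp
    have hb : ∀ x ∈ Set.Ico 0 ε, ‖f 1 x -
        ∑ k ∈ Finset.range n, ((x ^ k / k.factorial : ℝ) : ℂ) * f (k + 1) 0‖ ≤ C * ε ^ n := by
      intro x hx
      refine (ih (fun k => f (k + 1)) C x hx.1 (fun k y => hf (k + 1) y)
        (fun y hy => hC y ⟨hy.1, hy.2.trans hx.2.le⟩)).trans ?_
      have := hx.1
      have := hx.2.le
      gcongr
    have hmv := norm_image_sub_le_of_norm_deriv_le_segment' (f := g)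
      (fun x _ => (hd x).hasDerivWithinAt) hb ε ⟨hε, le_rfl⟩
    have hg0 : g 0 = 0 := by
      simp [hg, Finset.sum_range_succ']
    rw [hg0, sub_zero, sub_zero] at hmv
    refine hmv.trans (le_of_eq ?_)
    ring

/-- The generating function of the Hermite polynomials. -/
noncomputable def hermGen (τ : ℝ) (ζ : ℂ) (ε : ℝ) : ℂ :=
  Complex.exp (ε * τ * ζ - ε ^ 2 * ζ ^ 2 / 2)

/-- Differentiating the exponential in `ε` produces the factor `ζ (τ - ε ζ)`, and the recurrence
`He_{n+1} = X He_n - He_n'` absorbs it. At `ε = 0` the `n`-th derivative is `ζⁿ He_n(τ)`. -/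
theorem hasDerivAt_hermGen (τ : ℝ) (ζ : ℂ) (n : ℕ) (ε : ℝ) :
    HasDerivAt (fun ε : ℝ => ζ ^ n * aeval ((τ : ℂ) - ε * ζ) (hermR n) * hermGen τ ζ ε)
      (ζ ^ (n + 1) * aeval ((τ : ℂ) - ε * ζ) (hermR (n + 1)) * hermGen τ ζ ε) ε := by
  have h1 : HasDerivAt (fun ε : ℂ => ζ ^ n * aeval ((τ : ℂ) - ε * ζ) (hermR n) *
      Complex.exp (ε * τ * ζ - ε ^ 2 * ζ ^ 2 / 2))
      (ζ ^ (n + 1) * aeval ((τ : ℂ) - ε * ζ) (hermR (n + 1)) *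
        Complex.exp (ε * τ * ζ - ε ^ 2 * ζ ^ 2 / 2)) (ε : ℂ) := by
    have ha : HasDerivAt (fun ε : ℂ => (τ : ℂ) - ε * ζ) (-ζ) (ε : ℂ) := by
      simpa using ((hasDerivAt_id (ε : ℂ)).mul_const ζ).const_sub (τ : ℂ)
    have hp : HasDerivAt (fun w : ℂ => aeval w (hermR n))
        (aeval ((τ : ℂ) - ε * ζ) (derivative (hermR n))) ((τ : ℂ) - ε * ζ) :=
      Polynomial.hasDerivAt_aeval _ _
    have hc := hp.comp (ε : ℂ) ha
    have he : HasDerivAt (fun ε : ℂ => ε * τ * ζ - ε ^ 2 * ζ ^ 2 / 2)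
        (τ * ζ - ε * ζ ^ 2) (ε : ℂ) := by
      refine ((((hasDerivAt_id (ε : ℂ)).mul_const (τ : ℂ)).mul_const ζ).sub
        (((hasDerivAt_pow 2 (ε : ℂ)).mul_const (ζ ^ 2)).div_const 2)).congr_deriv ?_
      push_cast
      ring
    refine ((hc.const_mul (ζ ^ n)).mul he.cexp).congr_deriv ?_
    rw [hermR_succ]
    simp only [map_sub, map_mul, aeval_X, Function.comp_apply]
    ring
  exact h1.comp_ofReal

theorem norm_aeval_le (p : ℝ[X]) (n : ℕ) (hn : p.natDegree ≤ n) :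
    ∃ C : ℝ, 0 ≤ C ∧ ∀ w : ℂ, ‖aeval w p‖ ≤ C * (1 + ‖w‖) ^ n := by
  refine ⟨∑ i ∈ Finset.range (n + 1), |p.coeff i|, by positivity, fun w => ?_⟩
  rw [aeval_eq_sum_range' (Nat.lt_succ_of_le hn), Finset.sum_mul]
  refine (norm_sum_le _ _).trans (Finset.sum_le_sum fun i hi => ?_)
  rw [norm_smul, norm_pow, Real.norm_eq_abs]
  gcongr
  have := Finset.mem_range.1 hi
  calc ‖w‖ ^ i ≤ (1 + ‖w‖) ^ i := by gcongr; linarith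
    _ ≤ (1 + ‖w‖) ^ n := pow_le_pow_right₀ (by linarith [norm_nonneg w]) (by omega)

theorem natDegree_hermR_le (n : ℕ) : (hermR n).natDegree ≤ n :=
  natDegree_map_le.trans natDegree_hermite.le

theorem one_add_abs_pow_mul_exp_le (k : ℕ) (y : ℝ) :
    (1 + |y|) ^ k * Real.exp (-y ^ 2 / 2) ≤ k.factorial * Real.exp 2 := by
  have h1 := Real.pow_div_factorial_le_exp (1 + |y|) (by positivity) k
  rw [div_le_iff₀ (by positivity)] at h1
  calc (1 + |y|) ^ k * Real.exp (-y ^ 2 / 2)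
      ≤ (Real.exp (1 + |y|) * k.factorial) * Real.exp (-y ^ 2 / 2) := by gcongr
    _ = k.factorial * Real.exp (1 + |y| + -y ^ 2 / 2) := by
      rw [Real.exp_add (1 + |y|) (-y ^ 2 / 2)]; ring
    _ ≤ _ := by
      gcongr
      have := sq_abs y
      nlinarith [sq_nonneg (|y| - 1)]

/-- The complex variable `α + i w x`, which for a Gaussian `x` acts as `α` plus a centred
Gaussian of negative variance `-w²`. -/
noncomputable def zetaC (α w x : ℝ) : ℂ := α + (w * x : ℝ) * Complex.I

theorem norm_zetaC_le {α w x : ℝ} (hw : 0 ≤ w) :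
    ‖zetaC α w x‖ ≤ (1 + |α|) * (1 + w) * (1 + |x|) := by
  calc ‖zetaC α w x‖ ≤ |α| + w * |x| := by
        refine (norm_add_le _ _).trans (le_of_eq ?_)
        rw [norm_mul, Complex.norm_I, mul_one, Complex.norm_real, Complex.norm_real,
          Real.norm_eq_abs, Real.norm_eq_abs, abs_mul, abs_of_nonneg hw]
    _ ≤ _ := by
      have := abs_nonneg α
      have := abs_nonneg x
      have : 0 ≤ |α| * w := by positivity
      have : 0 ≤ |α| * |x| := by positivity
      have : 0 ≤ w * |x| := by positivity
      have : 0 ≤ |α| * (w * |x|) := by positivity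
      nlinarith

theorem norm_hermGen_zetaC (τ α w x ε : ℝ) : ‖hermGen τ (zetaC α w x) ε‖ =
    Real.exp (τ ^ 2 / 2) * Real.exp (-(τ - ε * α) ^ 2 / 2) *
      Real.exp ((ε * w) ^ 2 * x ^ 2 / 2) := by
  rw [hermGen, Complex.norm_exp, ← Real.exp_add, ← Real.exp_add]
  congr 1
  simp [zetaC, pow_two]
  ring

/-- The condition `ε w ≤ 1/2` keeps the growth caused by the imaginary part below `exp(x²/8)`, which
is integrable against the Gaussian. -/
theorem norm_hermGen_zetaC_le {τ α w x ε : ℝ} (hw : 0 ≤ w) (hε : 0 ≤ ε) (hεw : ε * w ≤ 1 / 2) :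
    ‖hermGen τ (zetaC α w x) ε‖ ≤
      Real.exp (τ ^ 2 / 2) * Real.exp (-(τ - ε * α) ^ 2 / 2) * Real.exp (x ^ 2 / 8) := by
  rw [norm_hermGen_zetaC]
  refine mul_le_mul_of_nonneg_left (Real.exp_le_exp.2 ?_) (by positivity)
  have h0 : 0 ≤ ε * w := by positivity
  have h2 : (ε * w) ^ 2 ≤ 1 / 4 := by nlinarith
  nlinarith [sq_nonneg x]

/-- The factor `exp(-(τ - ε α)²/2)` absorbs every power of `1 + |τ - ε α|`. Four of these powers,
with `(1 + |α|)⁴`, dominate `(1 + τ²)²` up to a constant: this buys the decay in `τ` and explains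
the exponent `n + 4`. The bound is polynomial in `α`, so finite moments suffice later. -/
theorem norm_hermGen_deriv_le (n : ℕ) : ∃ C : ℝ, 0 ≤ C ∧ ∀ {τ α w x ε : ℝ}, 0 ≤ w → 0 ≤ ε →
    ε ≤ 1 → ε * w ≤ 1 / 2 →
    ‖zetaC α w x ^ n * aeval ((τ : ℂ) - ε * zetaC α w x) (hermR n) *
      hermGen τ (zetaC α w x) ε‖ ≤
    C * (1 + w) ^ (2 * n) * ((1 + |α|) ^ (n + 4) * ((1 + |x|) ^ (2 * n) * Real.exp (x ^ 2 / 8)))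
      * (Real.exp (τ ^ 2 / 2) / (1 + τ ^ 2) ^ 2) := by
  obtain ⟨C, hC0, hC⟩ := norm_aeval_le (hermR n) n (natDegree_hermR_le n)
  refine ⟨C * (4 * ((n + 4).factorial * Real.exp 2)), by positivity, ?_⟩
  intro τ α w x ε hw hε hε1 hεw
  set y := τ - ε * α with hy
  have hz := norm_zetaC_le (α := α) (x := x) hw
  have hτz : 1 + ‖(τ : ℂ) - ε * zetaC α w x‖ ≤ (1 + |y|) * (1 + w) * (1 + |x|) := by
    -- The shifted argument is again of the form `zetaC`, now with real part `y`.
    have h1 : (τ : ℂ) - ε * zetaC α w x = zetaC y (ε * w) (-x) := by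
      simp only [zetaC, hy]; push_cast; ring
    have h2 : ‖zetaC y (ε * w) (-x)‖ ≤ |y| + w * |x| := by
      refine (norm_add_le _ _).trans ?_
      rw [norm_mul, Complex.norm_I, mul_one, Complex.norm_real, Complex.norm_real,
        Real.norm_eq_abs, Real.norm_eq_abs, abs_mul, abs_neg,
        abs_of_nonneg (show 0 ≤ ε * w by positivity)]
      have : ε * w ≤ w := mul_le_of_le_one_left hw hε1
      gcongr
    rw [h1]
    have := abs_nonneg y
    have := abs_nonneg x
    have : 0 ≤ |y| * w := by positivity
    have : 0 ≤ |y| * |x| := by positivity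
    have : 0 ≤ |y| * (w * |x|) := by positivity
    nlinarith
  have hg := norm_hermGen_zetaC_le (τ := τ) (α := α) (x := x) hw hε hεw
  rw [← hy] at hg
  have hτ : (1 + τ ^ 2) ^ 2 ≤ 4 * ((1 + |y|) ^ 4 * (1 + |α|) ^ 4) := by
    have h1 : 1 + τ ^ 2 ≤ 2 * ((1 + |y|) ^ 2 * (1 + |α|) ^ 2) := by
      have hτy : τ = y + ε * α := by rw [hy]; ring
      have e1 : |τ| ≤ |y| + |α| := by
        rw [hτy]
        refine (abs_add_le _ _).trans ?_
        rw [abs_mul, abs_of_nonneg hε]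
        gcongr
        exact mul_le_of_le_one_left (abs_nonneg _) hε1
      have e2 : 1 + |τ| ≤ (1 + |y|) * (1 + |α|) := by
        have : 0 ≤ |y| * |α| := by positivity
        linarith
      have e3 : 1 + τ ^ 2 ≤ (1 + |τ|) ^ 2 := by
        have := sq_abs τ
        nlinarith [abs_nonneg τ]
      calc 1 + τ ^ 2 ≤ (1 + |τ|) ^ 2 := e3
        _ ≤ ((1 + |y|) * (1 + |α|)) ^ 2 := by gcongr
        _ = (1 + |y|) ^ 2 * (1 + |α|) ^ 2 := by ring
        _ ≤ _ := by
          have : 0 ≤ (1 + |y|) ^ 2 * (1 + |α|) ^ 2 := by positivity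
          linarith
    calc (1 + τ ^ 2) ^ 2 ≤ (2 * ((1 + |y|) ^ 2 * (1 + |α|) ^ 2)) ^ 2 := by gcongr
      _ = _ := by ring
  have hexp := one_add_abs_pow_mul_exp_le (n + 4) y
  rw [mul_div_assoc', le_div_iff₀ (by positivity), norm_mul, norm_mul, norm_pow]
  calc ‖zetaC α w x‖ ^ n * ‖aeval ((τ : ℂ) - ε * zetaC α w x) (hermR n)‖ *
        ‖hermGen τ (zetaC α w x) ε‖ * (1 + τ ^ 2) ^ 2
      ≤ ((1 + |α|) * (1 + w) * (1 + |x|)) ^ n * (C * ((1 + |y|) * (1 + w) * (1 + |x|)) ^ n) *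
        (Real.exp (τ ^ 2 / 2) * Real.exp (-y ^ 2 / 2) * Real.exp (x ^ 2 / 8)) *
        (4 * ((1 + |y|) ^ 4 * (1 + |α|) ^ 4)) := by
        gcongr
        refine (hC _).trans ?_
        gcongr
    _ = C * (4 * ((1 + |y|) ^ (n + 4) * Real.exp (-y ^ 2 / 2))) * (1 + w) ^ (2 * n) *
        ((1 + |α|) ^ (n + 4) * ((1 + |x|) ^ (2 * n) * Real.exp (x ^ 2 / 8))) *
        Real.exp (τ ^ 2 / 2) := by
        generalize 1 + |α| = a
        generalize 1 + |y| = b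
        generalize 1 + |x| = c
        generalize 1 + w = d
        ring
    _ ≤ _ := by gcongr

/-- Remainder of the Hermite expansion of the generating function. -/
theorem norm_hermGen_sub_sum_le (n : ℕ) : ∃ C : ℝ, 0 ≤ C ∧ ∀ {τ α w x ε : ℝ}, 0 ≤ w → 0 ≤ ε →
    ε ≤ 1 → ε * w ≤ 1 / 2 →
    ‖hermGen τ (zetaC α w x) ε - ∑ k ∈ Finset.range n,
      ((ε ^ k / k.factorial * (hermR k).eval τ : ℝ) : ℂ) * zetaC α w x ^ k‖ ≤
    C * (1 + w) ^ (2 * n) * ((1 + |α|) ^ (n + 4) * ((1 + |x|) ^ (2 * n) * Real.exp (x ^ 2 / 8)))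
      * (Real.exp (τ ^ 2 / 2) / (1 + τ ^ 2) ^ 2) * ε ^ n := by
  obtain ⟨C, hC0, hC⟩ := norm_hermGen_deriv_le n
  refine ⟨C, hC0, ?_⟩
  intro τ α w x ε hw hε hε1 hεw
  have h := norm_sub_taylor_sum_le n (fun n ε => zetaC α w x ^ n *
    aeval ((τ : ℂ) - ε * zetaC α w x) (hermR n) * hermGen τ (zetaC α w x) ε) _ ε hε
    (fun k x' => hasDerivAt_hermGen τ (zetaC α w x) k x')
    (fun e he => hC (τ := τ) (α := α) (x := x) hw he.1 (he.2.trans hε1)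
      ((mul_le_mul_of_nonneg_right he.2 hw).trans hεw))
  refine le_trans (le_of_eq ?_) h
  congr 1
  have h0 : ∀ k, aeval (τ : ℂ) (hermR k) = (((hermR k).eval τ : ℝ) : ℂ) := fun k => by
    have := Polynomial.aeval_algebraMap_apply ℂ τ (hermR k)
    simpa using this
  simp only [pow_zero, hermR_zero, map_one, one_mul, Complex.ofReal_zero, zero_mul, sub_zero, h0]
  congr 1
  refine Finset.sum_congr rfl fun k _ => ?_
  simp [hermGen]
  ring

end GaussHermite

/-! ### The density ratio of a smoothed law and its Hermite expansion. -/

namespace GaussHermite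
open Polynomial

theorem integrable_gaussianReal_iff {f : ℝ → ℝ} :
    Integrable f (gaussianReal 0 1) ↔
      Integrable (fun x => (√(2 * Real.pi))⁻¹ * Real.exp (-x ^ 2 / 2) * f x) := by
  rw [gaussianReal_of_var_ne_zero 0 one_ne_zero,
    integrable_withDensity_iff_integrable_smul' (measurable_gaussianPDF 0 1)
      (ae_of_all _ fun x => gaussianPDF_lt_top)]
  simp [toReal_gaussianPDF, gaussianPDFReal]

theorem integrable_one_add_abs_pow_mul_exp (j : ℕ) :
    Integrable (fun x : ℝ => (1 + |x|) ^ j * Real.exp (x ^ 2 / 4)) (gaussianReal 0 1) := by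
  rw [integrable_gaussianReal_iff]
  have h := (integrable_exp_neg_mul_sq (b := 1 / 8) (by norm_num)).const_mul
    ((√(2 * Real.pi))⁻¹ * (j.factorial * Real.exp 3))
  refine h.mono' (by fun_prop) (ae_of_all _ fun x => ?_)
  have h1 := Real.pow_div_factorial_le_exp (1 + |x|) (by positivity) j
  rw [div_le_iff₀ (by positivity)] at h1
  rw [Real.norm_eq_abs, abs_of_nonneg (by positivity)]
  -- The constant comes from completing the square: `3 - x²/8 - (1 + |x| - x²/4) = (|x| - 4)²/8`.
  have h2 : Real.exp (1 + |x|) * (Real.exp (-x ^ 2 / 2) * Real.exp (x ^ 2 / 4)) ≤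
      Real.exp 3 * Real.exp (-(1 / 8) * x ^ 2) := by
    rw [← Real.exp_add, ← Real.exp_add, ← Real.exp_add]
    apply Real.exp_le_exp.2
    have := sq_abs x
    nlinarith [sq_nonneg (|x| - 4)]
  calc (√(2 * Real.pi))⁻¹ * Real.exp (-x ^ 2 / 2) * ((1 + |x|) ^ j * Real.exp (x ^ 2 / 4))
      ≤ (√(2 * Real.pi))⁻¹ * Real.exp (-x ^ 2 / 2) *
        ((Real.exp (1 + |x|) * j.factorial) * Real.exp (x ^ 2 / 4)) := by gcongr
    _ = (√(2 * Real.pi))⁻¹ * j.factorial *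
        (Real.exp (1 + |x|) * (Real.exp (-x ^ 2 / 2) * Real.exp (x ^ 2 / 4))) := by ring
    _ ≤ (√(2 * Real.pi))⁻¹ * j.factorial * (Real.exp 3 * Real.exp (-(1 / 8) * x ^ 2)) := by gcongr
    _ = _ := by ring

theorem integrable_one_add_abs_pow_mul_exp' (j : ℕ) :
    Integrable (fun x : ℝ => (1 + |x|) ^ j * Real.exp (x ^ 2 / 8)) (gaussianReal 0 1) := by
  refine (integrable_one_add_abs_pow_mul_exp j).mono' (by fun_prop) (ae_of_all _ fun x => ?_)
  rw [Real.norm_eq_abs, abs_of_nonneg (by positivity)]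
  have : x ^ 2 / 8 ≤ x ^ 2 / 4 := by nlinarith [sq_nonneg x]
  gcongr

theorem integrable_one_add_abs_pow (j : ℕ) :
    Integrable (fun x : ℝ => (1 + |x|) ^ j) (gaussianReal 0 1) := by
  refine (integrable_one_add_abs_pow_mul_exp j).mono' (by fun_prop) (ae_of_all _ fun x => ?_)
  rw [Real.norm_eq_abs, abs_of_nonneg (by positivity)]
  exact le_mul_of_one_le_right (by positivity) (Real.one_le_exp (by positivity))

/-- The borderline case: the exponential cancels the Gaussian density exactly, and `1/(1 + x²)` is
what remains to be integrated. -/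
theorem integrable_exp_div_one_add_sq :
    Integrable (fun x : ℝ => Real.exp ((1 + x ^ 2) / 2) / (1 + x ^ 2)) (gaussianReal 0 1) := by
  rw [integrable_gaussianReal_iff]
  refine (integrable_inv_one_add_sq.const_mul ((√(2 * Real.pi))⁻¹ * Real.exp (1 / 2))).congr
    (ae_of_all _ fun x => ?_)
  have h : Real.exp (1 / 2) = Real.exp (-x ^ 2 / 2) * Real.exp ((1 + x ^ 2) / 2) := by
    rw [← Real.exp_add]; congr 1; ring
  simp only [h]
  ring

theorem integrable_one_add_abs_sub_pow {ν : Measure ℝ} [IsProbabilityMeasure ν]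
    (hν : ∀ k : ℕ, MemLp id k ν) (m : ℝ) (j : ℕ) :
    Integrable (fun z => (1 + |z - m|) ^ j) ν := by
  have h1 : MemLp (fun z : ℝ => z - m) j ν := (hν j).sub (memLp_const m)
  have h2 : MemLp ((fun _ : ℝ => (1 : ℝ)) + fun z : ℝ => ‖z - m‖) j ν :=
    (memLp_const (1 : ℝ)).add h1.norm
  refine h2.integrable_norm_pow'.congr (ae_of_all _ fun z => ?_)
  simp only [Real.norm_eq_abs, Pi.add_apply]
  rw [abs_of_nonneg (a := 1 + |z - m|) (by positivity)]

/-- Density at `m + τ / ε` of `N(z, (1 - (ε w)²) / ε²)` relative to `N(m, 1 / ε²)`. -/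
noncomputable def gaussRatio (ε w m τ z : ℝ) : ℝ :=
  (√(1 - (ε * w) ^ 2))⁻¹ *
    Real.exp (τ ^ 2 / 2 - (τ - ε * (z - m)) ^ 2 / (2 * (1 - (ε * w) ^ 2)))

theorem gaussRatio_pos {ε w : ℝ} (h : (ε * w) ^ 2 < 1) (m τ z : ℝ) :
    0 < gaussRatio ε w m τ z := by
  have : 0 < 1 - (ε * w) ^ 2 := by linarith
  unfold gaussRatio
  positivity

/-- Averaging over the imaginary Gaussian shift deconvolves: it reduces the variance `1/ε²` by `w²`.
The computation is a Gaussian integral with an imaginary linear term. -/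
theorem integral_hermGen_zetaC {ε w : ℝ} (h : (ε * w) ^ 2 < 1) (m τ z : ℝ) :
    ∫ x, hermGen τ (zetaC (z - m) w x) ε ∂(gaussianReal 0 1) = (gaussRatio ε w m τ z : ℂ) := by
  set a := 1 - (ε * w) ^ 2 with ha
  have ha0 : 0 < a := by rw [ha]; linarith
  rw [integral_gaussianReal_eq_integral_smul one_ne_zero]
  have hfun : ∀ x : ℝ, gaussianPDFReal 0 1 x • hermGen τ (zetaC (z - m) w x) ε =
      ((√(2 * Real.pi))⁻¹ : ℝ) * Complex.exp ((-(a / 2) : ℝ) * x ^ 2 +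
        ((ε * w * (τ - ε * (z - m)) : ℝ) * Complex.I) * x +
        ((τ ^ 2 / 2 - (τ - ε * (z - m)) ^ 2 / 2 : ℝ) : ℂ)) := by
    intro x
    rw [Complex.real_smul, gaussianPDFReal, hermGen, zetaC]
    push_cast
    rw [mul_assoc, ← Complex.exp_add]
    simp only [mul_one]
    congr 2
    rw [ha]
    push_cast
    linear_combination (ε ^ 2 * w ^ 2 * (x : ℂ) ^ 2 / 2 * (-1)) * Complex.I_sq
  simp_rw [hfun]
  rw [integral_const_mul, integral_cexp_quadratic (by simpa using ha0)]
  have h1 : ((Real.pi : ℂ) / -((-(a / 2) : ℝ) : ℂ)) ^ (1 / 2 : ℂ) = ((√(2 * Real.pi / a) : ℝ) : ℂ) := by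
    rw [Real.sqrt_eq_rpow, Complex.ofReal_cpow (by positivity)]
    congr 1
    · push_cast
      have : (a : ℂ) ≠ 0 := by exact_mod_cast ha0.ne'
      field_simp
    · push_cast; rfl
  rw [h1, gaussRatio, ← ha]
  have h2 : ((τ ^ 2 / 2 - (τ - ε * (z - m)) ^ 2 / 2 : ℝ) : ℂ) -
      (((ε * w * (τ - ε * (z - m)) : ℝ) : ℂ) * Complex.I) ^ 2 / (4 * ((-(a / 2) : ℝ) : ℂ)) =
      ((τ ^ 2 / 2 - (τ - ε * (z - m)) ^ 2 / (2 * a) : ℝ) : ℂ) := by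
    rw [mul_pow, Complex.I_sq]
    have h3 : (τ - ε * (z - m)) ^ 2 / (2 * a) = (τ - ε * (z - m)) ^ 2 / 2 +
        (ε * w * (τ - ε * (z - m))) ^ 2 / (2 * a) := by
      field_simp
      rw [ha]; ring
    rw [h3]
    push_cast
    have : (a : ℂ) ≠ 0 := by exact_mod_cast ha0.ne'
    field_simp
    ring
  rw [h2, ← Complex.ofReal_exp, ← Complex.ofReal_mul, ← Complex.ofReal_mul, ← mul_assoc]
  congr 2
  rw [Real.sqrt_div (by positivity)]
  have : √(2 * Real.pi) ≠ 0 := by positivity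
  field_simp

/-- Density, in the rescaled variable, of `ν ∗ N(0, (1 - (ε w)²) / ε²)` relative to a Gaussian. -/
noncomputable def mixRatio (ν : Measure ℝ) (ε w m τ : ℝ) : ℝ :=
  ∫ z, gaussRatio ε w m τ z ∂ν

/-- Coefficients of the Hermite expansion of `mixRatio`. -/
noncomputable def hermCoeff (ν : Measure ℝ) (w m : ℝ) (k : ℕ) : ℝ :=
  ∫ p, (zetaC (p.1 - m) w p.2 ^ k).re ∂(ν.prod (gaussianReal 0 1))

@[fun_prop]
theorem continuous_zetaC {X : Type*} [TopologicalSpace X] {f g h : X → ℝ} (hf : Continuous f)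
    (hg : Continuous g) (hh : Continuous h) : Continuous fun x => zetaC (f x) (g x) (h x) := by
  unfold zetaC
  fun_prop

theorem mixRatio_nonneg (ν : Measure ℝ) {ε w : ℝ} (m τ : ℝ) (h : (ε * w) ^ 2 < 1) : 0 ≤ mixRatio ν ε w m τ :=
  integral_nonneg fun z => (gaussRatio_pos h m τ z).le

section
variable {ν : Measure ℝ} [IsProbabilityMeasure ν]

theorem integrable_hermGen_re {ε w : ℝ} (m τ : ℝ) (hw : 0 ≤ w) (hε : 0 ≤ ε) (hεw : ε * w ≤ 1 / 2) :
    Integrable (fun p : ℝ × ℝ => (hermGen τ (zetaC (p.1 - m) w p.2) ε).re)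
      (ν.prod (gaussianReal 0 1)) := by
  have h : Integrable (fun p : ℝ × ℝ => Real.exp (τ ^ 2 / 2) *
      ((1 + |p.2|) ^ 0 * Real.exp (p.2 ^ 2 / 8))) (ν.prod (gaussianReal 0 1)) :=
    (integrable_const (μ := ν) (Real.exp (τ ^ 2 / 2))).mul_prod
      (integrable_one_add_abs_pow_mul_exp' 0)
  refine h.mono' (by unfold hermGen; fun_prop) (ae_of_all _ fun p => ?_)
  refine (Complex.abs_re_le_norm _).trans ((norm_hermGen_zetaC_le hw hε hεw).trans ?_)
  rw [pow_zero, one_mul]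
  gcongr
  refine mul_le_of_le_one_right (by positivity) (Real.exp_le_one_iff.2 ?_)
  have := sq_nonneg (τ - ε * (p.1 - m))
  linarith

theorem sq_lt_one_of_le_half {a : ℝ} (h0 : 0 ≤ a) (h : a ≤ 1 / 2) : a ^ 2 < 1 := by nlinarith

theorem integrable_hermGen {ε w : ℝ} (α τ : ℝ) (hw : 0 ≤ w) (hε : 0 ≤ ε) (hεw : ε * w ≤ 1 / 2) :
    Integrable (fun x : ℝ => hermGen τ (zetaC α w x) ε) (gaussianReal 0 1) := by
  refine ((integrable_one_add_abs_pow_mul_exp' 0).const_mul (Real.exp (τ ^ 2 / 2))).mono'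
    (by unfold hermGen; fun_prop) (ae_of_all _ fun x => ?_)
  refine (norm_hermGen_zetaC_le hw hε hεw).trans ?_
  rw [pow_zero, one_mul]
  gcongr
  refine mul_le_of_le_one_right (by positivity) (Real.exp_le_one_iff.2 ?_)
  have := sq_nonneg (τ - ε * α)
  linarith

theorem mixRatio_eq_integral_prod {ε w : ℝ} (m τ : ℝ) (hw : 0 ≤ w) (hε : 0 ≤ ε)
    (hεw : ε * w ≤ 1 / 2) : mixRatio ν ε w m τ =
      ∫ p, (hermGen τ (zetaC (p.1 - m) w p.2) ε).re ∂(ν.prod (gaussianReal 0 1)) := by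
  rw [integral_prod _ (integrable_hermGen_re m τ hw hε hεw), mixRatio]
  congr 1
  ext z
  have h := integral_hermGen_zetaC (sq_lt_one_of_le_half (mul_nonneg hε hw) hεw) m τ z
  have h2 := integral_re (integrable_hermGen (z - m) τ hw hε hεw)
  simp only [RCLike.re_to_complex] at h2
  rw [h2, h, Complex.ofReal_re]

/-- The growth bound that controls the logarithm for large `τ`; the constant depends neither on `ν`
nor on `ε`. -/
theorem mixRatio_le : ∃ C : ℝ, ∀ (ν : Measure ℝ) [IsProbabilityMeasure ν] {ε w : ℝ} (m τ : ℝ),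
    0 ≤ w → 0 ≤ ε → ε * w ≤ 1 / 2 → mixRatio ν ε w m τ ≤ C * Real.exp (τ ^ 2 / 2) := by
  refine ⟨∫ x, (1 + |x|) ^ 0 * Real.exp (x ^ 2 / 8) ∂(gaussianReal 0 1), ?_⟩
  intro ν _ ε w m τ hw hε hεw
  have h : Integrable (fun p : ℝ × ℝ => Real.exp (τ ^ 2 / 2) *
      ((1 + |p.2|) ^ 0 * Real.exp (p.2 ^ 2 / 8))) (ν.prod (gaussianReal 0 1)) :=
    (integrable_const (μ := ν) (Real.exp (τ ^ 2 / 2))).mul_prod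
      (integrable_one_add_abs_pow_mul_exp' 0)
  rw [mixRatio_eq_integral_prod m τ hw hε hεw]
  refine (integral_mono (integrable_hermGen_re m τ hw hε hεw) h fun p => ?_).trans (le_of_eq ?_)
  · refine (Complex.re_le_norm _).trans ((norm_hermGen_zetaC_le hw hε hεw).trans ?_)
    simp only [pow_zero, one_mul]
    gcongr
    refine mul_le_of_le_one_right (by positivity) (Real.exp_le_one_iff.2 ?_)
    have := sq_nonneg (τ - ε * (p.1 - m))
    linarith
  · rw [integral_prod_mul (fun _ : ℝ => Real.exp (τ ^ 2 / 2))
      (fun x : ℝ => (1 + |x|) ^ 0 * Real.exp (x ^ 2 / 8))]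
    simp [mul_comm]

theorem integrable_zetaC_pow_re (hν : ∀ k : ℕ, MemLp id k ν) {w : ℝ} (hw : 0 ≤ w) (m : ℝ) (k : ℕ) :
    Integrable (fun p : ℝ × ℝ => (zetaC (p.1 - m) w p.2 ^ k).re)
      (ν.prod (gaussianReal 0 1)) := by
  have h := ((integrable_one_add_abs_sub_pow hν m k).mul_prod
    (integrable_one_add_abs_pow k)).const_mul ((1 + w) ^ k)
  refine h.mono' (by fun_prop) (ae_of_all _ fun p => ?_)
  refine (Complex.abs_re_le_norm _).trans ?_
  rw [norm_pow]
  calc ‖zetaC (p.1 - m) w p.2‖ ^ k ≤ ((1 + |p.1 - m|) * (1 + w) * (1 + |p.2|)) ^ k := by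
        gcongr; exact norm_zetaC_le hw
    _ = _ := by
      generalize 1 + |p.1 - m| = a
      generalize 1 + |p.2| = b
      generalize 1 + w = c
      ring

theorem abs_hermCoeff_le {w : ℝ} (hw : 0 ≤ w) (n : ℕ) : ∃ C : ℝ, 0 ≤ C ∧
    ∀ (ν : Measure ℝ) [IsProbabilityMeasure ν], (∀ k : ℕ, MemLp id k ν) → ∀ (m : ℝ) (k : ℕ),
      k ≤ n → |hermCoeff ν w m k| ≤ C * ∫ z, (1 + |z - m|) ^ n ∂ν := by
  refine ⟨(1 + w) ^ n * ∫ x, (1 + |x|) ^ n ∂(gaussianReal 0 1), by positivity, ?_⟩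
  intro ν _ hν m k hk
  have h := ((integrable_one_add_abs_sub_pow hν m n).mul_prod
    (integrable_one_add_abs_pow n)).const_mul ((1 + w) ^ n)
  rw [← Real.norm_eq_abs]
  refine (norm_integral_le_of_norm_le h (ae_of_all _ fun p => ?_)).trans (le_of_eq ?_)
  · refine (Complex.abs_re_le_norm _).trans ?_
    rw [norm_pow]
    calc ‖zetaC (p.1 - m) w p.2‖ ^ k ≤ ((1 + |p.1 - m|) * (1 + w) * (1 + |p.2|)) ^ k := by
          gcongr; exact norm_zetaC_le hw
      _ ≤ ((1 + |p.1 - m|) * (1 + w) * (1 + |p.2|)) ^ n := by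
          refine pow_le_pow_right₀ ?_ hk
          refine one_le_mul_of_one_le_of_one_le (one_le_mul_of_one_le_of_one_le ?_ ?_) ?_
          · linarith [abs_nonneg (p.1 - m)]
          · linarith
          · linarith [abs_nonneg p.2]
      _ = _ := by
        generalize 1 + |p.1 - m| = a
        generalize 1 + |p.2| = b
        generalize 1 + w = c
        ring
  · rw [integral_const_mul, integral_prod_mul (fun z : ℝ => (1 + |z - m|) ^ n)
      (fun x : ℝ => (1 + |x|) ^ n)]
    ring

/-- The pointwise remainder of the generating function is integrated over `ν` and the auxiliary
Gaussian. The law enters the bound only through one absolute moment. -/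
theorem abs_mixRatio_sub_sum_le {w : ℝ} (hw : 0 ≤ w) (n : ℕ) : ∃ C : ℝ, 0 ≤ C ∧
    ∀ (ν : Measure ℝ) [IsProbabilityMeasure ν], (∀ k : ℕ, MemLp id k ν) → ∀ (m τ ε : ℝ),
      0 ≤ ε → ε ≤ 1 → ε * w ≤ 1 / 2 →
      |mixRatio ν ε w m τ - ∑ k ∈ Finset.range n,
        ε ^ k / k.factorial * (hermR k).eval τ * hermCoeff ν w m k| ≤
      C * (∫ z, (1 + |z - m|) ^ (n + 4) ∂ν) * (Real.exp (τ ^ 2 / 2) / (1 + τ ^ 2) ^ 2) * ε ^ n := by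
  obtain ⟨C, hC0, hC⟩ := norm_hermGen_sub_sum_le n
  refine ⟨C * (1 + w) ^ (2 * n) *
    ∫ x, (1 + |x|) ^ (2 * n) * Real.exp (x ^ 2 / 8) ∂(gaussianReal 0 1), by positivity, ?_⟩
  intro ν _ hν m τ ε hε hε1 hεw
  have hsum : mixRatio ν ε w m τ - ∑ k ∈ Finset.range n,
        ε ^ k / k.factorial * (hermR k).eval τ * hermCoeff ν w m k =
      ∫ p, (hermGen τ (zetaC (p.1 - m) w p.2) ε - ∑ k ∈ Finset.range n,
        ((ε ^ k / k.factorial * (hermR k).eval τ : ℝ) : ℂ) * zetaC (p.1 - m) w p.2 ^ k).re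
        ∂(ν.prod (gaussianReal 0 1)) := by
    simp only [Complex.sub_re, Complex.re_sum, Complex.re_ofReal_mul]
    rw [integral_sub (integrable_hermGen_re m τ hw hε hεw)
      (integrable_finsetSum _ fun k _ => (integrable_zetaC_pow_re hν hw m k).const_mul _),
      integral_finsetSum _ fun k _ => (integrable_zetaC_pow_re hν hw m k).const_mul _,
      mixRatio_eq_integral_prod m τ hw hε hεw]
    simp only [integral_const_mul, hermCoeff]
  rw [hsum]
  have h := (((integrable_one_add_abs_sub_pow hν m (n + 4)).mul_prod
    (integrable_one_add_abs_pow_mul_exp' (2 * n))).const_mul (C * (1 + w) ^ (2 * n))).mul_const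
      (Real.exp (τ ^ 2 / 2) / (1 + τ ^ 2) ^ 2 * ε ^ n)
  rw [← Real.norm_eq_abs]
  refine (norm_integral_le_of_norm_le h (ae_of_all _ fun p => ?_)).trans (le_of_eq ?_)
  · refine (Complex.abs_re_le_norm _).trans ((hC hw hε hε1 hεw).trans (le_of_eq ?_))
    ring
  · rw [integral_mul_const, integral_const_mul, integral_prod_mul
      (fun z : ℝ => (1 + |z - m|) ^ (n + 4))
      (fun x : ℝ => (1 + |x|) ^ (2 * n) * Real.exp (x ^ 2 / 8))]
    ring

end

end GaussHermite

/-! ### Hermite coefficients as cumulants, and Gaussian integrals of the main terms. -/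

namespace GaussHermite
open Polynomial CumulantMoment KLExpansion

theorem integral_zetaC_pow_re_eq {p : ℝ[X]} {α w : ℝ} {k : ℕ}
    (h : ∀ x, (zetaC α w x ^ k).re = p.eval x) :
    ∫ x, (zetaC α w x ^ k).re ∂(gaussianReal 0 1) = gaussE p := by
  rw [gaussE_apply]
  simp_rw [h]

/-- For `w ≠ 0` these are the values `w^k He_k(α/w)`; in polynomial form they also cover a
degenerate `Z`, where `w = 0`. -/
theorem integral_zetaC_pow_re (α w : ℝ) :
    (∫ x, (zetaC α w x ^ 0).re ∂(gaussianReal 0 1) = 1) ∧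
    (∫ x, (zetaC α w x ^ 1).re ∂(gaussianReal 0 1) = α) ∧
    (∫ x, (zetaC α w x ^ 2).re ∂(gaussianReal 0 1) = α ^ 2 - w ^ 2) ∧
    (∫ x, (zetaC α w x ^ 3).re ∂(gaussianReal 0 1) = α ^ 3 - 3 * w ^ 2 * α) ∧
    (∫ x, (zetaC α w x ^ 4).re ∂(gaussianReal 0 1) = α ^ 4 - 6 * w ^ 2 * α ^ 2 + 3 * w ^ 4) ∧
    (∫ x, (zetaC α w x ^ 5).re ∂(gaussianReal 0 1) =
      α ^ 5 - 10 * w ^ 2 * α ^ 3 + 15 * w ^ 4 * α) ∧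
    (∫ x, (zetaC α w x ^ 6).re ∂(gaussianReal 0 1) =
      α ^ 6 - 15 * w ^ 2 * α ^ 4 + 45 * w ^ 4 * α ^ 2 - 15 * w ^ 6) := by
  have key : ∀ (k : ℕ) (a0 a1 a2 a3 : ℝ),
      (∀ x, (zetaC α w x ^ k).re = a0 + a1 * x ^ 2 + a2 * x ^ 4 + a3 * x ^ 6) →
      ∫ x, (zetaC α w x ^ k).re ∂(gaussianReal 0 1) = a0 + a1 + 3 * a2 + 15 * a3 := by
    intro k a0 a1 a2 a3 h
    rw [integral_zetaC_pow_re_eq (p := C a0 + C a1 * X ^ 2 + C a2 * X ^ 4 + C a3 * X ^ 6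
      + C 0 * X ^ 8 + C 0 * X ^ 10 + C 0 * X ^ 12) (fun x => by rw [h]; simp),
      gaussE_even_polynomial]
    ring
  refine ⟨?_, ?_, ?_, ?_, ?_, ?_, ?_⟩
  · simp
  · rw [key 1 α 0 0 0 (fun x => by simp [zetaC])]; ring
  · rw [key 2 (α ^ 2) (-w ^ 2) 0 0 (fun x => by simp [zetaC, pow_succ]; ring)]; ring
  · rw [key 3 (α ^ 3) (-3 * w ^ 2 * α) 0 0 (fun x => by simp [zetaC, pow_succ]; ring)]; ring
  · rw [key 4 (α ^ 4) (-6 * w ^ 2 * α ^ 2) (w ^ 4) 0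
      (fun x => by simp [zetaC, pow_succ]; ring)]; ring
  · rw [key 5 (α ^ 5) (-10 * w ^ 2 * α ^ 3) (5 * w ^ 4 * α) 0
      (fun x => by simp [zetaC, pow_succ]; ring)]; ring
  · rw [key 6 (α ^ 6) (-15 * w ^ 2 * α ^ 4) (15 * w ^ 4 * α ^ 2) (-w ^ 6)
      (fun x => by simp [zetaC, pow_succ]; ring)]; ring

section
variable {ν : Measure ℝ} [IsProbabilityMeasure ν]

theorem integrable_pow_of_memLp (hν : ∀ k : ℕ, MemLp id k ν) (k : ℕ) :
    Integrable (fun z : ℝ => z ^ k) ν := by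
  refine (hν k).integrable_norm_pow'.mono' (by fun_prop) (ae_of_all _ fun x => ?_)
  simp

theorem integral_polynomial_six (hν : ∀ k : ℕ, MemLp id k ν) (a0 a1 a2 a3 a4 a5 a6 : ℝ) :
    ∫ z, (a0 + a1 * z ^ 1 + a2 * z ^ 2 + a3 * z ^ 3 + a4 * z ^ 4 + a5 * z ^ 5 + a6 * z ^ 6) ∂ν =
      a0 + a1 * (∫ z, z ^ 1 ∂ν) + a2 * (∫ z, z ^ 2 ∂ν) + a3 * (∫ z, z ^ 3 ∂ν)
      + a4 * (∫ z, z ^ 4 ∂ν) + a5 * (∫ z, z ^ 5 ∂ν) + a6 * (∫ z, z ^ 6 ∂ν) := by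
  have h : ∀ (a : ℝ) (k : ℕ), Integrable (fun z : ℝ => a * z ^ k) ν := fun a k =>
    (integrable_pow_of_memLp hν k).const_mul a
  have h0 := integrable_const (μ := ν) a0
  have h1 : Integrable (fun z : ℝ => a0 + a1 * z ^ 1) ν := h0.add (h a1 1)
  have h2 : Integrable (fun z : ℝ => a0 + a1 * z ^ 1 + a2 * z ^ 2) ν := h1.add (h a2 2)
  have h3 : Integrable (fun z : ℝ => a0 + a1 * z ^ 1 + a2 * z ^ 2 + a3 * z ^ 3) ν := h2.add (h a3 3)
  have h4 : Integrable (fun z : ℝ => a0 + a1 * z ^ 1 + a2 * z ^ 2 + a3 * z ^ 3 + a4 * z ^ 4) ν := h3.add (h a4 4)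
  have h5 : Integrable (fun z : ℝ => a0 + a1 * z ^ 1 + a2 * z ^ 2 + a3 * z ^ 3 + a4 * z ^ 4 + a5 * z ^ 5) ν := h4.add (h a5 5)
  rw [integral_add h5 (h a6 6), integral_add h4 (h a5 5), integral_add h3 (h a4 4),
    integral_add h2 (h a3 3), integral_add h1 (h a2 2), integral_add h0 (h a1 1)]
  simp only [integral_const_mul, integral_const, probReal_univ, smul_eq_mul, one_mul]

theorem hermCoeff_eq_integral (hν : ∀ k : ℕ, MemLp id k ν) {w : ℝ} (hw : 0 ≤ w) (m : ℝ) (k : ℕ)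
    {a0 a1 a2 a3 a4 a5 a6 : ℝ}
    (h : ∀ z, ∫ x, (zetaC (z - m) w x ^ k).re ∂(gaussianReal 0 1) =
      a0 + a1 * z ^ 1 + a2 * z ^ 2 + a3 * z ^ 3 + a4 * z ^ 4 + a5 * z ^ 5 + a6 * z ^ 6) :
    hermCoeff ν w m k = a0 + a1 * (∫ z, z ^ 1 ∂ν) + a2 * (∫ z, z ^ 2 ∂ν) + a3 * (∫ z, z ^ 3 ∂ν)
      + a4 * (∫ z, z ^ 4 ∂ν) + a5 * (∫ z, z ^ 5 ∂ν) + a6 * (∫ z, z ^ 6 ∂ν) := by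
  rw [hermCoeff, integral_prod _ (integrable_zetaC_pow_re hν hw m k),
    ← integral_polynomial_six hν]
  simp_rw [h]

/-- The low-order Hermite coefficients expressed by cumulants. -/
theorem hermCoeff_eq_cumulant (hν : ∀ k : ℕ, MemLp id k ν) {w m : ℝ} (hw : 0 ≤ w)
    (hm : ∫ z, z ∂ν = m) (hv : ∫ z, z ^ 2 ∂ν = m ^ 2 + w ^ 2) :
    hermCoeff ν w m 0 = 1 ∧ hermCoeff ν w m 1 = 0 ∧ hermCoeff ν w m 2 = 0 ∧
    hermCoeff ν w m 3 = cumulant ν 3 ∧ hermCoeff ν w m 4 = cumulant ν 4 ∧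
    hermCoeff ν w m 5 = cumulant ν 5 ∧
    hermCoeff ν w m 6 = cumulant ν 6 + 10 * cumulant ν 3 ^ 2 := by
  have k1 := moment_eq_sum_cumulant ν hν 0
  have k2 := moment_eq_sum_cumulant ν hν 1
  have k3 := moment_eq_sum_cumulant ν hν 2
  have k4 := moment_eq_sum_cumulant ν hν 3
  have k5 := moment_eq_sum_cumulant ν hν 4
  have k6 := moment_eq_sum_cumulant ν hν 5
  have c1 : Nat.choose 4 2 = 6 := rfl
  have c2 : Nat.choose 5 2 = 10 := rfl
  have c3 : Nat.choose 5 3 = 10 := rfl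
  simp only [Finset.sum_range_succ, Finset.sum_range_zero, pow_zero, integral_const, probReal_univ,
    smul_eq_mul, mul_one, zero_add, Nat.choose_zero_right, Nat.cast_one, one_mul, tsub_zero,
    Nat.choose_self, Nat.choose_one_right, Nat.reduceAdd, Nat.reduceSub, Nat.cast_ofNat, c1, c2, c3,
    Nat.choose_succ_self_right] at k1 k2 k3 k4 k5 k6
  have hm' : ∫ z, z ^ 1 ∂ν = m := by simpa using hm
  rw [hm'] at k1
  rw [hm', hv] at k2
  -- The Hermite coefficients are the formal moments attached to the cumulants of `ν` with the first
  -- two replaced by zero. Hence orders three to five return the cumulants, and order six gains `10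
  -- κ_3²` from the ten splittings of six points into two triples.
  have hκ1 : cumulant ν 1 = m := k1.symm
  have hκ2 : cumulant ν 2 = w ^ 2 := by rw [hκ1] at k2; linarith
  rw [hκ1, hκ2, hm', hv] at k3
  rw [hκ1, hκ2, hm', hv, k3] at k4
  rw [hκ1, hκ2, hm', hv, k4, k3] at k5
  rw [hκ1, hκ2, hm', hv, k5, k4, k3] at k6
  obtain ⟨i0, i1, i2, i3, i4, i5, i6⟩ : _ ∧ _ ∧ _ ∧ _ ∧ _ ∧ _ ∧ _ :=
    ⟨fun z => (integral_zetaC_pow_re (z - m) w).1, fun z => (integral_zetaC_pow_re (z - m) w).2.1,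
    fun z => (integral_zetaC_pow_re (z - m) w).2.2.1,
    fun z => (integral_zetaC_pow_re (z - m) w).2.2.2.1,
    fun z => (integral_zetaC_pow_re (z - m) w).2.2.2.2.1,
    fun z => (integral_zetaC_pow_re (z - m) w).2.2.2.2.2.1,
    fun z => (integral_zetaC_pow_re (z - m) w).2.2.2.2.2.2⟩
  refine ⟨?_, ?_, ?_, ?_, ?_, ?_, ?_⟩
  · rw [hermCoeff_eq_integral hν hw m 0 (a0 := 1) (a1 := 0) (a2 := 0) (a3 := 0) (a4 := 0)
      (a5 := 0) (a6 := 0) (fun z => by rw [i0]; ring)]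
    ring
  · rw [hermCoeff_eq_integral hν hw m 1 (a0 := -m) (a1 := 1) (a2 := 0) (a3 := 0) (a4 := 0)
      (a5 := 0) (a6 := 0) (fun z => by rw [i1]; ring), hm']
    ring
  · rw [hermCoeff_eq_integral hν hw m 2 (a0 := m ^ 2 - w ^ 2) (a1 := -2 * m) (a2 := 1) (a3 := 0)
      (a4 := 0) (a5 := 0) (a6 := 0) (fun z => by rw [i2]; ring), hm', hv]
    ring
  · rw [hermCoeff_eq_integral hν hw m 3 (a0 := -m ^ 3 + 3 * w ^ 2 * m)
      (a1 := 3 * m ^ 2 - 3 * w ^ 2) (a2 := -3 * m) (a3 := 1)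
      (a4 := 0) (a5 := 0) (a6 := 0) (fun z => by rw [i3]; ring), hm', hv, k3]
    ring
  · rw [hermCoeff_eq_integral hν hw m 4 (a0 := m ^ 4 - 6 * w ^ 2 * m ^ 2 + 3 * w ^ 4)
      (a1 := -4 * m ^ 3 + 12 * w ^ 2 * m) (a2 := 6 * m ^ 2 - 6 * w ^ 2) (a3 := -4 * m)
      (a4 := 1) (a5 := 0) (a6 := 0) (fun z => by rw [i4]; ring), hm', hv, k4, k3]
    ring
  · rw [hermCoeff_eq_integral hν hw m 5
      (a0 := -m ^ 5 + 10 * w ^ 2 * m ^ 3 - 15 * w ^ 4 * m)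
      (a1 := 5 * m ^ 4 - 30 * w ^ 2 * m ^ 2 + 15 * w ^ 4)
      (a2 := -10 * m ^ 3 + 30 * w ^ 2 * m) (a3 := 10 * m ^ 2 - 10 * w ^ 2)
      (a4 := -5 * m) (a5 := 1) (a6 := 0) (fun z => by rw [i5]; ring), hm', hv, k5, k4, k3]
    ring
  · rw [hermCoeff_eq_integral hν hw m 6
      (a0 := m ^ 6 - 15 * w ^ 2 * m ^ 4 + 45 * w ^ 4 * m ^ 2 - 15 * w ^ 6)
      (a1 := -6 * m ^ 5 + 60 * w ^ 2 * m ^ 3 - 90 * w ^ 4 * m)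
      (a2 := 15 * m ^ 4 - 90 * w ^ 2 * m ^ 2 + 45 * w ^ 4)
      (a3 := -20 * m ^ 3 + 60 * w ^ 2 * m) (a4 := 15 * m ^ 2 - 15 * w ^ 2)
      (a5 := -6 * m) (a6 := 1) (fun z => by rw [i6]; ring), hm', hv, k6, k5, k4, k3]
    ring

end

theorem abs_eval_hermR_le (n : ℕ) : ∃ C : ℝ, 0 ≤ C ∧ ∀ k ≤ n, ∀ τ : ℝ,
    |(hermR k).eval τ| ≤ C * (1 + |τ|) ^ n := by
  choose C hC0 hC using fun k => norm_aeval_le (hermR k) k (natDegree_hermR_le k)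
  refine ⟨∑ k ∈ Finset.range (n + 1), C k, Finset.sum_nonneg fun k _ => hC0 k, ?_⟩
  intro k hk τ
  have h := hC k (τ : ℂ)
  have h0 : aeval (τ : ℂ) (hermR k) = (((hermR k).eval τ : ℝ) : ℂ) := by
    have := Polynomial.aeval_algebraMap_apply ℂ τ (hermR k)
    simpa using this
  rw [h0, Complex.norm_real, Complex.norm_real, Real.norm_eq_abs, Real.norm_eq_abs] at h
  have h1 : C k ≤ ∑ k ∈ Finset.range (n + 1), C k :=
    Finset.single_le_sum (fun i _ => hC0 i) (Finset.mem_range.2 (by omega))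
  have h2 : (1 + |τ|) ^ k ≤ (1 + |τ|) ^ n :=
    pow_le_pow_right₀ (by linarith [abs_nonneg τ]) hk
  have := hC0 k
  exact h.trans (mul_le_mul h1 h2 (by positivity) (this.trans h1))

theorem gaussE_smul_triple (x y z : ℝ) (p q r : ℝ[X]) :
    gaussE ((x • p) * (y • q) * (z • r)) = x * y * z * gaussE (p * q * r) := by
  have : (x • p) * (y • q) * (z • r) = (x * y * z) • (p * q * r) := by
    simp only [smul_eq_C_mul, C_mul]; ring
  rw [this, map_smul, smul_eq_mul]

/-- Products of odd total degree vanish, which leaves the index triples `334`, `336`, `345` and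
`444`. -/
theorem gaussE_cubic_terms (ε x3 x4 x5 x6 x7 : ℝ) {a b c d e : ℝ[X]} (ha : a = x3 • hermR 3)
    (hb : b = x4 • hermR 4) (hc : c = x5 • hermR 5) (hd : d = x6 • hermR 6)
    (he : e = x7 • hermR 7) :
    gaussE (a ^ 3 + C ε * (3 * (a ^ 2 * b))
      + C ε ^ 2 * (3 * (a ^ 2 * c) + 3 * (a * b ^ 2))
      + C ε ^ 3 * (3 * (a ^ 2 * d) + 6 * (a * b * c) + b ^ 3)
      + C ε ^ 4 * (3 * (a ^ 2 * e) + 6 * (a * b * d) + 3 * (a * c ^ 2) + 3 * (b ^ 2 * c))) =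
    ε * (648 * (x3 ^ 2 * x4)) +
      ε ^ 3 * (2160 * (x3 ^ 2 * x6) + 8640 * (x3 * x4 * x5) + 1728 * x4 ^ 3) := by
  have h : a ^ 3 + C ε * (3 * (a ^ 2 * b))
      + C ε ^ 2 * (3 * (a ^ 2 * c) + 3 * (a * b ^ 2))
      + C ε ^ 3 * (3 * (a ^ 2 * d) + 6 * (a * b * c) + b ^ 3)
      + C ε ^ 4 * (3 * (a ^ 2 * e) + 6 * (a * b * d) + 3 * (a * c ^ 2) + 3 * (b ^ 2 * c)) =
      (1 : ℝ) • (a * a * a) + (3 * ε) • (a * a * b) + (3 * ε ^ 2) • (a * a * c)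
      + (3 * ε ^ 2) • (a * b * b) + (3 * ε ^ 3) • (a * a * d) + (6 * ε ^ 3) • (a * b * c)
      + (ε ^ 3) • (b * b * b) + (3 * ε ^ 4) • (a * a * e) + (6 * ε ^ 4) • (a * b * d)
      + (3 * ε ^ 4) • (a * c * c) + (3 * ε ^ 4) • (b * b * c) := by
    simp only [smul_eq_C_mul, C_mul, C_pow, C_1, map_ofNat]
    ring
  rw [h]
  simp only [map_add, map_smul, smul_eq_mul]
  subst ha hb hc hd he
  simp only [gaussE_smul_triple]
  rw [gaussE_334, gaussE_336, gaussE_345, gaussE_444,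
    gaussE_triple_odd (i := 3) (j := 3) (k := 3) (by decide),
    gaussE_triple_odd (i := 3) (j := 3) (k := 5) (by decide),
    gaussE_triple_odd (i := 3) (j := 4) (k := 4) (by decide),
    gaussE_triple_odd (i := 3) (j := 3) (k := 7) (by decide),
    gaussE_triple_odd (i := 3) (j := 4) (k := 6) (by decide),
    gaussE_triple_odd (i := 3) (j := 5) (k := 5) (by decide),
    gaussE_triple_odd (i := 4) (j := 4) (k := 5) (by decide)]
  ring

theorem gaussE_quartic_terms (ε x3 x4 : ℝ) {a b : ℝ[X]} (ha : a = x3 • hermR 3)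
    (hb : b = x4 • hermR 4) :
    gaussE (a ^ 4 + C ε * (4 * (a ^ 3 * b))) = 3348 * x3 ^ 4 := by
  have h : a ^ 4 + C ε * (4 * (a ^ 3 * b)) =
      (x3 ^ 4) • (hermR 3 ^ 4) + (4 * ε * x3 ^ 3 * x4) • (hermR 3 ^ 3 * hermR 4) := by
    subst ha hb
    simp only [smul_eq_C_mul, C_mul, C_pow, map_ofNat]
    ring
  rw [h, map_add, map_smul, map_smul, gaussE_three_fourth, gaussE_three_cubed_four]
  simp only [smul_eq_mul]
  ring

/-- Parseval's identity for the Hermite polynomials, which satisfy `E He_k² = k!`. -/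
theorem gaussE_sq_sum (s : Finset ℕ) (c : ℕ → ℝ) :
    gaussE ((∑ k ∈ s, c k • hermR k) ^ 2) = ∑ k ∈ s, c k ^ 2 * k.factorial := by
  rw [pow_two, Finset.sum_mul_sum, map_sum]
  refine Finset.sum_congr rfl fun k hk => ?_
  rw [map_sum, Finset.sum_eq_single k]
  · rw [smul_mul_smul_comm, map_smul, gaussE_hermR_mul_hermR, if_pos rfl, smul_eq_mul, pow_two]
  · intro l _ hl
    rw [smul_mul_smul_comm, map_smul, gaussE_hermR_mul_hermR, if_neg (Ne.symm hl), smul_zero]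
  · exact fun h => absurd hk h

end GaussHermite

/-! ### The truncated expansion and its main polynomial. -/

namespace GaussHermite
open Polynomial KLExpansion

theorem continuous_gaussRatio (ε w m : ℝ) :
    Continuous (fun p : ℝ × ℝ => gaussRatio ε w m p.1 p.2) := by
  unfold gaussRatio
  fun_prop

theorem stronglyMeasurable_mixRatio (ν : Measure ℝ) [IsProbabilityMeasure ν] (ε w m : ℝ) :
    StronglyMeasurable (mixRatio ν ε w m) :=
  (continuous_gaussRatio ε w m).stronglyMeasurable.integral_prod_right

/-- The expansion, up to order `13` in `ε`, of the divergence of a smoothed law with the given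
cumulants from the Gaussian with the same mean and variance. -/
noncomputable def klMain (k3 k4 k5 k6 ε : ℝ) : ℝ :=
  k3 ^ 2 / 12 * ε ^ 6 + k4 ^ 2 / 48 * ε ^ 8 - k3 ^ 2 * k4 / 8 * ε ^ 10 + k5 ^ 2 / 240 * ε ^ 10
    + 7 * k3 ^ 4 / 48 * ε ^ 12 - k4 ^ 3 / 48 * ε ^ 12 - k3 * k4 * k5 / 12 * ε ^ 12
    + k6 ^ 2 / 1440 * ε ^ 12

/-- A Gaussian-integrable majorant of the pointwise error. -/
noncomputable def errWeight (τ : ℝ) : ℝ :=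
  ((1 + |τ|) ^ 41) ^ 5 * (1 + τ ^ 2) * Real.exp ((1 + τ ^ 2) / 4)
    + Real.exp ((1 + τ ^ 2) / 2) / (1 + τ ^ 2)

theorem integrable_errWeight : Integrable errWeight (gaussianReal 0 1) := by
  refine Integrable.add ?_ integrable_exp_div_one_add_sq
  -- Here `207 = 5 · 41 + 2`, the last two powers dominating `1 + τ²`.
  refine ((integrable_one_add_abs_pow_mul_exp 207).const_mul (Real.exp (1 / 4))).mono'
    (by fun_prop) (ae_of_all _ fun τ => ?_)
  rw [Real.norm_eq_abs, abs_of_nonneg (by positivity)]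
  have h1 : 1 + τ ^ 2 ≤ (1 + |τ|) ^ 2 := by
    have := sq_abs τ
    nlinarith [abs_nonneg τ]
  have h2 : Real.exp ((1 + τ ^ 2) / 4) = Real.exp (1 / 4) * Real.exp (τ ^ 2 / 4) := by
    rw [← Real.exp_add]; congr 1; ring
  rw [h2]
  calc ((1 + |τ|) ^ 41) ^ 5 * (1 + τ ^ 2) * (Real.exp (1 / 4) * Real.exp (τ ^ 2 / 4))
      ≤ ((1 + |τ|) ^ 41) ^ 5 * (1 + |τ|) ^ 2 * (Real.exp (1 / 4) * Real.exp (τ ^ 2 / 4)) := by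
        gcongr
    _ = _ := by
      rw [← pow_mul, ← pow_add]; ring

theorem one_le_integral_one_add_abs_sub_pow {ν : Measure ℝ} [IsProbabilityMeasure ν]
    (hν : ∀ k : ℕ, MemLp id k ν) (m : ℝ) (j : ℕ) : 1 ≤ ∫ z, (1 + |z - m|) ^ j ∂ν := by
  have h := integral_mono (integrable_const (1 : ℝ)) (integrable_one_add_abs_sub_pow hν m j)
    (fun z => one_le_pow₀ (by linarith [abs_nonneg (z - m)]))
  simpa using h

/-- The truncated Hermite expansion of `mixRatio - 1`. -/
noncomputable def hermTrunc (b : ℕ → ℝ) (ε : ℝ) : ℝ[X] :=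
  ∑ k ∈ Finset.Ico 3 42, (ε ^ k / k.factorial * b k) • hermR k

/-- Only the indices `3` to `7` contribute to the cubic and quartic terms of order below `14`; the
other terms are gathered into one bounded remainder. -/
theorem hermTrunc_eval_eq (b : ℕ → ℝ) (ε τ : ℝ) : (hermTrunc b ε).eval τ =
    ε ^ 3 * ((b 3 / 6) * (hermR 3).eval τ + ε * ((b 4 / 24) * (hermR 4).eval τ)
      + ε ^ 2 * ((b 5 / 120) * (hermR 5).eval τ) + ε ^ 3 * ((b 6 / 720) * (hermR 6).eval τ)
      + ε ^ 4 * ((b 7 / 5040) * (hermR 7).eval τ)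
      + ε ^ 5 * ∑ k ∈ Finset.Ico 8 42, ε ^ (k - 8) / k.factorial * b k * (hermR k).eval τ) := by
  rw [hermTrunc, eval_finsetSum]
  simp only [eval_smul, smul_eq_mul]
  rw [Finset.sum_eq_sum_Ico_succ_bot (by norm_num), Finset.sum_eq_sum_Ico_succ_bot (by norm_num),
    Finset.sum_eq_sum_Ico_succ_bot (by norm_num), Finset.sum_eq_sum_Ico_succ_bot (by norm_num),
    Finset.sum_eq_sum_Ico_succ_bot (by norm_num)]
  have h : ∑ k ∈ Finset.Ico (3 + 1 + 1 + 1 + 1 + 1) 42,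
      ε ^ k / k.factorial * b k * (hermR k).eval τ =
      ε ^ 8 * ∑ k ∈ Finset.Ico 8 42, ε ^ (k - 8) / k.factorial * b k * (hermR k).eval τ := by
    rw [Finset.mul_sum]
    refine Finset.sum_congr rfl fun k hk => ?_
    have h8 : 8 ≤ k := (Finset.mem_Ico.1 hk).1
    have : ε ^ k = ε ^ 8 * ε ^ (k - 8) := by rw [← pow_add]; congr 1; omega
    rw [this]
    ring
  rw [h]
  simp only [Nat.reduceAdd, Nat.factorial]
  push_cast
  ring

/-- The terms of `klPoly (hermTrunc b ε)` of order at most `13`, as a polynomial. -/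
noncomputable def klMainPoly (b : ℕ → ℝ) (ε : ℝ) : ℝ[X] :=
  let x3 := (b 3 / 6) • hermR 3
  let x4 := (b 4 / 24) • hermR 4
  let x5 := (b 5 / 120) • hermR 5
  let x6 := (b 6 / 720) • hermR 6
  let x7 := (b 7 / 5040) • hermR 7
  (1 / 2 : ℝ) • hermTrunc b ε ^ 2 - (ε ^ 9 / 6) • (x3 ^ 3 + C ε * (3 * (x3 ^ 2 * x4))
      + C ε ^ 2 * (3 * (x3 ^ 2 * x5) + 3 * (x3 * x4 ^ 2))
      + C ε ^ 3 * (3 * (x3 ^ 2 * x6) + 6 * (x3 * x4 * x5) + x4 ^ 3)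
      + C ε ^ 4 * (3 * (x3 ^ 2 * x7) + 6 * (x3 * x4 * x6) + 3 * (x3 * x5 ^ 2)
        + 3 * (x4 ^ 2 * x5)))
    + (ε ^ 12 / 12) • (x3 ^ 4 + C ε * (4 * (x3 ^ 3 * x4)))

/-- With `b_6 = κ_6 + 10κ_3²`, the cross term `κ_3² κ_6` cancels between the square (`20/1440`) and
the cube (`-1/72`), and `κ_3⁴` collects `100/1440 - 10/72 + 3348/(12 · 6⁴) = 7/48`. The squares with
`k ≥ 7` are already of order `ε¹⁴`. -/
theorem gaussE_klMainPoly (b : ℕ → ℝ) (ε : ℝ) : gaussE (klMainPoly b ε) =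
    klMain (b 3) (b 4) (b 5) (b 6 - 10 * b 3 ^ 2) ε
      + ∑ k ∈ Finset.Ico 7 42, b k ^ 2 / (2 * k.factorial) * ε ^ (2 * k) := by
  have h2 : gaussE (hermTrunc b ε ^ 2) = b 3 ^ 2 / 6 * ε ^ 6 + b 4 ^ 2 / 24 * ε ^ 8
      + b 5 ^ 2 / 120 * ε ^ 10 + b 6 ^ 2 / 720 * ε ^ 12
      + 2 * ∑ k ∈ Finset.Ico 7 42, b k ^ 2 / (2 * k.factorial) * ε ^ (2 * k) := by
    rw [hermTrunc, gaussE_sq_sum, Finset.mul_sum]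
    have hk : ∀ k : ℕ, (ε ^ k / k.factorial * b k) ^ 2 * k.factorial =
        2 * (b k ^ 2 / (2 * k.factorial) * ε ^ (2 * k)) := by
      intro k
      have : (k.factorial : ℝ) ≠ 0 := by positivity
      field_simp
      ring
    simp only [hk]
    rw [Finset.sum_eq_sum_Ico_succ_bot (by norm_num), Finset.sum_eq_sum_Ico_succ_bot (by norm_num),
      Finset.sum_eq_sum_Ico_succ_bot (by norm_num), Finset.sum_eq_sum_Ico_succ_bot (by norm_num)]
    simp only [Nat.reduceAdd, Nat.factorial, Nat.reduceMul]
    push_cast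
    ring
  rw [klMainPoly]
  simp only [map_add, map_sub, map_smul, smul_eq_mul]
  have h3 := gaussE_cubic_terms ε (b 3 / 6) (b 4 / 24) (b 5 / 120) (b 6 / 720) (b 7 / 5040)
    rfl rfl rfl rfl rfl
  have h4 := gaussE_quartic_terms ε (b 3 / 6) (b 4 / 24) rfl rfl
  simp only [map_add] at h3 h4
  rw [h2, h3, h4, klMain]
  ring

theorem abs_klPoly_sub_klMainPoly_le {b : ℕ → ℝ} {ε τ M A : ℝ} (hε0 : 0 ≤ ε) (hε1 : ε ≤ 1)
    (hM : ∀ k < 42, |b k| ≤ M) (hA : ∀ k < 42, |(hermR k).eval τ| ≤ A)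
    (hMA : 1 ≤ 34 * (M * A)) :
    |(hermTrunc b ε).eval τ| ≤ 6 * (34 * (M * A)) * ε ^ 3 ∧
    |klPoly ((hermTrunc b ε).eval τ) - (klMainPoly b ε).eval τ| ≤
      1000 * (34 * (M * A)) ^ 4 * ε ^ 14 := by
  have hM0 : 0 ≤ M := (abs_nonneg _).trans (hM 0 (by norm_num))
  have hA0 : 0 ≤ A := (abs_nonneg _).trans (hA 0 (by norm_num))
  have hMA0 : 0 ≤ M * A := mul_nonneg hM0 hA0
  -- There are 34 indices from 8 to 41, so `B` bounds the remainder sum as well as each leading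
  -- coefficient.
  set B := 34 * (M * A) with hB
  have term : ∀ (k : ℕ) (c : ℝ), k < 42 → 1 ≤ c → |b k / c * (hermR k).eval τ| ≤ M * A := by
    intro k c hk hc
    rw [abs_mul, abs_div, abs_of_pos (show 0 < c by linarith)]
    have h1 := hM k hk
    have h2 := hA k hk
    have : |b k| / c ≤ M := (div_le_self (abs_nonneg _) hc).trans h1
    gcongr
  have t : ∀ (k : ℕ) (c : ℝ), k < 42 → 1 ≤ c → |b k / c * (hermR k).eval τ| ≤ B :=
    fun k c hk hc => (term k c hk hc).trans (by linarith)
  have hR : |∑ k ∈ Finset.Ico 8 42, ε ^ (k - 8) / k.factorial * b k * (hermR k).eval τ| ≤ B := by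
    refine (Finset.abs_sum_le_sum_abs _ _).trans ?_
    refine (Finset.sum_le_card_nsmul _ _ (M * A) fun k hk => ?_).trans (le_of_eq ?_)
    · have hk2 := (Finset.mem_Ico.1 hk).2
      have h1 : ε ^ (k - 8) / k.factorial * b k * (hermR k).eval τ =
          ε ^ (k - 8) * (b k / k.factorial * (hermR k).eval τ) := by ring
      rw [h1, abs_mul, abs_of_nonneg (pow_nonneg hε0 _)]
      refine (mul_le_of_le_one_left (abs_nonneg _) (pow_le_one₀ hε0 hε1)).trans ?_
      exact term k _ hk2 (by exact_mod_cast Nat.one_le_iff_ne_zero.2 (Nat.factorial_ne_zero k))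
    · simp [hB]
  have h := abs_klPoly_sub_main_le hε0 hε1 hMA (t 3 6 (by norm_num) (by norm_num))
    (t 4 24 (by norm_num) (by norm_num)) (t 5 120 (by norm_num) (by norm_num))
    (t 6 720 (by norm_num) (by norm_num)) (t 7 5040 (by norm_num) (by norm_num)) hR
    (hermTrunc_eval_eq b ε τ)
  constructor
  · rw [hermTrunc_eval_eq]
    set R := ∑ k ∈ Finset.Ico 8 42, ε ^ (k - 8) / k.factorial * b k * (hermR k).eval τ
    have sm : ∀ (k : ℕ) {x : ℝ}, |x| ≤ B → |ε ^ k * x| ≤ B := by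
      intro k x hx
      rw [abs_mul, abs_of_nonneg (pow_nonneg hε0 k)]
      exact (mul_le_of_le_one_left (abs_nonneg _) (pow_le_one₀ hε0 hε1)).trans hx
    have s0 := t 3 6 (by norm_num) (by norm_num)
    have s1 := sm 1 (t 4 24 (by norm_num) (by norm_num))
    have s2 := sm 2 (t 5 120 (by norm_num) (by norm_num))
    have s3 := sm 3 (t 6 720 (by norm_num) (by norm_num))
    have s4 := sm 4 (t 7 5040 (by norm_num) (by norm_num))
    have s5 := sm 5 hR
    rw [pow_one] at s1
    rw [abs_mul, abs_of_nonneg (pow_nonneg hε0 3), mul_comm]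
    gcongr
    rw [abs_le] at *
    constructor <;> linarith [s0.1, s0.2, s1.1, s1.2, s2.1, s2.2, s3.1, s3.2, s4.1, s4.2,
      s5.1, s5.2]
  · refine le_trans (le_of_eq ?_) h
    congr 2
    simp only [klMainPoly, eval_add, eval_sub, eval_smul, eval_pow, eval_mul, eval_C, smul_eq_mul,
      eval_ofNat]
    ring

end GaussHermite

/-! ### Expansion of the divergence, uniformly over the input law. -/

namespace GaussHermite
open Polynomial KLExpansion

theorem sum_range_hermR_eq {b : ℕ → ℝ} (h0 : b 0 = 1) (h1 : b 1 = 0) (h2 : b 2 = 0) (ε τ : ℝ) :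
    ∑ k ∈ Finset.range 42, ε ^ k / k.factorial * (hermR k).eval τ * b k =
      1 + (hermTrunc b ε).eval τ := by
  rw [Finset.range_eq_Ico, Finset.sum_eq_sum_Ico_succ_bot (by norm_num),
    Finset.sum_eq_sum_Ico_succ_bot (by norm_num), Finset.sum_eq_sum_Ico_succ_bot (by norm_num),
    h0, h1, h2, hermTrunc, eval_finsetSum]
  simp only [eval_smul, smul_eq_mul, hermR_zero, eval_one]
  norm_num
  exact Finset.sum_congr rfl fun k _ => by ring

set_option maxHeartbeats 1000000 in
theorem abs_klFun_mixRatio_sub_le {w : ℝ} (hw : 0 ≤ w) : ∃ C : ℝ, 0 ≤ C ∧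
    ∀ (ν : Measure ℝ) [IsProbabilityMeasure ν], (∀ k : ℕ, MemLp id k ν) → ∀ (m : ℝ),
      ∫ z, z ∂ν = m → ∫ z, z ^ 2 ∂ν = m ^ 2 + w ^ 2 → ∀ ε : ℝ, 0 < ε → ε ≤ 1 → ε * w ≤ 1 / 2 →
      (∀ τ, |klFun (mixRatio ν ε w m τ) - (klMainPoly (hermCoeff ν w m) ε).eval τ| ≤
        (C * (∫ z, (1 + |z - m|) ^ 46 ∂ν) ^ 5 * ε ^ 14) * errWeight τ) ∧
      |∑ k ∈ Finset.Ico 7 42, hermCoeff ν w m k ^ 2 / (2 * k.factorial) * ε ^ (2 * k)| ≤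
        C * (∫ z, (1 + |z - m|) ^ 46 ∂ν) ^ 5 * ε ^ 14 := by
  obtain ⟨C1, hC1, hb⟩ := abs_hermCoeff_le hw 46
  obtain ⟨C2, hC2, hH⟩ := abs_eval_hermR_le 41
  obtain ⟨C3, hC3, hD⟩ := abs_mixRatio_sub_sum_le hw 42
  obtain ⟨C4, hC4⟩ := mixRatio_le
  -- Adding one makes the constants at least `1`, as the pointwise estimates require.
  obtain ⟨D1, hD1⟩ : ∃ D1, D1 = C1 + 1 := ⟨_, rfl⟩
  obtain ⟨D2, hD2⟩ : ∃ D2, D2 = C2 + 1 := ⟨_, rfl⟩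
  have hD1' : 0 ≤ D1 := by linarith
  have hD2' : 0 ≤ D2 := by linarith
  have hD12 : 1 ≤ D1 * D2 := one_le_mul_of_one_le_of_one_le (by linarith) (by linarith)
  obtain ⟨K, hK⟩ : ∃ K, K = 204 * (D1 * D2) + C3 + |C4| := ⟨_, rfl⟩
  have hK1 : 1 ≤ K := by have := abs_nonneg C4; linarith
  -- The summands account for replacing `klFun` by `klPoly`, for dropping the terms of `klPoly` of
  -- order at least `14`, and for the 35 squares with index 7 to 41.
  refine ⟨4000 * K ^ 5 + 1000 * (34 * (D1 * D2)) ^ 4 + 35 * D1 ^ 2, by positivity, ?_⟩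
  intro ν _ hν m hm hv ε hε0 hε1 hεw
  have hS1 := one_le_integral_one_add_abs_sub_pow hν m 46
  have hDD := hD ν hν m
  have hbb := hb ν hν m
  simp only [Nat.reduceAdd] at hDD
  generalize ∫ z, (1 + |z - m|) ^ 46 ∂ν = S at hS1 hDD hbb ⊢
  set b := hermCoeff ν w m with hbdef
  obtain ⟨b0, b1, b2, -⟩ := hermCoeff_eq_cumulant hν hw hm hv
  have hbM : ∀ k < 42, |b k| ≤ D1 * S := fun k hk =>
    (hbb k (by omega)).trans (by gcongr; linarith)
  constructor
  · intro τ
    obtain ⟨W, hW⟩ : ∃ W, W = (1 + |τ|) ^ 41 := ⟨_, rfl⟩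
    have hW1 : 1 ≤ W := by rw [hW]; exact one_le_pow₀ (by linarith [abs_nonneg τ])
    have hHA : ∀ k < 42, |(hermR k).eval τ| ≤ D2 * W := fun k hk =>
      (hH k (by omega) τ).trans (by rw [← hW]; gcongr; linarith)
    have hMA : 1 ≤ 34 * ((D1 * S) * (D2 * W)) := by
      have : 1 ≤ (D1 * D2) * (S * W) :=
        one_le_mul_of_one_le_of_one_le hD12 (one_le_mul_of_one_le_of_one_le hS1 hW1)
      calc (1 : ℝ) ≤ (D1 * D2) * (S * W) := this
        _ ≤ 34 * ((D1 * D2) * (S * W)) := by linarith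
        _ = _ := by ring
    obtain ⟨hU, hP⟩ := abs_klPoly_sub_klMainPoly_le hε0.le hε1 hbM hHA hMA
    obtain ⟨r, hr⟩ : ∃ r, r = mixRatio ν ε w m τ := ⟨_, rfl⟩
    obtain ⟨U, hUdef⟩ : ∃ U, U = (hermTrunc b ε).eval τ := ⟨_, rfl⟩
    have hDb := hDD τ ε hε0.le hε1 hεw
    rw [sum_range_hermR_eq b0 b1 b2, ← hr, ← hUdef] at hDb
    rw [← hUdef] at hU hP
    have hr0 : 0 ≤ r := by
      rw [hr]
      exact mixRatio_nonneg ν m τ (sq_lt_one_of_le_half (mul_nonneg hε0.le hw) hεw)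
    have hr1 := hC4 ν m τ hw hε0.le hεw
    rw [← hr] at hr1 ⊢
    have hEw : errWeight τ = W ^ 5 * (1 + τ ^ 2) * Real.exp ((1 + τ ^ 2) / 4)
        + Real.exp ((1 + τ ^ 2) / 2) / (1 + τ ^ 2) := by rw [errWeight, hW]
    have hT1 : 1 ≤ 1 + τ ^ 2 := by nlinarith [sq_nonneg τ]
    have hexp : Real.exp (τ ^ 2 / 2) ≤ Real.exp ((1 + τ ^ 2) / 2) :=
      Real.exp_le_exp.2 (by linarith)
    have hmain := abs_klFun_sub_klPoly_le_of_approx (ε := ε) (S := S) (W := W) (T := 1 + τ ^ 2)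
      (r := r) (U := U) (D := r - (1 + U)) (C := K) hε0 hε1 hS1 hW1 hK1 hT1
      hr0
      (by
        refine hr1.trans ?_
        calc C4 * Real.exp (τ ^ 2 / 2) ≤ |C4| * Real.exp ((1 + τ ^ 2) / 2) := by
              gcongr; exact le_abs_self _
          _ ≤ K * Real.exp ((1 + τ ^ 2) / 2) := by gcongr; rw [hK]; linarith)
      (by ring)
      (by
        refine hU.trans ?_
        calc 6 * (34 * ((D1 * S) * (D2 * W))) * ε ^ 3
            = (204 * (D1 * D2)) * S * ε ^ 3 * W := by ring
          _ ≤ K * S * ε ^ 3 * W := by gcongr; have := abs_nonneg C4; linarith)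
      (by
        refine hDb.trans ?_
        calc C3 * S * (Real.exp (τ ^ 2 / 2) / (1 + τ ^ 2) ^ 2) * ε ^ 42
            ≤ C3 * S * (Real.exp ((1 + τ ^ 2) / 2) / (1 + τ ^ 2) ^ 2) * ε ^ 42 := by gcongr
          _ = C3 * S * ε ^ 42 * (Real.exp ((1 + τ ^ 2) / 2) / (1 + τ ^ 2) ^ 2) := by ring
          _ ≤ _ := by gcongr; have := abs_nonneg C4; linarith)
    rw [← hEw] at hmain
    have hWw : W ^ 4 ≤ errWeight τ := by
      have e1 : 1 ≤ (1 + τ ^ 2) * Real.exp ((1 + τ ^ 2) / 4) :=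
        one_le_mul_of_one_le_of_one_le hT1 (Real.one_le_exp (by positivity))
      calc W ^ 4 ≤ W ^ 5 := pow_le_pow_right₀ hW1 (by norm_num)
        _ ≤ W ^ 5 * ((1 + τ ^ 2) * Real.exp ((1 + τ ^ 2) / 4)) :=
          le_mul_of_one_le_right (by positivity) e1
        _ = W ^ 5 * (1 + τ ^ 2) * Real.exp ((1 + τ ^ 2) / 4) := by ring
        _ ≤ _ := by
          rw [hEw]
          exact le_add_of_nonneg_right (by positivity)
    have hEw0 : 0 ≤ errWeight τ := by rw [hEw]; positivity
    calc |klFun r - (klMainPoly b ε).eval τ| ≤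
          |klFun r - klPoly U| + |klPoly U - (klMainPoly b ε).eval τ| := abs_sub_le _ _ _
      _ ≤ 4000 * K ^ 5 * S ^ 5 * ε ^ 14 * errWeight τ +
          1000 * (34 * ((D1 * S) * (D2 * W))) ^ 4 * ε ^ 14 := add_le_add hmain hP
      _ = 4000 * K ^ 5 * S ^ 5 * ε ^ 14 * errWeight τ +
          1000 * (34 * (D1 * D2)) ^ 4 * S ^ 4 * ε ^ 14 * W ^ 4 := by ring
      _ ≤ 4000 * K ^ 5 * S ^ 5 * ε ^ 14 * errWeight τ +
          1000 * (34 * (D1 * D2)) ^ 4 * S ^ 5 * ε ^ 14 * errWeight τ := by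
        have hS45 : S ^ 4 ≤ S ^ 5 := pow_le_pow_right₀ hS1 (by norm_num)
        gcongr
      _ ≤ 4000 * K ^ 5 * S ^ 5 * ε ^ 14 * errWeight τ +
          1000 * (34 * (D1 * D2)) ^ 4 * S ^ 5 * ε ^ 14 * errWeight τ +
          35 * D1 ^ 2 * S ^ 5 * ε ^ 14 * errWeight τ := le_add_of_nonneg_right (by positivity)
      _ = _ := by ring
  · have hterm : ∀ k ∈ Finset.Ico 7 42, |b k ^ 2 / (2 * k.factorial) * ε ^ (2 * k)| ≤
        D1 ^ 2 * S ^ 5 * ε ^ 14 := by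
      intro k hk
      obtain ⟨hk7, hk42⟩ := Finset.mem_Ico.1 hk
      have h1 : b k ^ 2 ≤ (D1 * S) ^ 2 := sq_le_sq' (abs_le.1 (hbM k hk42)).1 (abs_le.1 (hbM k hk42)).2
      have h2 : b k ^ 2 / (2 * k.factorial) ≤ b k ^ 2 := by
        refine div_le_self (by positivity) ?_
        have : (1 : ℝ) ≤ k.factorial := by
          exact_mod_cast Nat.one_le_iff_ne_zero.2 (Nat.factorial_ne_zero k)
        linarith
      have h3 : ε ^ (2 * k) ≤ ε ^ 14 := pow_le_pow_of_le_one hε0.le hε1 (by omega)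
      have h4 : S ^ 2 ≤ S ^ 5 := pow_le_pow_right₀ hS1 (by norm_num)
      rw [abs_of_nonneg (by positivity)]
      calc b k ^ 2 / (2 * k.factorial) * ε ^ (2 * k) ≤ (D1 * S) ^ 2 * ε ^ 14 := by
            gcongr; exact h2.trans h1
        _ = D1 ^ 2 * S ^ 2 * ε ^ 14 := by ring
        _ ≤ _ := by gcongr
    refine (Finset.abs_sum_le_sum_abs _ _).trans ?_
    refine (Finset.sum_le_card_nsmul _ _ _ hterm).trans ?_
    simp only [Nat.card_Ico, nsmul_eq_mul]
    have : 0 ≤ (4000 * K ^ 5 + 1000 * (34 * (D1 * D2)) ^ 4) * (S ^ 5 * ε ^ 14) := by positivity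
    norm_num
    linarith

/-- Expansion of the divergence of a smoothed law, with an error controlled by an absolute
moment, uniformly over all laws with the given mean and variance. -/
theorem abs_integral_klFun_mixRatio_sub_klMain_le {w : ℝ} (hw : 0 ≤ w) : ∃ C : ℝ, 0 ≤ C ∧
    ∀ (ν : Measure ℝ) [IsProbabilityMeasure ν], (∀ k : ℕ, MemLp id k ν) → ∀ (m : ℝ),
      ∫ z, z ∂ν = m → ∫ z, z ^ 2 ∂ν = m ^ 2 + w ^ 2 → ∀ ε : ℝ, 0 < ε → ε ≤ 1 → ε * w ≤ 1 / 2 →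
      Integrable (fun τ => klFun (mixRatio ν ε w m τ)) (gaussianReal 0 1) ∧
      |∫ τ, klFun (mixRatio ν ε w m τ) ∂(gaussianReal 0 1) -
        klMain (cumulant ν 3) (cumulant ν 4) (cumulant ν 5) (cumulant ν 6) ε| ≤
        C * (∫ z, (1 + |z - m|) ^ 46 ∂ν) ^ 5 * ε ^ 14 := by
  obtain ⟨C, hC, h⟩ := abs_klFun_mixRatio_sub_le hw
  refine ⟨C * ∫ τ, errWeight τ ∂(gaussianReal 0 1) + C, ?_, ?_⟩
  · have : 0 ≤ ∫ τ, errWeight τ ∂(gaussianReal 0 1) :=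
      integral_nonneg fun τ => by unfold errWeight; positivity
    positivity
  intro ν _ hν m hm hv ε hε0 hε1 hεw
  obtain ⟨hpt, hs⟩ := h ν hν m hm hv ε hε0 hε1 hεw
  set S := ∫ z, (1 + |z - m|) ^ 46 ∂ν
  have hpoly := integrable_polynomial_gaussian (klMainPoly (hermCoeff ν w m) ε)
  have hbd := integrable_errWeight.const_mul (C * S ^ 5 * ε ^ 14)
  have hmeas : AEStronglyMeasurable (fun τ => klFun (mixRatio ν ε w m τ)) (gaussianReal 0 1) :=
    (measurable_klFun.comp (stronglyMeasurable_mixRatio ν ε w m).measurable).aestronglyMeasurable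
  have hdiff : Integrable (fun τ => klFun (mixRatio ν ε w m τ) -
      (klMainPoly (hermCoeff ν w m) ε).eval τ) (gaussianReal 0 1) :=
    hbd.mono' (hmeas.sub hpoly.aestronglyMeasurable) (ae_of_all _ hpt)
  have hint : Integrable (fun τ => klFun (mixRatio ν ε w m τ)) (gaussianReal 0 1) := by
    refine (hdiff.add hpoly).congr (ae_of_all _ fun τ => ?_)
    simp
  refine ⟨hint, ?_⟩
  obtain ⟨-, -, -, b3, b4, b5, b6⟩ := hermCoeff_eq_cumulant hν hw hm hv
  have hval := gaussE_klMainPoly (hermCoeff ν w m) ε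
  rw [b3, b4, b5, b6, add_sub_cancel_right] at hval
  have h1 : |∫ τ, klFun (mixRatio ν ε w m τ) ∂(gaussianReal 0 1) -
      gaussE (klMainPoly (hermCoeff ν w m) ε)| ≤
      C * S ^ 5 * ε ^ 14 * ∫ τ, errWeight τ ∂(gaussianReal 0 1) := by
    rw [gaussE_apply, ← integral_sub hint hpoly, ← integral_const_mul, ← Real.norm_eq_abs]
    exact norm_integral_le_of_norm_le hbd (ae_of_all _ hpt)
  set q := ∑ k ∈ Finset.Ico 7 42, hermCoeff ν w m k ^ 2 / (2 * k.factorial) * ε ^ (2 * k)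
  rw [hval] at h1
  set M := klMain (cumulant ν 3) (cumulant ν 4) (cumulant ν 5) (cumulant ν 6) ε
  calc |∫ τ, klFun (mixRatio ν ε w m τ) ∂(gaussianReal 0 1) - M|
      ≤ |∫ τ, klFun (mixRatio ν ε w m τ) ∂(gaussianReal 0 1) - (M + q)| + |(M + q) - M| :=
        abs_sub_le _ _ _
    _ ≤ C * S ^ 5 * ε ^ 14 * ∫ τ, errWeight τ ∂(gaussianReal 0 1) + C * S ^ 5 * ε ^ 14 := by
      rw [add_sub_cancel_left]
      exact add_le_add h1 hs
    _ = _ := by ring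

end GaussHermite

/-! ### Output densities of the Gaussian channel. -/

namespace GaussChannel
open GaussHermite

/-- Inverse standard deviation of the channel output. -/
noncomputable def invSd (s w : ℝ≥0) : ℝ := (√((s : ℝ) ^ 2 + (w : ℝ) ^ 2))⁻¹

theorem invSd_pos {s : ℝ≥0} (hs : 0 < s) (w : ℝ≥0) : 0 < invSd s w := by
  have : (0 : ℝ) < s := by exact_mod_cast hs
  unfold invSd
  positivity

theorem one_sub_invSd_mul_sq {s : ℝ≥0} (hs : 0 < s) (w : ℝ≥0) :
    1 - (invSd s w * w) ^ 2 = (s : ℝ) ^ 2 * invSd s w ^ 2 := by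
  have h0 : (0 : ℝ) < s := by exact_mod_cast hs
  have h1 : (0 : ℝ) < (s : ℝ) ^ 2 + (w : ℝ) ^ 2 := by positivity
  rw [mul_pow, invSd, inv_pow, Real.sq_sqrt h1.le]
  field_simp
  ring

theorem invSd_mul_sq_lt_one {s : ℝ≥0} (hs : 0 < s) (w : ℝ≥0) : (invSd s w * w) ^ 2 < 1 := by
  have h := one_sub_invSd_mul_sq hs w
  have h0 : (0 : ℝ) < s := by exact_mod_cast hs
  have := invSd_pos hs w
  have : 0 < (s : ℝ) ^ 2 * invSd s w ^ 2 := by positivity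
  linarith

/-- Gaussian reference law with the mean and variance of the channel output. -/
noncomputable def refGauss (s w : ℝ≥0) (m : ℝ) : Measure ℝ := gaussianReal m (s ^ 2 + w ^ 2)

instance (s w : ℝ≥0) (m : ℝ) : IsProbabilityMeasure (refGauss s w m) := by
  unfold refGauss; infer_instance

theorem map_refGauss {s : ℝ≥0} (hs : 0 < s) (w : ℝ≥0) (m : ℝ) :
    (refGauss s w m).map (fun y => invSd s w * (y - m)) = gaussianReal 0 1 := by
  have h : (fun y => invSd s w * (y - m)) = (fun x => invSd s w * x) ∘ fun y => y - m := rfl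
  rw [h, ← Measure.map_map (by fun_prop) (by fun_prop), refGauss, gaussianReal_map_sub_const,
    gaussianReal_map_const_mul]
  congr 1
  · simp
  · have h0 : (0 : ℝ) < s := by exact_mod_cast hs
    have h1 : (0 : ℝ) < (s : ℝ) ^ 2 + (w : ℝ) ^ 2 := by positivity
    ext
    push_cast
    rw [invSd, inv_pow, Real.sq_sqrt h1.le]
    field_simp

/-- Density of the channel output relative to `refGauss`, for an input with law `ν`. -/
noncomputable def outDens (ν : Measure ℝ) (s w : ℝ≥0) (m y : ℝ) : ℝ :=
  mixRatio ν (invSd s w) w m (invSd s w * (y - m))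

/-- For `ε = 1/√(s² + w²)` one has `(1 - (ε w)²)/ε² = s²`, so `gaussRatio` is the density of the
noise centred at `z` relative to the reference law. -/
theorem gaussianPDFReal_eq_mul_gaussRatio {s : ℝ≥0} (hs : 0 < s) (w : ℝ≥0) (m z y : ℝ) :
    gaussianPDFReal z (s ^ 2) y =
      gaussianPDFReal m (s ^ 2 + w ^ 2) y *
        gaussRatio (invSd s w) w m (invSd s w * (y - m)) z := by
  have h0 : (0 : ℝ) < s := by exact_mod_cast hs
  have h1 : (0 : ℝ) < (s : ℝ) ^ 2 + (w : ℝ) ^ 2 := by positivity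
  rw [gaussianPDFReal, gaussianPDFReal, gaussRatio, one_sub_invSd_mul_sq hs w]
  push_cast
  have he : invSd s w ^ 2 = ((s : ℝ) ^ 2 + (w : ℝ) ^ 2)⁻¹ := by
    rw [invSd, inv_pow, Real.sq_sqrt h1.le]
  have hsq : √((s : ℝ) ^ 2 * invSd s w ^ 2) = s / √((s : ℝ) ^ 2 + (w : ℝ) ^ 2) := by
    rw [← mul_pow, Real.sqrt_sq (by have := invSd_pos hs w; positivity), invSd]
    rfl
  have harg : -(y - z) ^ 2 / (2 * (s : ℝ) ^ 2) = -(y - m) ^ 2 / (2 * ((s : ℝ) ^ 2 + (w : ℝ) ^ 2)) +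
      ((invSd s w * (y - m)) ^ 2 / 2 - (invSd s w * (y - m) - invSd s w * (z - m)) ^ 2 /
        (2 * ((s : ℝ) ^ 2 * invSd s w ^ 2))) := by
    have e1 : (invSd s w * (y - m) - invSd s w * (z - m)) ^ 2 = invSd s w ^ 2 * (y - z) ^ 2 := by
      ring
    rw [e1, mul_pow, he]
    field_simp
    ring
  rw [harg, Real.exp_add, hsq, Real.sqrt_mul (by positivity), Real.sqrt_mul (by positivity),
    Real.sqrt_sq h0.le]
  have h3 : √(2 * Real.pi * ((s : ℝ) ^ 2 + (w : ℝ) ^ 2)) =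
      √2 * √Real.pi * √((s : ℝ) ^ 2 + (w : ℝ) ^ 2) := by
    rw [Real.sqrt_mul (by positivity), Real.sqrt_mul (by positivity)]
  have : √((s : ℝ) ^ 2 + (w : ℝ) ^ 2) ≠ 0 := by positivity
  rw [h3]
  field_simp

theorem gaussianReal_eq_withDensity {s : ℝ≥0} (hs : 0 < s) (w : ℝ≥0) (m z : ℝ) :
    gaussianReal z (s ^ 2) = (refGauss s w m).withDensity fun y =>
      ENNReal.ofReal (gaussRatio (invSd s w) w m (invSd s w * (y - m)) z) := by
  have hs2 : s ^ 2 ≠ 0 := by positivity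
  have hsw : s ^ 2 + w ^ 2 ≠ 0 := by positivity
  have hc := continuous_gaussRatio (invSd s w) w m
  have hm : Measurable fun y =>
      ENNReal.ofReal (gaussRatio (invSd s w) w m (invSd s w * (y - m)) z) := by
    refine ENNReal.measurable_ofReal.comp (Continuous.measurable ?_)
    exact hc.comp (f := fun y : ℝ => (invSd s w * (y - m), z)) (by fun_prop)
  rw [refGauss, gaussianReal_of_var_ne_zero _ hs2, gaussianReal_of_var_ne_zero _ hsw,
    ← withDensity_mul _ (measurable_gaussianPDF _ _) hm]
  congr 1
  ext y
  rw [Pi.mul_apply, gaussianPDF, gaussianPDF, ← ENNReal.ofReal_mul (gaussianPDFReal_nonneg _ _ _),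
    ← gaussianPDFReal_eq_mul_gaussRatio hs]

theorem gaussRatio_le {ε w : ℝ} (h : (ε * w) ^ 2 < 1) (m τ z : ℝ) :
    gaussRatio ε w m τ z ≤ (√(1 - (ε * w) ^ 2))⁻¹ * Real.exp (τ ^ 2 / 2) := by
  have : 0 < 1 - (ε * w) ^ 2 := by linarith
  unfold gaussRatio
  gcongr
  have : 0 ≤ (τ - ε * (z - m)) ^ 2 / (2 * (1 - (ε * w) ^ 2)) := by positivity
  linarith

theorem integrable_gaussRatio {ν : Measure ℝ} [IsProbabilityMeasure ν] {ε w : ℝ}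
    (h : (ε * w) ^ 2 < 1) (m τ : ℝ) : Integrable (gaussRatio ε w m τ) ν := by
  refine (integrable_const ((√(1 - (ε * w) ^ 2))⁻¹ * Real.exp (τ ^ 2 / 2))).mono' ?_
    (ae_of_all _ fun z => ?_)
  · exact ((continuous_gaussRatio ε w m).comp
      (f := fun z : ℝ => (τ, z)) (by fun_prop)).aestronglyMeasurable
  · rw [Real.norm_eq_abs, abs_of_pos (gaussRatio_pos h m τ z)]
    exact gaussRatio_le h m τ z

theorem mixRatio_le_exp {ν : Measure ℝ} [IsProbabilityMeasure ν] {ε w : ℝ}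
    (h : (ε * w) ^ 2 < 1) (m τ : ℝ) :
    mixRatio ν ε w m τ ≤ (√(1 - (ε * w) ^ 2))⁻¹ * Real.exp (τ ^ 2 / 2) := by
  have := integral_mono (μ := ν) (integrable_gaussRatio h m τ) (integrable_const _)
    (fun z => gaussRatio_le h m τ z)
  simpa [mixRatio] using this

/-- Jensen's inequality: the left exponent is the `ν`-mean of the exponent in `gaussRatio`, which
depends on `ν` only through its mean and variance. The lower bound is thus the same for all
conditional laws. -/
theorem exp_le_mixRatio {ν : Measure ℝ} [IsProbabilityMeasure ν] {ε w m : ℝ}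
    (h : (ε * w) ^ 2 < 1) (hν : ∀ k : ℕ, MemLp id k ν) (hm : ∫ z, z ∂ν = m)
    (hv : ∫ z, z ^ 2 ∂ν = m ^ 2 + w ^ 2) (τ : ℝ) :
    Real.exp (τ ^ 2 / 2 - (τ ^ 2 + (ε * w) ^ 2) / (2 * (1 - (ε * w) ^ 2))) ≤
      mixRatio ν ε w m τ := by
  set a := 1 - (ε * w) ^ 2 with ha
  have ha0 : 0 < a := by rw [ha]; linarith
  set c := τ ^ 2 / 2 - (τ ^ 2 + (ε * w) ^ 2) / (2 * a) with hc
  -- The tangent line of the exponential at `c`; the prefactor of `gaussRatio` is at least `1` and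
  -- is dropped.
  have hlow : ∀ z, Real.exp c * (1 - c + (τ ^ 2 / 2 - (τ - ε * (z - m)) ^ 2 / (2 * a))) ≤
      gaussRatio ε w m τ z := by
    intro z
    set l := τ ^ 2 / 2 - (τ - ε * (z - m)) ^ 2 / (2 * a) with hl
    have h1 : 1 ≤ (√a)⁻¹ := by
      refine (one_le_inv₀ (Real.sqrt_pos.2 ha0)).2 (Real.sqrt_le_one.2 ?_)
      rw [ha]; nlinarith [sq_nonneg (ε * w)]
    have h2 : Real.exp l = Real.exp c * Real.exp (l - c) := by rw [← Real.exp_add]; congr 1; ring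
    have h3 := Real.add_one_le_exp (l - c)
    calc Real.exp c * (1 - c + l) ≤ Real.exp c * Real.exp (l - c) := by gcongr; linarith
      _ = Real.exp l := h2.symm
      _ ≤ (√a)⁻¹ * Real.exp l := le_mul_of_one_le_left (Real.exp_pos _).le h1
      _ = _ := by rw [gaussRatio]
  have hi1 : Integrable (fun z : ℝ => z) ν := by simpa using integrable_pow_of_memLp hν 1
  have hi2 : Integrable (fun z : ℝ => z ^ 2) ν := integrable_pow_of_memLp hν 2
  have hform : ∀ z, Real.exp c * (1 - c + (τ ^ 2 / 2 - (τ - ε * (z - m)) ^ 2 / (2 * a))) =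
      Real.exp c * (1 - c + τ ^ 2 / 2 - (τ + ε * m) ^ 2 / (2 * a)) +
      Real.exp c * ((τ + ε * m) * ε / a) * z + (-(Real.exp c * (ε ^ 2 / (2 * a)))) * z ^ 2 := by
    intro z
    field_simp
    ring
  have hI : Integrable (fun z => Real.exp c *
      (1 - c + (τ ^ 2 / 2 - (τ - ε * (z - m)) ^ 2 / (2 * a)))) ν := by
    simp_rw [hform]
    exact ((integrable_const _).add (hi1.const_mul _)).add (hi2.const_mul _)
  have hmono := integral_mono hI (integrable_gaussRatio h m τ) hlow
  refine le_trans (le_of_eq ?_) hmono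
  simp_rw [hform]
  have hJ : Integrable (fun z : ℝ =>
      Real.exp c * (1 - c + τ ^ 2 / 2 - (τ + ε * m) ^ 2 / (2 * a)) +
      Real.exp c * ((τ + ε * m) * ε / a) * z) ν := (integrable_const _).add (hi1.const_mul _)
  rw [integral_add hJ (hi2.const_mul _), integral_add (integrable_const _) (hi1.const_mul _)]
  have hK : ∫ z, Real.exp c * ((τ + ε * m) * ε / a) * z ∂ν =
      Real.exp c * ((τ + ε * m) * ε / a) * m := by rw [integral_const_mul, hm]
  have hK2 : ∫ z, (-(Real.exp c * (ε ^ 2 / (2 * a)))) * z ^ 2 ∂ν =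
      (-(Real.exp c * (ε ^ 2 / (2 * a)))) * (m ^ 2 + w ^ 2) := by rw [integral_const_mul, hv]
  rw [hK, hK2]
  simp only [integral_const, probReal_univ, smul_eq_mul, one_mul]
  rw [hc]
  generalize Real.exp (τ ^ 2 / 2 - (τ ^ 2 + (ε * w) ^ 2) / (2 * a)) = E
  field_simp
  ring

theorem mixRatio_pos (ν : Measure ℝ) [IsProbabilityMeasure ν] {ε w : ℝ}
    (h : (ε * w) ^ 2 < 1) (m τ : ℝ) : 0 < mixRatio ν ε w m τ := by
  rw [mixRatio, integral_pos_iff_support_of_nonneg (fun z => (gaussRatio_pos h m τ z).le)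
    (integrable_gaussRatio h m τ)]
  have : Function.support (gaussRatio ε w m τ) = Set.univ := by
    ext z; simp [(gaussRatio_pos h m τ z).ne']
  rw [this]
  simp

/-- `log (mixRatio ν ε w m τ)` grows at most quadratically, uniformly in `ν`. -/
theorem abs_log_mixRatio_le {ε w : ℝ} (h : (ε * w) ^ 2 < 1) : ∃ C : ℝ, 0 ≤ C ∧
    ∀ (ν : Measure ℝ) [IsProbabilityMeasure ν] (m : ℝ), (∀ k : ℕ, MemLp id k ν) →
      ∫ z, z ∂ν = m → ∫ z, z ^ 2 ∂ν = m ^ 2 + w ^ 2 → ∀ τ : ℝ,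
      |Real.log (mixRatio ν ε w m τ)| ≤ C * (1 + τ ^ 2) := by
  have ha0 : 0 < 1 - (ε * w) ^ 2 := by linarith
  refine ⟨|Real.log ((√(1 - (ε * w) ^ 2))⁻¹)| + 1 + 1 / (1 - (ε * w) ^ 2), by positivity, ?_⟩
  intro ν _ m hν hm hv τ
  have h1 := Real.log_le_log (mixRatio_pos ν h m τ) (mixRatio_le_exp h m τ)
  rw [Real.log_mul (by positivity) (by positivity), Real.log_exp] at h1
  have h2 := Real.log_le_log (Real.exp_pos _) (exp_le_mixRatio h hν hm hv τ)
  rw [Real.log_exp] at h2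
  set L := |Real.log ((√(1 - (ε * w) ^ 2))⁻¹)|
  have hL0 : 0 ≤ L := abs_nonneg _
  have hL := le_abs_self (Real.log ((√(1 - (ε * w) ^ 2))⁻¹))
  have hdiv : (τ ^ 2 + (ε * w) ^ 2) / (2 * (1 - (ε * w) ^ 2)) ≤
      1 / (1 - (ε * w) ^ 2) * (1 + τ ^ 2) := by
    rw [div_le_iff₀ (by positivity)]
    have : 1 / (1 - (ε * w) ^ 2) * (1 + τ ^ 2) * (2 * (1 - (ε * w) ^ 2)) = 2 * (1 + τ ^ 2) := by
      rw [one_div]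
      linear_combination (2 * (1 + τ ^ 2)) * inv_mul_cancel₀ ha0.ne'
    rw [this]
    nlinarith [sq_nonneg τ]
  have p1 : 0 ≤ 1 / (1 - (ε * w) ^ 2) * (1 + τ ^ 2) := by positivity
  have p2 : 0 ≤ L * τ ^ 2 := by positivity
  have p3 := sq_nonneg τ
  rw [abs_le]
  constructor <;> nlinarith

theorem stronglyMeasurable_outDens (ν : Measure ℝ) [IsProbabilityMeasure ν] (s w : ℝ≥0) (m : ℝ) :
    StronglyMeasurable (outDens ν s w m) :=
  (stronglyMeasurable_mixRatio ν (invSd s w) w m).comp_measurable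
    (g := fun y => invSd s w * (y - m)) (by fun_prop)

/-- Tonelli's theorem in test-function form, which yields both the marginal law of the output and,
fibrewise over `X`, the joint law. -/
theorem lintegral_gaussian_conv {s : ℝ≥0} (hs : 0 < s) (w : ℝ≥0) (m : ℝ) (ν : Measure ℝ)
    [IsProbabilityMeasure ν] {F : ℝ → ℝ≥0∞} (hF : Measurable F) :
    ∫⁻ z, ∫⁻ n, F (z + n) ∂(gaussianReal 0 (s ^ 2)) ∂ν =
      ∫⁻ y, ENNReal.ofReal (outDens ν s w m y) * F y ∂(refGauss s w m) := by
  have hlt := invSd_mul_sq_lt_one hs w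
  have hm2 : Measurable fun p : ℝ × ℝ =>
      ENNReal.ofReal (gaussRatio (invSd s w) w m (invSd s w * (p.2 - m)) p.1) := by
    refine ENNReal.measurable_ofReal.comp (Continuous.measurable ?_)
    exact (continuous_gaussRatio (invSd s w) w m).comp
      (f := fun p : ℝ × ℝ => (invSd s w * (p.2 - m), p.1)) (by fun_prop)
  have h1 : ∀ z, ∫⁻ n, F (z + n) ∂(gaussianReal 0 (s ^ 2)) = ∫⁻ y,
      ENNReal.ofReal (gaussRatio (invSd s w) w m (invSd s w * (y - m)) z) * F y
        ∂(refGauss s w m) := by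
    intro z
    have h2 : ∫⁻ n, F (z + n) ∂(gaussianReal 0 (s ^ 2)) = ∫⁻ y, F y ∂(gaussianReal z (s ^ 2)) := by
      have := gaussianReal_map_const_add (μ := 0) (v := s ^ 2) z
      rw [zero_add] at this
      rw [← this, lintegral_map hF (by fun_prop)]
    rw [h2, gaussianReal_eq_withDensity hs w m z, lintegral_withDensity_eq_lintegral_mul _ _ hF]
    · rfl
    · exact hm2.comp (f := fun y => (z, y)) (by fun_prop)
  simp_rw [h1]
  rw [lintegral_lintegral_swap]
  · refine lintegral_congr fun y => ?_
    rw [lintegral_mul_const]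
    · congr 1
      rw [outDens, mixRatio, ofReal_integral_eq_lintegral_ofReal (integrable_gaussRatio hlt m _)
        (ae_of_all _ fun z => (gaussRatio_pos hlt m _ z).le)]
    · exact hm2.comp (f := fun z => (z, y)) (by fun_prop)
  · exact (hm2.mul (hF.comp measurable_snd)).aemeasurable

theorem map_add_gaussian {s : ℝ≥0} (hs : 0 < s) (w : ℝ≥0) (m : ℝ) (ν : Measure ℝ)
    [IsProbabilityMeasure ν] :
    (ν.prod (gaussianReal 0 (s ^ 2))).map (fun p => p.1 + p.2) =
      (refGauss s w m).withDensity fun y => ENNReal.ofReal (outDens ν s w m y) := by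
  ext A hA
  have hd : Measurable fun y => ENNReal.ofReal (outDens ν s w m y) :=
    ENNReal.measurable_ofReal.comp (stronglyMeasurable_outDens ν s w m).measurable
  have hF : Measurable (A.indicator (1 : ℝ → ℝ≥0∞)) := measurable_one.indicator hA
  rw [← lintegral_indicator_one hA, ← lintegral_indicator_one hA,
    lintegral_map hF (by fun_prop), lintegral_withDensity_eq_lintegral_mul _ hd hF,
    lintegral_prod (fun p : ℝ × ℝ => A.indicator 1 (p.1 + p.2))
      (hF.comp (by fun_prop : Measurable fun p : ℝ × ℝ => p.1 + p.2)).aemeasurable]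
  exact lintegral_gaussian_conv hs w m ν hF

theorem integral_outDens {s : ℝ≥0} (hs : 0 < s) (w : ℝ≥0) (m : ℝ) (ν : Measure ℝ)
    [IsProbabilityMeasure ν] :
    Integrable (outDens ν s w m) (refGauss s w m) ∧ ∫ y, outDens ν s w m y ∂(refGauss s w m) = 1 := by
  have h := lintegral_gaussian_conv hs w m ν (F := fun _ => 1) measurable_const
  simp only [lintegral_const, measure_univ, mul_one] at h
  have h0 : ∀ y, 0 ≤ outDens ν s w m y := fun y =>
    mixRatio_nonneg ν m _ (invSd_mul_sq_lt_one hs w)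
  have hm := (stronglyMeasurable_outDens ν s w m).aestronglyMeasurable (μ := refGauss s w m)
  constructor
  · refine ⟨hm, ?_⟩
    rw [hasFiniteIntegral_iff_ofReal (ae_of_all _ h0), ← h]
    exact ENNReal.one_lt_top
  · rw [integral_eq_lintegral_of_nonneg_ae (ae_of_all _ h0) hm, ← h]
    simp

/-- The correction `1 - r` in `klFun r = r log r + 1 - r` integrates to zero, because `r` is a
probability density. -/
theorem integral_outDens_mul_log {s : ℝ≥0} (hs : 0 < s) (w : ℝ≥0) (m : ℝ) (ν : Measure ℝ)
    [IsProbabilityMeasure ν]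
    (hint : Integrable (fun τ => klFun (mixRatio ν (invSd s w) w m τ)) (gaussianReal 0 1)) :
    ∫ y, outDens ν s w m y * Real.log (outDens ν s w m y) ∂(refGauss s w m) =
      ∫ τ, klFun (mixRatio ν (invSd s w) w m τ) ∂(gaussianReal 0 1) := by
  obtain ⟨hi, h1⟩ := integral_outDens hs w m ν
  have hmap := map_refGauss hs w m
  have hmeas : Measurable fun y => invSd s w * (y - m) := by fun_prop
  rw [← hmap] at hint ⊢
  have hint2 := hint.comp_measurable hmeas
  rw [integral_map hmeas.aemeasurable hint.aestronglyMeasurable]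
  have heq : ∀ y, outDens ν s w m y * Real.log (outDens ν s w m y) =
      klFun (mixRatio ν (invSd s w) w m (invSd s w * (y - m))) - 1 + outDens ν s w m y := by
    intro y
    rw [klFun_apply, outDens]; ring
  simp_rw [heq]
  have hint3 : Integrable (fun y => klFun (mixRatio ν (invSd s w) w m (invSd s w * (y - m))))
    (refGauss s w m) := hint2
  rw [integral_add (f := fun y => klFun (mixRatio ν (invSd s w) w m (invSd s w * (y - m))) - 1)
    (hint3.sub (integrable_const 1)) hi, h1, integral_sub hint3 (integrable_const 1)]
  simp

end GaussChannel

/-! ### Divergence of a joint law from the product of its marginals. -/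

namespace GaussChannel
open GaussHermite

/-- Mutual information as a difference of two divergences from a common reference law. -/
theorem klDiv_withDensity_prod {𝓧 𝓨 : Type*} [MeasurableSpace 𝓧] [MeasurableSpace 𝓨]
    {ρ : Measure 𝓧} [IsProbabilityMeasure ρ] {G : Measure 𝓨} [IsProbabilityMeasure G]
    {f : 𝓧 × 𝓨 → ℝ} {g : 𝓨 → ℝ} (hf : Measurable f) (hg : Measurable g)
    (hf0 : ∀ p, 0 < f p) (hg0 : ∀ y, 0 < g y) {J : Measure (𝓧 × 𝓨)} {M : Measure 𝓨}
    [IsProbabilityMeasure J] [IsProbabilityMeasure M]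
    (hJ : J = (ρ.prod G).withDensity fun p => ENNReal.ofReal (f p))
    (hM : M = G.withDensity fun y => ENNReal.ofReal (g y)) (hJM : J.map Prod.snd = M)
    (hfi : Integrable (fun p => Real.log (f p)) J) (hgi : Integrable (fun y => Real.log (g y)) M) :
    klDiv J (ρ.prod M) ≠ ∞ ∧
    Integrable (fun x => ∫ y, f (x, y) * Real.log (f (x, y)) ∂G) ρ ∧
    (klDiv J (ρ.prod M)).toReal =
      ∫ x, ∫ y, f (x, y) * Real.log (f (x, y)) ∂G ∂ρ - ∫ y, g y * Real.log (g y) ∂G := by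
  have hfm : Measurable fun p => ENNReal.ofReal (f p) := hf.ennreal_ofReal
  have hgm : Measurable fun y => ENNReal.ofReal (g y) := hg.ennreal_ofReal
  have hqm : Measurable fun p : 𝓧 × 𝓨 => ENNReal.ofReal (f p / g p.2) :=
    (hf.div (hg.comp measurable_snd)).ennreal_ofReal
  -- The reference law cancels: relative to the product of the marginals the joint density is `f /
  -- g`. Since both logarithms are integrable under `J`, its logarithm may be split.
  have hJ2 : J = (ρ.prod M).withDensity fun p => ENNReal.ofReal (f p / g p.2) := by
    have hgm2 : Measurable fun p : 𝓧 × 𝓨 => ENNReal.ofReal (g p.2) := hgm.comp measurable_snd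
    rw [hM, prod_withDensity_right hgm, ← withDensity_mul _ hgm2 hqm, hJ]
    congr 1
    ext p
    rw [Pi.mul_apply, ← ENNReal.ofReal_mul (hg0 _).le,
      mul_div_cancel₀ _ (hg0 _).ne']
  have hac : J ≪ ρ.prod M := by
    rw [hJ2]; exact withDensity_absolutelyContinuous _ _
  have hrn : J.rnDeriv (ρ.prod M) =ᵐ[J] fun p => ENNReal.ofReal (f p / g p.2) := by
    have h := Measure.rnDeriv_withDensity (ρ.prod M) hqm
    rw [← hJ2] at h
    exact hac.ae_eq h
  have hllr : llr J (ρ.prod M) =ᵐ[J] fun p => Real.log (f p) - Real.log (g p.2) := by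
    filter_upwards [hrn] with p hp
    rw [llr, hp, ENNReal.toReal_ofReal (div_pos (hf0 _) (hg0 _)).le,
      Real.log_div (hf0 _).ne' (hg0 _).ne']
  have hgi2 : Integrable (fun p : 𝓧 × 𝓨 => Real.log (g p.2)) J := by
    rw [← hJM] at hgi
    exact hgi.comp_measurable measurable_snd
  have hint : Integrable (llr J (ρ.prod M)) J := (hfi.sub hgi2).congr hllr.symm
  have hfi2 : Integrable (fun p => f p * Real.log (f p)) (ρ.prod G) := by
    rw [hJ, integrable_withDensity_iff_integrable_smul' hfm
      (ae_of_all _ fun p => ENNReal.ofReal_lt_top)] at hfi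
    refine hfi.congr (ae_of_all _ fun p => ?_)
    simp [ENNReal.toReal_ofReal (hf0 p).le]
  refine ⟨klDiv_ne_top hac hint, hfi2.integral_prod_left, ?_⟩
  rw [toReal_klDiv_of_measure_eq hac (by simp), integral_congr_ae hllr, integral_sub hfi hgi2]
  congr 1
  · rw [← integral_prod _ hfi2, hJ, integral_withDensity_eq_integral_toReal_smul hfm
      (ae_of_all _ fun p => ENNReal.ofReal_lt_top)]
    refine integral_congr_ae (ae_of_all _ fun p => ?_)
    simp [ENNReal.toReal_ofReal (hf0 p).le]
  · have h1 : ∫ p, Real.log (g p.2) ∂J = ∫ y, Real.log (g y) ∂M := by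
      rw [← hJM, integral_map measurable_snd.aemeasurable hg.log.aestronglyMeasurable]
    rw [h1, hM, integral_withDensity_eq_integral_toReal_smul hgm
      (ae_of_all _ fun p => ENNReal.ofReal_lt_top)]
    refine integral_congr_ae (ae_of_all _ fun p => ?_)
    simp [ENNReal.toReal_ofReal (hg0 p).le]

section
variable {𝓧 : Type*} [MeasurableSpace 𝓧]

theorem measurable_outDens_kernel (η : Kernel 𝓧 ℝ) [IsMarkovKernel η] (s w : ℝ≥0) (m : ℝ) :
    Measurable fun p : 𝓧 × ℝ => outDens (η p.1) s w m p.2 := by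
  have h : StronglyMeasurable (Function.uncurry fun (p : 𝓧 × ℝ) (z : ℝ) =>
      gaussRatio (invSd s w) w m (invSd s w * (p.2 - m)) z) := by
    refine Measurable.stronglyMeasurable ?_
    exact (continuous_gaussRatio (invSd s w) w m).measurable.comp
      (f := fun q : (𝓧 × ℝ) × ℝ => (invSd s w * (q.1.2 - m), q.2)) (by fun_prop)
  have h2 := (h.integral_kernel_prod_right (κ := η.comap Prod.fst measurable_fst)).measurable
  simpa only [Kernel.comap_apply, outDens, mixRatio] using h2

theorem map_compProd_add_gaussian {s : ℝ≥0} (hs : 0 < s) (w : ℝ≥0) (m : ℝ) (ρ : Measure 𝓧)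
    [IsProbabilityMeasure ρ] (η : Kernel 𝓧 ℝ) [IsMarkovKernel η] :
    ((ρ ⊗ₘ η).prod (gaussianReal 0 (s ^ 2))).map (fun q => (q.1.1, q.1.2 + q.2)) =
      (ρ.prod (refGauss s w m)).withDensity
        fun p => ENNReal.ofReal (outDens (η p.1) s w m p.2) := by
  ext A hA
  have hd := (measurable_outDens_kernel η s w m).ennreal_ofReal
  have hF : Measurable (A.indicator (1 : 𝓧 × ℝ → ℝ≥0∞)) := measurable_one.indicator hA
  have hq : Measurable fun q : (𝓧 × ℝ) × ℝ => (q.1.1, q.1.2 + q.2) := by fun_prop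
  rw [← lintegral_indicator_one hA, ← lintegral_indicator_one hA,
    lintegral_map hF hq, lintegral_withDensity_eq_lintegral_mul _ hd hF,
    lintegral_prod (fun q : (𝓧 × ℝ) × ℝ => A.indicator 1 (q.1.1, q.1.2 + q.2))
      (hF.comp hq).aemeasurable,
    Measure.lintegral_compProd (f := fun p : 𝓧 × ℝ =>
      ∫⁻ n, A.indicator 1 (p.1, p.2 + n) ∂(gaussianReal 0 (s ^ 2)))
      (Measurable.lintegral_prod_right' (f := fun q : (𝓧 × ℝ) × ℝ =>
        A.indicator (1 : 𝓧 × ℝ → ℝ≥0∞) (q.1.1, q.1.2 + q.2)) (hF.comp hq)),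
    lintegral_prod _ (hd.mul hF).aemeasurable]
  refine lintegral_congr fun x => ?_
  exact lintegral_gaussian_conv hs w m (η x) (F := fun y => A.indicator 1 (x, y))
    (hF.comp measurable_prodMk_left)

end

end GaussChannel

/-! ### Moments of conditional laws and conditional cumulants. -/

/-- Functions with all moments are closed under products, by Hölder's inequality with exponents
`2n`, `2n`, `n`. -/
theorem memLp_mul_of_forall {α : Type*} [MeasurableSpace α] {μ : Measure α} {f g : α → ℝ}
    (hf : ∀ n : ℕ, MemLp f n μ) (hg : ∀ n : ℕ, MemLp g n μ) (n : ℕ) :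
    MemLp (fun x => f x * g x) n μ := by
  have : ENNReal.HolderTriple ((2 * n : ℕ) : ℝ≥0∞) ((2 * n : ℕ) : ℝ≥0∞) n := by
    refine ⟨?_⟩
    push_cast
    rw [ENNReal.mul_inv (by simp) (by simp), ← add_mul, ENNReal.inv_two_add_inv_two, one_mul]
  exact (hg (2 * n)).mul (hf (2 * n))

theorem memLp_pow_of_forall {α : Type*} [MeasurableSpace α] {μ : Measure α} [IsFiniteMeasure μ]
    {f : α → ℝ} (hf : ∀ n : ℕ, MemLp f n μ) (k n : ℕ) : MemLp (fun x => f x ^ k) n μ := by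
  induction k generalizing n with
  | zero => simpa using memLp_const (1 : ℝ)
  | succ k ih => simpa only [pow_succ] using memLp_mul_of_forall ih hf n

theorem integrable_of_forall_memLp {α : Type*} [MeasurableSpace α] {μ : Measure α}
    {f : α → ℝ} (hf : ∀ n : ℕ, MemLp f n μ) : Integrable f μ :=
  memLp_one_iff_integrable.1 (by simpa using hf 1)

section
variable {Ω 𝓧 : Type*} [MeasurableSpace Ω] [m𝓧 : MeasurableSpace 𝓧] {P : Measure Ω}
  [IsProbabilityMeasure P] {X : Ω → 𝓧} {Z : Ω → ℝ}

theorem memLp_integral_condDistrib (hX : Measurable X) (hZ : Measurable Z) {f : ℝ → ℝ}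
    (hf : Measurable f) (hfZ : ∀ n : ℕ, MemLp (fun ω => f (Z ω)) n P) (n : ℕ) :
    MemLp (fun ω => ∫ z, f z ∂(condDistrib Z X P (X ω))) n P := by
  have h := condExp_ae_eq_integral_condDistrib hX hZ.aemeasurable hf.stronglyMeasurable
    (integrable_of_forall_memLp hfZ)
  -- Conditional expectation contracts `Lᵖ` only for `p ≥ 1`; passing through `n + 1` covers `n =
  -- 0`.
  have h1 : MemLp (fun ω => ∫ z, f z ∂(condDistrib Z X P (X ω))) ((n + 1 : ℕ) : ℝ≥0∞) P :=
    (memLp_congr_ae h).1 ((hfZ (n + 1)).condExp (by exact_mod_cast Nat.le_add_left 1 n))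
  exact h1.mono_exponent (by exact_mod_cast Nat.le_succ n)

theorem ae_memLp_condDistrib (hX : Measurable X) (hZ : Measurable Z)
    (hmom : ∀ n : ℕ, MemLp Z n P) :
    ∀ᵐ x ∂(P.map X), ∀ n : ℕ, MemLp id n (condDistrib Z X P x) := by
  refine ae_all_iff.2 fun n => ?_
  have hi : Integrable (fun p : 𝓧 × ℝ => ‖p.2‖ ^ n) (P.map fun ω => (X ω, Z ω)) := by
    rw [integrable_map_measure (by fun_prop) (by fun_prop)]
    exact (hmom n).integrable_norm_pow'
  filter_upwards [hi.condDistrib_ae_map hZ.aemeasurable] with x hx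
  rcases Nat.eq_zero_or_pos n with rfl | hn
  · simpa using (measurable_id (α := ℝ)).aestronglyMeasurable
  · refine (integrable_norm_rpow_iff (by fun_prop) (by exact_mod_cast hn.ne') (by simp)).1 ?_
    simpa using hx

/-- Conditional cumulants have finite moments of all orders. -/
theorem memLp_cumulant_condDistrib (hX : Measurable X) (hZ : Measurable Z)
    (hmom : ∀ n : ℕ, MemLp Z n P) (k p : ℕ) :
    MemLp (fun ω => cumulant (condDistrib Z X P (X ω)) (k + 1)) p P := by
  induction k using Nat.strong_induction_on generalizing p with
  | _ k ih =>
    have hM : ∀ i q : ℕ, MemLp (fun ω => ∫ z, z ^ i ∂(condDistrib Z X P (X ω))) q P :=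
      fun i => memLp_integral_condDistrib hX hZ (by fun_prop) (memLp_pow_of_forall hmom i)
    -- The moment recursion solved for its top cumulant, which occurs with coefficient `1`.
    have heq : (fun ω => (∫ z, z ^ (k + 1) ∂(condDistrib Z X P (X ω))) -
        ∑ i ∈ Finset.range k, (k.choose (i + 1) : ℝ) *
          ((∫ z, z ^ (i + 1) ∂(condDistrib Z X P (X ω))) *
            cumulant (condDistrib Z X P (X ω)) (k - (i + 1) + 1))) =ᵐ[P]
        fun ω => cumulant (condDistrib Z X P (X ω)) (k + 1) := by
      filter_upwards [ae_of_ae_map hX.aemeasurable (ae_memLp_condDistrib hX hZ hmom)] with ω hω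
      rw [CumulantMoment.moment_eq_sum_cumulant _ hω, Finset.sum_range_succ']
      simp [mul_assoc]
    refine (memLp_congr_ae heq).1 ((hM _ p).sub (memLp_finsetSum _ fun i hi => ?_))
    have hi' := Finset.mem_range.1 hi
    exact (memLp_mul_of_forall (hM (i + 1)) (ih (k - (i + 1)) (by omega)) p).const_mul _

end

/-! ### Mutual information across the channel. -/

namespace GaussChannel
open GaussHermite

variable {Ω 𝓧 : Type*} [MeasurableSpace Ω] [m𝓧 : MeasurableSpace 𝓧] {P : Measure Ω}
  [IsProbabilityMeasure P] {X : Ω → 𝓧} {Z N : Ω → ℝ} {s : ℝ≥0}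

theorem map_prodMk_add (hs : 0 < s) (w : ℝ≥0) (m : ℝ) (hX : Measurable X) (hZ : Measurable Z)
    (hN : HasLaw N (gaussianReal 0 (s ^ 2)) P) (hind : IndepFun N (fun ω => (X ω, Z ω)) P) :
    P.map (fun ω => (X ω, Z ω + N ω)) = ((P.map X).prod (refGauss s w m)).withDensity
      fun p => ENNReal.ofReal (outDens (condDistrib Z X P p.1) s w m p.2) := by
  have : IsProbabilityMeasure (P.map X) := Measure.isProbabilityMeasure_map hX.aemeasurable
  have hNm := hN.aemeasurable
  have h := (indepFun_iff_map_prod_eq_prod_map_map (by fun_prop) hNm).1 hind.symm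
  rw [hN.map_eq, ← compProd_map_condDistrib hZ.aemeasurable] at h
  rw [← map_compProd_add_gaussian hs, ← h, AEMeasurable.map_map_of_aemeasurable (by fun_prop)
    (by fun_prop)]
  rfl

theorem map_add (hs : 0 < s) (w : ℝ≥0) (m : ℝ) (hZ : Measurable Z)
    (hN : HasLaw N (gaussianReal 0 (s ^ 2)) P) (hind : IndepFun N Z P) :
    P.map (fun ω => Z ω + N ω) = (refGauss s w m).withDensity
      fun y => ENNReal.ofReal (outDens (P.map Z) s w m y) := by
  have : IsProbabilityMeasure (P.map Z) := Measure.isProbabilityMeasure_map hZ.aemeasurable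
  have hNm := hN.aemeasurable
  have h := (indepFun_iff_map_prod_eq_prod_map_map (by fun_prop) hNm).1 hind.symm
  rw [hN.map_eq] at h
  rw [← map_add_gaussian hs, ← h, AEMeasurable.map_map_of_aemeasurable (by fun_prop)
    (by fun_prop)]
  rfl

/-- The mutual information across an additive Gaussian channel, through the output densities. -/
theorem mutualInfo_add_gaussian (hs : 0 < s) {w : ℝ≥0} {m : ℝ} (hX : Measurable X)
    (hZ : Measurable Z) (hmom : ∀ n : ℕ, MemLp Z n P)
    (hm : ∫ z, z ∂(P.map Z) = m) (hw : ∫ z, z ^ 2 ∂(P.map Z) = m ^ 2 + (w : ℝ) ^ 2)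
    (hcm : ∀ᵐ x ∂(P.map X), ∫ z, z ∂(condDistrib Z X P x) = m)
    (hcw : ∀ᵐ x ∂(P.map X), ∫ z, z ^ 2 ∂(condDistrib Z X P x) = m ^ 2 + (w : ℝ) ^ 2)
    (hN : HasLaw N (gaussianReal 0 (s ^ 2)) P) (hind : IndepFun N (fun ω => (X ω, Z ω)) P) :
    mutualInfo P X (fun ω => Z ω + N ω) ≠ ∞ ∧
    Integrable (fun ω => ∫ y, outDens (condDistrib Z X P (X ω)) s w m y *
      Real.log (outDens (condDistrib Z X P (X ω)) s w m y) ∂(refGauss s w m)) P ∧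
    (mutualInfo P X (fun ω => Z ω + N ω)).toReal =
      ∫ ω, ∫ y, outDens (condDistrib Z X P (X ω)) s w m y *
        Real.log (outDens (condDistrib Z X P (X ω)) s w m y) ∂(refGauss s w m) ∂P -
      ∫ y, outDens (P.map Z) s w m y * Real.log (outDens (P.map Z) s w m y)
        ∂(refGauss s w m) := by
  have : IsProbabilityMeasure (P.map X) := Measure.isProbabilityMeasure_map hX.aemeasurable
  have : IsProbabilityMeasure (P.map Z) := Measure.isProbabilityMeasure_map hZ.aemeasurable
  have : IsProbabilityMeasure (refGauss s w m) := by unfold refGauss; infer_instance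
  have hNm := hN.aemeasurable
  have hYm : AEMeasurable (fun ω => Z ω + N ω) P := by fun_prop
  have hXY : AEMeasurable (fun ω => (X ω, Z ω + N ω)) P := by fun_prop
  have : IsProbabilityMeasure (P.map fun ω => (X ω, Z ω + N ω)) :=
    Measure.isProbabilityMeasure_map hXY
  have : IsProbabilityMeasure (P.map fun ω => Z ω + N ω) :=
    Measure.isProbabilityMeasure_map hYm
  have hsq := invSd_mul_sq_lt_one hs w
  have hindZ : IndepFun N Z P := hind.comp (φ := id) (ψ := Prod.snd) measurable_id measurable_snd
  have hf := measurable_outDens_kernel (condDistrib Z X P) s w m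
  have hg : Measurable (outDens (P.map Z) s w m) :=
    (stronglyMeasurable_outDens (P.map Z) s w m).measurable
  have hY2 : MemLp (fun ω => Z ω + N ω) 2 P := by
    have hN2 : MemLp N 2 P := by
      have := memLp_id_gaussianReal (μ := 0) (v := s ^ 2) 2
      rw [← hN.map_eq] at this
      exact this.comp_of_map hNm
    exact (by simpa using hmom 2 : MemLp Z 2 P).add hN2
  have hτ : MemLp (fun ω => invSd s w * (Z ω + N ω - m)) 2 P :=
    (hY2.sub (memLp_const m)).const_mul _
  -- The log densities grow at most quadratically, uniformly in the input law, so their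
  -- integrability reduces to the finite second moment of `Y`. This gives finiteness for every noise
  -- level.
  obtain ⟨C, -, hC⟩ := abs_log_mixRatio_le hsq
  have hB : Integrable (fun ω => C * (1 + (invSd s w * (Z ω + N ω - m)) ^ 2)) P :=
    ((integrable_const _).add hτ.integrable_sq).const_mul C
  have hmomZ : ∀ k : ℕ, MemLp id k (P.map Z) := fun k =>
    (memLp_map_measure_iff (by fun_prop) hZ.aemeasurable).2 (hmom k)
  have hfi : Integrable (fun p : 𝓧 × ℝ => Real.log (outDens (condDistrib Z X P p.1) s w m p.2))
      (P.map fun ω => (X ω, Z ω + N ω)) := by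
    rw [integrable_map_measure hf.log.aestronglyMeasurable hXY]
    refine hB.mono' (hf.log.comp_aemeasurable hXY).aestronglyMeasurable ?_
    filter_upwards [ae_of_ae_map hX.aemeasurable hcm, ae_of_ae_map hX.aemeasurable hcw,
      ae_of_ae_map hX.aemeasurable (ae_memLp_condDistrib hX hZ hmom)] with ω h1 h2 h3
    exact hC _ m h3 h1 h2 _
  have hgi : Integrable (fun y : ℝ => Real.log (outDens (P.map Z) s w m y))
      (P.map fun ω => Z ω + N ω) := by
    rw [integrable_map_measure hg.log.aestronglyMeasurable hYm]
    exact hB.mono' (hg.log.comp_aemeasurable hYm).aestronglyMeasurable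
      (ae_of_all _ fun ω => hC _ m hmomZ hm hw _)
  obtain ⟨r1, r2, r3⟩ := klDiv_withDensity_prod hf hg
    (fun p => mixRatio_pos _ hsq _ _) (fun p => mixRatio_pos _ hsq _ _)
    (map_prodMk_add hs w m hX hZ hN hind) (map_add hs w m hZ hN hindZ)
    (by rw [AEMeasurable.map_map_of_aemeasurable (by fun_prop) hXY]; rfl) hfi hgi
  refine ⟨r1, r2.comp_measurable hX, ?_⟩
  rw [integral_map hX.aemeasurable r2.aestronglyMeasurable] at r3
  exact r3

end GaussChannel

/-! ### Integration over `X` and the final expansion. -/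

namespace GaussChannel
open GaussHermite

theorem integral_klMain {Ω : Type*} [MeasurableSpace Ω] {P : Measure Ω} [IsFiniteMeasure P]
    {f : ℕ → Ω → ℝ} (hf : ∀ k, 3 ≤ k → ∀ n : ℕ, MemLp (f k) n P) (ε : ℝ) :
    Integrable (fun ω => klMain (f 3 ω) (f 4 ω) (f 5 ω) (f 6 ω) ε) P ∧
    ∫ ω, klMain (f 3 ω) (f 4 ω) (f 5 ω) (f 6 ω) ε ∂P =
      (∫ ω, f 3 ω ^ 2 ∂P) / 12 * ε ^ 6 + (∫ ω, f 4 ω ^ 2 ∂P) / 48 * ε ^ 8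
      - (∫ ω, f 3 ω ^ 2 * f 4 ω ∂P) / 8 * ε ^ 10 + (∫ ω, f 5 ω ^ 2 ∂P) / 240 * ε ^ 10
      + 7 * (∫ ω, f 3 ω ^ 4 ∂P) / 48 * ε ^ 12 - (∫ ω, f 4 ω ^ 3 ∂P) / 48 * ε ^ 12
      - (∫ ω, f 3 ω * f 4 ω * f 5 ω ∂P) / 12 * ε ^ 12
      + (∫ ω, f 6 ω ^ 2 ∂P) / 1440 * ε ^ 12 := by
  have h3 := hf 3 le_rfl
  have h4 := hf 4 (by norm_num)
  have h5 := hf 5 (by norm_num)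
  have h6 := hf 6 (by norm_num)
  have i1 : Integrable (fun ω => f 3 ω ^ 2) P :=
    integrable_of_forall_memLp (memLp_pow_of_forall h3 2)
  have i2 : Integrable (fun ω => f 4 ω ^ 2) P :=
    integrable_of_forall_memLp (memLp_pow_of_forall h4 2)
  have i3 : Integrable (fun ω => f 3 ω ^ 2 * f 4 ω) P :=
    integrable_of_forall_memLp (memLp_mul_of_forall (memLp_pow_of_forall h3 2) h4)
  have i4 : Integrable (fun ω => f 5 ω ^ 2) P :=
    integrable_of_forall_memLp (memLp_pow_of_forall h5 2)
  have i5 : Integrable (fun ω => f 3 ω ^ 4) P :=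
    integrable_of_forall_memLp (memLp_pow_of_forall h3 4)
  have i6 : Integrable (fun ω => f 4 ω ^ 3) P :=
    integrable_of_forall_memLp (memLp_pow_of_forall h4 3)
  have i7 : Integrable (fun ω => f 3 ω * f 4 ω * f 5 ω) P :=
    integrable_of_forall_memLp (memLp_mul_of_forall (memLp_mul_of_forall h3 h4) h5)
  have i8 : Integrable (fun ω => f 6 ω ^ 2) P :=
    integrable_of_forall_memLp (memLp_pow_of_forall h6 2)
  have heq : (fun ω => klMain (f 3 ω) (f 4 ω) (f 5 ω) (f 6 ω) ε) = fun ω =>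
      ε ^ 6 / 12 * f 3 ω ^ 2 + ε ^ 8 / 48 * f 4 ω ^ 2 - ε ^ 10 / 8 * (f 3 ω ^ 2 * f 4 ω)
      + ε ^ 10 / 240 * f 5 ω ^ 2 + 7 * ε ^ 12 / 48 * f 3 ω ^ 4 - ε ^ 12 / 48 * f 4 ω ^ 3
      - ε ^ 12 / 12 * (f 3 ω * f 4 ω * f 5 ω) + ε ^ 12 / 1440 * f 6 ω ^ 2 := by
    funext ω
    simp only [klMain]
    ring
  have j1 := i1.const_mul (ε ^ 6 / 12)
  have j2 := j1.add (i2.const_mul (ε ^ 8 / 48))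
  have j3 := j2.sub (i3.const_mul (ε ^ 10 / 8))
  have j4 := j3.add (i4.const_mul (ε ^ 10 / 240))
  have j5 := j4.add (i5.const_mul (7 * ε ^ 12 / 48))
  have j6 := j5.sub (i6.const_mul (ε ^ 12 / 48))
  have j7 := j6.sub (i7.const_mul (ε ^ 12 / 12))
  have j8 := j7.add (i8.const_mul (ε ^ 12 / 1440))
  rw [heq]
  refine ⟨j8, (integral_add j7 (i8.const_mul _)).trans ?_⟩
  rw [integral_sub' j6 (i7.const_mul _), integral_sub' j5 (i6.const_mul _),
    integral_add' j4 (i5.const_mul _), integral_add' j3 (i4.const_mul _),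
    integral_sub' j2 (i3.const_mul _), integral_add' j1 (i2.const_mul _)]
  simp only [integral_const_mul]
  ring

section
variable {Ω 𝓧 : Type*} [MeasurableSpace Ω] [m𝓧 : MeasurableSpace 𝓧] {P : Measure Ω}
  [IsProbabilityMeasure P] {X : Ω → 𝓧} {Z : Ω → ℝ}

theorem ae_integral_condDistrib_eq (hX : Measurable X) (hZ : Measurable Z) {f : ℝ → ℝ}
    (hf : Measurable f) (hfi : Integrable (fun ω => f (Z ω)) P) {c : ℝ}
    (h : P[fun ω => f (Z ω) | m𝓧.comap X] =ᵐ[P] fun _ => c) :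
    ∀ᵐ x ∂(P.map X), ∫ z, f z ∂(condDistrib Z X P x) = c := by
  have hm : StronglyMeasurable fun x => ∫ z, f z ∂(condDistrib Z X P x) :=
    StronglyMeasurable.integral_kernel_prod_right (f := fun _ z => f z)
      (hf.comp measurable_snd).stronglyMeasurable
  rw [ae_map_iff hX.aemeasurable (measurableSet_eq_fun hm.measurable measurable_const)]
  filter_upwards [h, condExp_ae_eq_integral_condDistrib hX hZ.aemeasurable
    hf.stronglyMeasurable hfi] with ω h1 h2
  rw [← h2, h1]

/-- Uniform error bound for the expansion of the mutual information at small `1 / σ`. -/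
theorem exists_abs_mutualInfo_sub_le {w : ℝ≥0} {m : ℝ} (hX : Measurable X)
    (hZ : Measurable Z) (hmom : ∀ n : ℕ, MemLp Z n P)
    (hm : ∫ z, z ∂(P.map Z) = m) (hw : ∫ z, z ^ 2 ∂(P.map Z) = m ^ 2 + (w : ℝ) ^ 2)
    (hcm : ∀ᵐ x ∂(P.map X), ∫ z, z ∂(condDistrib Z X P x) = m)
    (hcw : ∀ᵐ x ∂(P.map X), ∫ z, z ^ 2 ∂(condDistrib Z X P x) = m ^ 2 + (w : ℝ) ^ 2) :
    ∃ C : ℝ, ∀ (s : ℝ≥0) (N : Ω → ℝ), 0 < s → invSd s w ≤ 1 → invSd s w * w ≤ 1 / 2 →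
      HasLaw N (gaussianReal 0 (s ^ 2)) P → IndepFun N (fun ω => (X ω, Z ω)) P →
      |(mutualInfo P X (fun ω => Z ω + N ω)).toReal -
        ((∫ ω, klMain (condCumulant P Z X 3 (X ω)) (condCumulant P Z X 4 (X ω))
            (condCumulant P Z X 5 (X ω)) (condCumulant P Z X 6 (X ω)) (invSd s w) ∂P) -
          klMain (cumulantRV P Z 3) (cumulantRV P Z 4) (cumulantRV P Z 5) (cumulantRV P Z 6)
            (invSd s w))| ≤ C * invSd s w ^ 14 := by
  have : IsProbabilityMeasure (P.map Z) := Measure.isProbabilityMeasure_map hZ.aemeasurable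
  have hmomZ : ∀ k : ℕ, MemLp id k (P.map Z) := fun k =>
    (memLp_map_measure_iff (by fun_prop) hZ.aemeasurable).2 (hmom k)
  obtain ⟨C, hC0, hC⟩ := abs_integral_klFun_mixRatio_sub_klMain_le w.coe_nonneg
  -- The error constant of the conditional laws is random, but it is a power of a conditional moment
  -- and hence integrable; the remainder stays of order `ε¹⁴` after averaging over `X`.
  have hS : Integrable
      (fun ω => (∫ z, (1 + |z - m|) ^ 46 ∂(condDistrib Z X P (X ω))) ^ 5) P := by
    refine integrable_of_forall_memLp (memLp_pow_of_forall
      (memLp_integral_condDistrib hX hZ (by fun_prop)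
        (memLp_pow_of_forall (f := fun ω => 1 + |Z ω - m|) (fun n => ?_) 46)) 5)
    exact (memLp_const (1 : ℝ)).add ((hmom n).sub (memLp_const m)).norm
  refine ⟨C * (∫ ω, (∫ z, (1 + |z - m|) ^ 46 ∂(condDistrib Z X P (X ω))) ^ 5 ∂P) +
    C * (∫ z, (1 + |z - m|) ^ 46 ∂(P.map Z)) ^ 5, fun s N hs h1 h2 hN hind => ?_⟩
  have hε0 : 0 < invSd s w := invSd_pos hs w
  obtain ⟨-, r2, r3⟩ := mutualInfo_add_gaussian hs hX hZ hmom hm hw hcm hcw hN hind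
  have hcum : ∀ k, 3 ≤ k → ∀ n : ℕ, MemLp (fun ω => condCumulant P Z X k (X ω)) n P := by
    intro k hk n
    obtain ⟨j, rfl⟩ : ∃ j, k = j + 1 := ⟨k - 1, by omega⟩
    exact memLp_cumulant_condDistrib hX hZ hmom j n
  have hA := (integral_klMain (f := fun k ω => condCumulant P Z X k (X ω)) hcum (invSd s w)).1
  obtain ⟨b1, b2⟩ := hC (P.map Z) hmomZ m hm hw (invSd s w) hε0 h1 h2
  rw [← integral_outDens_mul_log hs w m (P.map Z) b1] at b2
  have hae : ∀ᵐ ω ∂P, |(∫ y, outDens (condDistrib Z X P (X ω)) s w m y *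
      Real.log (outDens (condDistrib Z X P (X ω)) s w m y) ∂(refGauss s w m)) -
      klMain (condCumulant P Z X 3 (X ω)) (condCumulant P Z X 4 (X ω))
        (condCumulant P Z X 5 (X ω)) (condCumulant P Z X 6 (X ω)) (invSd s w)| ≤
      C * (∫ z, (1 + |z - m|) ^ 46 ∂(condDistrib Z X P (X ω))) ^ 5 * invSd s w ^ 14 := by
    filter_upwards [ae_of_ae_map hX.aemeasurable hcm, ae_of_ae_map hX.aemeasurable hcw,
      ae_of_ae_map hX.aemeasurable (ae_memLp_condDistrib hX hZ hmom)] with ω g1 g2 g3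
    obtain ⟨c1, c2⟩ := hC _ g3 m g1 g2 (invSd s w) hε0 h1 h2
    rw [← integral_outDens_mul_log hs w m _ c1] at c2
    exact c2
  simp_rw [← Real.norm_eq_abs] at hae
  have hD := norm_integral_le_of_norm_le ((hS.const_mul C).mul_const (invSd s w ^ 14)) hae
  rw [integral_sub r2 hA, integral_mul_const, integral_const_mul, Real.norm_eq_abs] at hD
  rw [r3]
  simp only [cumulantRV]
  rw [abs_le] at b2 hD ⊢
  constructor <;> linarith [b2.1, b2.2, hD.1, hD.2]

end

end GaussChannel

theorem mainTheorem5 {Ω 𝓧 : Type*} [MeasurableSpace Ω] [m𝓧 : MeasurableSpace 𝓧]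
    (P : Measure Ω) [IsProbabilityMeasure P]
    (X : Ω → 𝓧) (hX : Measurable X)
    (Z : Ω → ℝ) (hZ : Measurable Z)
    -- all moments (equivalently, all cumulants) of `Z` are finite
    (hmom : ∀ n : ℕ, MemLp Z n P)
    -- the first two conditional moments of `Z` do not depend on `X`
    (h1 : P[Z | m𝓧.comap X] =ᵐ[P] fun _ => ∫ ω, Z ω ∂P)
    (h2 : P[fun ω => Z ω ^ 2 | m𝓧.comap X] =ᵐ[P] fun _ => ∫ ω, Z ω ^ 2 ∂P)
    -- for each `σN > 0`, a Gaussian noise of variance `σN ^ 2` independent of `(X, Z)`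
    (N : ℝ≥0 → Ω → ℝ)
    (hN : ∀ σN : ℝ≥0, 0 < σN → HasLaw (N σN) (gaussianReal 0 (σN ^ 2)) P)
    (hind : ∀ σN : ℝ≥0, 0 < σN → IndepFun (N σN) (fun ω => (X ω, Z ω)) P)
    -- the observation `Y = Z + N` and its standard deviation `σ = σ_Y`
    (Y : ℝ≥0 → Ω → ℝ) (hY : ∀ σN ω, Y σN ω = Z ω + N σN ω)
    (σ : ℝ≥0 → ℝ) (hσ : ∀ σN, σ σN = √(Var[Y σN; P]))
    -- `κ k = κ_k(Z)` and `κc k = κ_k(Z | X)`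
    (κ : ℕ → ℝ) (hκ : ∀ k, κ k = cumulantRV P Z k)
    (κc : ℕ → Ω → ℝ) (hκc : ∀ k ω, κc k ω = condCumulant P Z X k (X ω)) :
    -- the mutual information and all expectations in the expansion are finite
    (∀ σN : ℝ≥0, 0 < σN → mutualInfo P X (Y σN) ≠ ∞) ∧
    (∀ a b c d : ℕ,
      Integrable (fun ω => κc 3 ω ^ a * κc 4 ω ^ b * κc 5 ω ^ c * κc 6 ω ^ d) P) ∧
    -- the expansion
    (fun σN : ℝ≥0 => (mutualInfo P X (Y σN)).toReal -
      (((∫ ω, κc 3 ω ^ 2 ∂P) - κ 3 ^ 2) / (12 * σ σN ^ 6)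
        + ((∫ ω, κc 4 ω ^ 2 ∂P) - κ 4 ^ 2) / (48 * σ σN ^ 8)
        - ((∫ ω, κc 3 ω ^ 2 * κc 4 ω ∂P) - κ 3 ^ 2 * κ 4) / (8 * σ σN ^ 10)
        + ((∫ ω, κc 5 ω ^ 2 ∂P) - κ 5 ^ 2) / (240 * σ σN ^ 10)
        + 7 * ((∫ ω, κc 3 ω ^ 4 ∂P) - κ 3 ^ 4) / (48 * σ σN ^ 12)
        - ((∫ ω, κc 4 ω ^ 3 ∂P) - κ 4 ^ 3) / (48 * σ σN ^ 12)
        - ((∫ ω, κc 3 ω * κc 4 ω * κc 5 ω ∂P) - κ 3 * κ 4 * κ 5) / (12 * σ σN ^ 12)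
        + ((∫ ω, κc 6 ω ^ 2 ∂P) - κ 6 ^ 2) / (1440 * σ σN ^ 12)))
      =O[atTop] (fun σN : ℝ≥0 => 1 / σ σN ^ 14) := by
  have hκc' : κc = fun k ω => condCumulant P Z X k (X ω) := funext₂ hκc
  have hY' : Y = fun s ω => Z ω + N s ω := funext₂ hY
  subst hκc' hY'
  have hcum : ∀ k, 3 ≤ k → ∀ n : ℕ, MemLp (fun ω => condCumulant P Z X k (X ω)) n P := by
    intro k hk n
    obtain ⟨j, rfl⟩ : ∃ j, k = j + 1 := ⟨k - 1, by omega⟩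
    exact memLp_cumulant_condDistrib hX hZ hmom j n
  have hZ2 : MemLp Z 2 P := by simpa using hmom 2
  obtain ⟨m, hm⟩ : ∃ m, ∫ ω, Z ω ∂P = m := ⟨_, rfl⟩
  obtain ⟨w, hw⟩ : ∃ w : ℝ≥0, Var[Z; P] = (w : ℝ) ^ 2 :=
    ⟨⟨√(Var[Z; P]), Real.sqrt_nonneg _⟩, (Real.sq_sqrt (variance_nonneg _ _)).symm⟩
  have hsq : ∫ ω, Z ω ^ 2 ∂P = m ^ 2 + (w : ℝ) ^ 2 := by
    have h := variance_eq_sub hZ2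
    rw [hw, hm] at h
    simp only [Pi.pow_apply] at h
    linarith
  rw [hm] at h1
  rw [hsq] at h2
  have hm' : ∫ z, z ∂(P.map Z) = m := by
    rw [integral_map hZ.aemeasurable (by fun_prop), hm]
  have hw' : ∫ z, z ^ 2 ∂(P.map Z) = m ^ 2 + (w : ℝ) ^ 2 := by
    rw [integral_map hZ.aemeasurable (by fun_prop), hsq]
  have hcm := GaussChannel.ae_integral_condDistrib_eq hX hZ measurable_id
    (integrable_of_forall_memLp hmom) h1
  have hcw := GaussChannel.ae_integral_condDistrib_eq hX hZ (f := fun z => z ^ 2) (by fun_prop)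
    hZ2.integrable_sq h2
  simp only [id] at hcm
  refine ⟨fun s hs => (GaussChannel.mutualInfo_add_gaussian hs hX hZ hmom hm' hw' hcm hcw (hN s hs)
    (hind s hs)).1, fun a b c d => ?_, ?_⟩
  · exact integrable_of_forall_memLp (memLp_mul_of_forall (memLp_mul_of_forall
      (memLp_mul_of_forall (memLp_pow_of_forall (hcum 3 le_rfl) a)
        (memLp_pow_of_forall (hcum 4 (by norm_num)) b))
      (memLp_pow_of_forall (hcum 5 (by norm_num)) c))
      (memLp_pow_of_forall (hcum 6 (by norm_num)) d))
  -- By independence the output variance is `s² + w²`, so the expansion parameter is exactly `1/σ`.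
  have hσ' : ∀ s : ℝ≥0, 0 < s → (σ s)⁻¹ = GaussChannel.invSd s w := by
    intro s hs
    have hNm := (hN s hs).aemeasurable
    have hN2 : MemLp (N s) 2 P := by
      have := memLp_id_gaussianReal (μ := 0) (v := s ^ 2) 2
      rw [← (hN s hs).map_eq] at this
      exact this.comp_of_map hNm
    have hvN : Var[N s; P] = (s : ℝ) ^ 2 := by
      rw [(hN s hs).variance_eq, variance_id_gaussianReal]
      simp
    have hindZ : IndepFun (N s) Z P :=
      (hind s hs).comp (φ := id) (ψ := Prod.snd) measurable_id measurable_snd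
    have hv : Var[fun ω => Z ω + N s ω; P] = (s : ℝ) ^ 2 + (w : ℝ) ^ 2 := by
      have h := IndepFun.variance_add hZ2 hN2 hindZ.symm
      rw [hw, hvN] at h
      rw [add_comm]
      exact h
    rw [hσ, hv, GaussChannel.invSd]
  obtain ⟨C, hC⟩ := GaussChannel.exists_abs_mutualInfo_sub_le hX hZ hmom hm' hw' hcm hcw
  refine IsBigO.of_bound C ?_
  -- Since `1/σ ≤ 1/s`, these two thresholds give `ε ≤ 1` and `ε w ≤ 1/2`.
  filter_upwards [eventually_ge_atTop 1, eventually_ge_atTop (2 * w)] with s hs1 hs2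
  have hs : 0 < s := zero_lt_one.trans_le hs1
  have hs1' : (1 : ℝ) ≤ s := hs1
  have hs2' : 2 * (w : ℝ) ≤ s := hs2
  have hle : GaussChannel.invSd s w ≤ (s : ℝ)⁻¹ :=
    inv_anti₀ (by linarith) (Real.le_sqrt_of_sq_le (by nlinarith [sq_nonneg (w : ℝ)]))
  have hε1 : GaussChannel.invSd s w ≤ 1 := hle.trans (inv_le_one_of_one_le₀ hs1')
  have hε2 : GaussChannel.invSd s w * w ≤ 1 / 2 := by
    have := mul_le_mul_of_nonneg_right hle w.2
    refine this.trans ?_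
    rw [inv_mul_le_iff₀ (by linarith)]
    change (w : ℝ) ≤ _
    linarith
  have h := hC s (N s) hs hε1 hε2 (hN s hs) (hind s hs)
  rw [(GaussChannel.integral_klMain (f := fun k ω => condCumulant P Z X k (X ω)) hcum (GaussChannel.invSd s w)).2] at h
  have hpos := GaussChannel.invSd_pos hs w
  rw [← hσ' s hs] at h hpos
  have hσ0 : 0 < σ s := inv_pos.1 hpos
  rw [Real.norm_eq_abs, Real.norm_eq_abs, abs_of_pos (by positivity : 0 < 1 / σ s ^ 14)]
  refine (le_of_eq ?_).trans (h.trans (le_of_eq (by rw [inv_pow, one_div])))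
  congr 1
  simp only [hκ, GaussHermite.klMain]
  ring
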